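/- **Setting.** An input $(G,f)$ consists of a permutation group $G\le S_n$, $n\ge 1$, given by a list of generators, and a function $f$ on $G$ (with values in a finite set of data objects), available as a black box. It is assumed that $f$ hides a subgroup $H\le G$: $f(a)=f(b)$ iff $a^{-1}b\in H$. A program $P$ for Hidden Subgroup$_D$ maps every input to TRIVIAL or NONTRIVIAL (its answer depends only on the generators and on the function $f$), and it is correct on $(G,f)$ if it answers TRIVIAL exactly when $H=\{id\}$. A program for Hidden Subgroup maps every input to a list of permutations, and is correct on $(G,f)$ if the list generates $H$. A program is correct if it is correct on all inputs where $f$ hides a subgroup. Write $G\wr\mathbb Z_2=\{(g_1,g_2,\tau)\}$ with product $(g_1,g_2,\tau)(g_1',g_2',\tau')=(g_{\tau'(1)}g_1',g_{\tau'(2)}g_2',\tau+\tau')$, acting on $\Gamma=\{1,\dots,n\}\times\{1,2\}$ by $(i,j)\mapsto(g_j(i),\tau(j))$; for functions $f_1,f_2$ on $G$ let $f_1*f_2$ be the function on $G\wr\mathbb Z_2$ with $(g_1,g_2,0)\mapsto(f_1(g_1),f_2(g_2))$ and $(g_1,g_2,1)\mapsto(f_2(g_2),f_1(g_1))$. For $u\in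 G$ let $f^u(g)=f(gu^{-1})$, and let $I_u=(G\wr\mathbb Z_2,\ f*f^u)$. **Search with $P$.** Let $G^{(i)}$ be the pointwise stabilizer of $\{1,\dots,i\}$ in $G$, given by generators computed by some fixed correct routine $R$. For $1\le i\le n$, $j,j'>i$ and $k,l\ge i$, the query $Q(i,j,j',k,l)$ is the group $(G^{(i-1)}\wr\mathbb Z_2)\times B_1\times B_2\times B_3$, where $B_1,B_2,B_3$ are the setwise stabilizers in $S_\Gamma$ of $\{(i,1),(j,2)\}$, $\{(i,2),(j',1)\}$, $\{(k,1),(l,2)\}$, with the function $(g,g_1,g_2,g_3)\mapsto((f*f)(g),gg_1^{-1},gg_2^{-1},gg_3^{-1})$. The search takes the largest $i$, and for it the first $(j,j')$, for which $P$ answers NONTRIVIAL to some $Q(i,j,j',k,l)$, and returns the permutation $h$ which fixes $1,\dots,i-1$ and maps each $k\ge i$ to the first $l\ge i$ such that $P$ answers NONTRIVIAL to $Q(i,j,j',k,l)$; it fails if there is no such $(i,j,j')$, or no such permutation $h$, or if $h=id$ or $h\notin G$. **Checker for Hidden Subgroup$_D$.** $C^P(G,f,0^k)$: if $P(G,f)=$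 NONTRIVIAL, search with $P$ on $(G,f)$; output CORRECT if the search returns some $h$ with $f(h)=f(id)$, and BUGGY otherwise. If $P(G,f)=$ TRIVIAL, draw $u_1,\dots,u_k\in G$ independently and uniformly; output CORRECT if for every $r$ the search with $P$ on $I_{u_r}$ returns $(u_r^{-1},u_r,1)$, and BUGGY otherwise. **Checker for Hidden Subgroup.** Let $S=P(G,f)$. Output BUGGY unless all $s\in S$ lie in $G$ and satisfy $f(s)=f(id)$. Draw $u_1,\dots,u_k\in G$ independently and uniformly. For each $r$, $P(I_{u_r})$ has to be a list of elements of $S_n\wr\mathbb Z_2$ which contains an element of the form $(k_1,k_2,1)$; let $u'$ be the $k_2$ of the first such element, and let $S'$ consist of $k_1,\ u'k_2u'^{-1}$ for each $(k_1,k_2,0)$ and of $u'k_1,\ k_2u'^{-1}$ for each $(k_1,k_2,1)$ in the list. Output BUGGY unless for every $r$ such an element exists, $\langle S'\rangle=\langle S\rangle$ and $u_r\in\langle S\rangle u'$. Otherwise output CORRECT. **Theorem.** 1. Let $P$ be a program for Hidden Subgroup$_D$, $f$ hide a subgroup of $G$, and $k\ge 0$; let $R$ be any correct routine for stabilizer generators.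 If $P$ is a correct program, then $C^P(G,f,0^k)$ always outputs CORRECT. If $P(G,f)$ is incorrect, then $\Pr[C^P(G,f,0^k)\text{ outputs CORRECT}]\le 2^{-k}$. 2. For a suitable correct routine $R$, $C^P(G,f,0^k)$ is carried out, with exactly the same distribution of verdicts, by a nonadaptive probabilistic oracle machine: it uses fair coins, writes down all its queries to $P$ before it receives any answer, and runs in expected polynomial time (in the length of the written input, the unary parameter $0^k$ and the maximal length of a value of $f$; the time spent by $P$ is not counted). The functions of the queries, which $P$ receives as black boxes, are computed by the machine from the black box for $f$ in worst-case polynomial time. 3. The statements of 1 (without $R$) and 2 hold as well for the checker for Hidden Subgroup; here the time bound is polynomial also in the maximal length of an answer of $P$ to a query, and the machine makes exactly $k$ queries besides the query $(G,f)$. -/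

import Mathlib

noncomputable section

namespace HSP

open scoped ENNReal

/-! ## Data, programs, running time -/

/-- Finite binary trees: the data objects on which programs work. -/
inductive Data : Type
  | nil : Data
  | cons : Data → Data → Data

namespace Data

/-- Number of nodes of a tree. -/
def size : Data → ℕ
  | nil => 1
  | cons a b => 1 + a.size + b.size

def head : Data → Data
  | nil => nil
  | cons a _ => a

def tail : Data → Data
  | nil => nil
  | cons _ b => b

/-- One bit. -/
def ofBool : Bool → Data
  | false => nil
  | true => cons nil nil

/-- Unary numerals. -/
def ofNat : ℕ → Data
  | 0 => nil
  | n + 1 => cons nil (ofNat n)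

def ofList : List Data → Data
  | [] => nil
  | a :: l => cons a (ofList l)

/-- A permutation is written down as the list of its values. -/
def ofPerm {n : ℕ} (g : Equiv.Perm (Fin n)) : Data :=
  ofList ((List.finRange n).map fun a => ofNat (g a))

def ofPerms {n : ℕ} (l : List (Equiv.Perm (Fin n))) : Data :=
  ofList (l.map ofPerm)

end Data

/-- Structured programs over trees, with fair coins and a function oracle. -/
inductive Prog : Type
  | copy : Prog
  | nil : Prog
  | head : Prog
  | tail : Prog
  | coin : Prog
  | oracle : Prog
  | pair : Prog → Prog → Prog
  | comp : Prog → Prog → Prog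
  | cond : Prog → Prog → Prog → Prog
  | loop : Prog → Prog

/-- `Run O p d w t a`: with oracle `O`, the program `p` started on `d` tosses exactly the coins `w`
(in this order), halts after time `t`, and outputs `a`.  Every executed instruction costs one plus
the size of the tree it is applied to; an oracle call is also charged for the size of the answer.
`comp q p` runs `p` and then `q`; `loop p` iterates `p` as long as the head of the current tree
is not `nil`. -/
inductive Run (O : Data → Data) : Prog → Data → List Bool → ℕ → Data → Prop
  | copy (d : Data) : Run O .copy d [] (1 + d.size) d
  | nil (d : Data) : Run O .nil d [] (1 + d.size) .nil
  | head (d : Data) : Run O .head d [] (1 + d.size) d.head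
  | tail (d : Data) : Run O .tail d [] (1 + d.size) d.tail
  | coin (d : Data) (b : Bool) : Run O .coin d [b] (1 + d.size) (Data.ofBool b)
  | oracle (d : Data) : Run O .oracle d [] (1 + d.size + (O d).size) (O d)
  | pair {p q : Prog} {d a b : Data} {w w' : List Bool} {t t' : ℕ} :
      Run O p d w t a → Run O q d w' t' b →
      Run O (.pair p q) d (w ++ w') (1 + d.size + t + t') (.cons a b)
  | comp {p q : Prog} {d a b : Data} {w w' : List Bool} {t t' : ℕ} :
      Run O p d w t a → Run O q a w' t' b →
      Run O (.comp q p) d (w ++ w') (1 + d.size + t + t') b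
  | cond_true {c p q : Prog} {d a b : Data} {w w' : List Bool} {t t' : ℕ} :
      Run O c d w t a → a ≠ .nil → Run O p d w' t' b →
      Run O (.cond c p q) d (w ++ w') (1 + d.size + t + t') b
  | cond_false {c p q : Prog} {d a b : Data} {w w' : List Bool} {t t' : ℕ} :
      Run O c d w t a → a = .nil → Run O q d w' t' b →
      Run O (.cond c p q) d (w ++ w') (1 + d.size + t + t') b
  | loop_done {p : Prog} {d : Data} :
      d.head = .nil → Run O (.loop p) d [] (1 + d.size) d
  | loop_step {p : Prog} {d a b : Data} {w w' : List Bool} {t t' : ℕ} :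
      d.head ≠ .nil → Run O p d w t a → Run O (.loop p) a w' t' b →
      Run O (.loop p) d (w ++ w') (1 + d.size + t + t') b

/-! ## Hidden subgroup inputs over permutation groups -/

/-- The group generated by the members of a list. -/
def span {G : Type*} [Group G] (l : List G) : Subgroup G :=
  Subgroup.closure {g | g ∈ l}

/-- An input `(G, f)`: a permutation group of degree `n ≥ 1`, given by a list of generators, and a
function `f` on the group, which is available as a black box only. -/
structure Input : Type where
  n : ℕ
  n_pos : 0 < n
  gens : List (Equiv.Perm (Fin n))
  f : span gens → Data

namespace Input

def G (x : Input) : Subgroup (Equiv.Perm (Fin x.n)) := span x.gens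

/-- `f` hides `H`: it is constant on the left cosets of `H` and separates distinct ones. -/
def Hides (x : Input) (H : Subgroup x.G) : Prop :=
  ∀ a b : x.G, x.f a = x.f b ↔ a⁻¹ * b ∈ H

/-- `f`, extended by `nil` to all permutations. -/
def ev (x : Input) : Equiv.Perm (Fin x.n) → Data :=
  Function.extend (fun g : x.G => (g : Equiv.Perm (Fin x.n))) x.f fun _ => .nil

/-- The oracle through which programs evaluate `f`. -/
def oracle (x : Input) : Data → Data :=
  Function.extend (fun g : x.G => Data.ofPerm (g : Equiv.Perm (Fin x.n))) x.f fun _ => .nil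

/-- The input with the given generators and the restriction of `F` to the group. -/
def build {n : ℕ} (hn : 0 < n) (gens : List (Equiv.Perm (Fin n)))
    (F : Equiv.Perm (Fin n) → Data) : Input :=
  ⟨n, hn, gens, fun g => F g⟩

/-- What is written on the input tape: degree, generators, and the unary security parameter. -/
def code (n : ℕ) (gens : List (Equiv.Perm (Fin n))) : Data :=
  .cons (.ofNat n) (.ofPerms gens)

def tape (x : Input) (k : ℕ) : Data := .cons (code x.n x.gens) (.ofNat k)

/-- Length of the written input plus the maximal length of a value of `f`. -/
def size (x : Input) (k : ℕ) : ℕ := (x.tape k).size + ⨆ g : x.G, (x.f g).size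

end Input

/-! ## Programs to be checked -/

inductive Answer : Type
  | trivial
  | nontrivial

inductive Verdict : Type
  | correct
  | buggy

def Answer.code : Answer → Data
  | .trivial => .ofBool false
  | .nontrivial => .ofBool true

def Verdict.code : Verdict → Data
  | .correct => .ofBool true
  | .buggy => .ofBool false

/-- A (possibly wrong) program for the decision version. -/
abbrev DecisionProgram : Type := Input → Answer

/-- `a` is the right answer when the hidden subgroup is `H`. -/
def RightAnswer {x : Input} (H : Subgroup x.G) (a : Answer) : Prop :=
  a = .trivial ↔ H = ⊥

def DecisionProgram.IsCorrect (P : DecisionProgram) : Prop :=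
  ∀ (x : Input) (H : Subgroup x.G), x.Hides H → RightAnswer H (P x)

/-- A (possibly wrong) program for the problem of finding generators. -/
abbrev GeneratorProgram : Type := (x : Input) → List (Equiv.Perm (Fin x.n))

/-- `l` generates the hidden subgroup `H`. -/
def RightGenerators {x : Input} (H : Subgroup x.G) (l : List (Equiv.Perm (Fin x.n))) : Prop :=
  span l = H.map x.G.subtype

def GeneratorProgram.IsCorrect (P : GeneratorProgram) : Prop :=
  ∀ (x : Input) (H : Subgroup x.G), x.Hides H → RightGenerators H (P x)

/-! ## Wreath products with `ℤ/2` and direct products as permutation groups -/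

/-- The point `(i, j)` of `Γ = {1, …, n} × {1, 2}`. -/
def point {n : ℕ} (i : Fin n) (j : Fin 2) : Fin (n * 2) := finProdFinEquiv (i, j)

/-- The element `(g₁, g₂, τ)` of `Sₙ ≀ ℤ/2`, mapping `(i, j)` to `(g_j i, τ + j)`. -/
def wr {n : ℕ} (t : Equiv.Perm (Fin n) × Equiv.Perm (Fin n) × Fin 2) :
    Equiv.Perm (Fin (n * 2)) :=
  finProdFinEquiv.permCongr
    ((Equiv.prodCongrLeft ![t.1, t.2.1]).trans
      (Equiv.prodCongr (Equiv.refl (Fin n)) (Equiv.addLeft t.2.2)))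

/-- Generators of `G ≀ ℤ/2` from generators of `G`. -/
def wrGens {n : ℕ} (gens : List (Equiv.Perm (Fin n))) : List (Equiv.Perm (Fin (n * 2))) :=
  gens.map (fun s => wr (s, 1, 0)) ++ [wr (1, 1, 1)]

/-- The function `(g₁, g₂, 0) ↦ (F₁ g₁, F₂ g₂)`, `(g₁, g₂, 1) ↦ (F₂ g₂, F₁ g₁)`. -/
def wrFun {n : ℕ} (F₁ F₂ : Equiv.Perm (Fin n) → Data) : Equiv.Perm (Fin (n * 2)) → Data :=
  Function.extend wr
    (fun t => if t.2.2 = 0 then .cons (F₁ t.1) (F₂ t.2.1) else .cons (F₂ t.2.1) (F₁ t.1))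
    fun _ => .nil

/-- The element `(v 0, v 1, v 2, v 3)` of a fourfold direct product, acting on four copies. -/
def block {N : ℕ} (v : Fin 4 → Equiv.Perm (Fin N)) : Equiv.Perm (Fin (4 * N)) :=
  finProdFinEquiv.permCongr (Equiv.prodCongrRight v)

/-- Generators of the setwise stabilizer of `{a, b}` in the full symmetric group. -/
def setStabGens {N : ℕ} (a b : Fin N) : List (Equiv.Perm (Fin N)) :=
  ((List.finRange N ×ˢ List.finRange N).filter
    fun c => decide (c.1 = a ∨ c.1 = b) == decide (c.2 = a ∨ c.2 = b)).map
    fun c => Equiv.swap c.1 c.2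

/-! ## From search to decision -/

/-- A routine that computes generators of the pointwise stabilizers of initial segments. -/
abbrev StabRoutine : Type :=
  (n : ℕ) → List (Equiv.Perm (Fin n)) → Fin n → List (Equiv.Perm (Fin n))

def StabRoutine.IsCorrect (R : StabRoutine) : Prop :=
  ∀ (n : ℕ) (gens : List (Equiv.Perm (Fin n))) (i : Fin n),
    span (R n gens i) = span gens ⊓ fixingSubgroup (Equiv.Perm (Fin n)) {a : Fin n | a < i}

/-- The query for `(i, j, j', k, l)`: with `A` the stabilizer in `G` of all points before `i`, the
group is the product of `A ≀ ℤ/2` and of the setwise stabilizers of `{(i,1), (j,2)}`,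
`{(i,2), (j',1)}`, `{(k,1), (l,2)}`; the function is
`(g, g₁, g₂, g₃) ↦ (f' g, g g₁⁻¹, g g₂⁻¹, g g₃⁻¹)`, where `f'` is `f` on both components. -/
def searchQuery (R : StabRoutine) (x : Input) (i j j' k l : Fin x.n) : Input :=
  Input.build (n := 4 * (x.n * 2)) (by have := x.n_pos; omega)
    ((wrGens (R x.n x.gens i)).map (fun s => block (Pi.mulSingle 0 s)) ++
      (setStabGens (point i 0) (point j 1)).map (fun s => block (Pi.mulSingle 1 s)) ++
      (setStabGens (point i 1) (point j' 0)).map (fun s => block (Pi.mulSingle 2 s)) ++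
      (setStabGens (point k 0) (point l 1)).map (fun s => block (Pi.mulSingle 3 s)))
    (Function.extend block
      (fun v => .ofList [wrFun x.ev x.ev (v 0), .ofPerm (v 0 * (v 1)⁻¹),
        .ofPerm (v 0 * (v 2)⁻¹), .ofPerm (v 0 * (v 3)⁻¹)])
      fun _ => .nil)

/-- All triples `(i, j, j')`, with `i` in decreasing order. -/
def triples (n : ℕ) : List (Fin n × Fin n × Fin n) :=
  (List.finRange n).reverse ×ˢ (List.finRange n ×ˢ List.finRange n)

open Classical in
/-- Look through the answers of `P` for the last `i`, and then the first `j, j' > i`, such that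
some query `(i, j, j', k, l)` with `k, l ≥ i` is answered "nontrivial". -/
def searchTriple (R : StabRoutine) (P : DecisionProgram) (x : Input) :
    Option (Fin x.n × Fin x.n × Fin x.n) :=
  (triples x.n).find? fun c => decide (c.1 < c.2.1 ∧ c.1 < c.2.2 ∧
    ∃ k l, c.1 ≤ k ∧ c.1 ≤ l ∧ P (searchQuery R x c.1 c.2.1 c.2.2 k l) = .nontrivial)

open Classical in
/-- `h` is the nontrivial element of `G` that is read off from the answers for `(i, j, j')`:
it fixes all points before `i` and maps `k ≥ i` to the first `l ≥ i` for which the answer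
to `(i, j, j', k, l)` is "nontrivial". -/
def IsReadOff (R : StabRoutine) (P : DecisionProgram) (x : Input) (i j j' : Fin x.n)
    (h : Equiv.Perm (Fin x.n)) : Prop :=
  h ∈ x.G ∧ h ≠ 1 ∧ (∀ k, k < i → h k = k) ∧
    ∀ k, i ≤ k → ((List.finRange x.n).find? fun l =>
      decide (i ≤ l ∧ P (searchQuery R x i j j' k l) = .nontrivial)) = some (h k)

open Classical in
/-- Search for a nontrivial element of the hidden subgroup, using `P` as if it were correct.
The outcome is `none` if the answers of `P` do not describe a nontrivial element of `G`. -/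
def search (R : StabRoutine) (P : DecisionProgram) (x : Input) :
    Option (Equiv.Perm (Fin x.n)) :=
  match searchTriple R P x with
  | none => none
  | some c =>
    if h : ∃ g, IsReadOff R P x c.1 c.2.1 c.2.2 g then some h.choose else none

/-! ## The checkers -/

/-- The input over `G ≀ ℤ/2` obtained from `f` and its shift `f' g = f (g u⁻¹)`. -/
def shiftInput (x : Input) (u : x.G) : Input :=
  Input.build (n := x.n * 2) (by have := x.n_pos; omega) (wrGens x.gens)
    (wrFun x.ev fun g => x.ev (g * (u : Equiv.Perm (Fin x.n))⁻¹))

open Classical in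
/-- The checker for the decision version, once its random elements `u` have been drawn. -/
def checkDecision (R : StabRoutine) (P : DecisionProgram) (x : Input) {k : ℕ}
    (u : Fin k → x.G) : Verdict :=
  match P x with
  | .nontrivial =>
    match search R P x with
    | some h => if x.ev h = x.ev 1 then .correct else .buggy
    | none => .buggy
  | .trivial =>
    if ∀ r, search R P (shiftInput x (u r)) =
        some (wr ((u r : Equiv.Perm (Fin x.n))⁻¹, (u r : Equiv.Perm (Fin x.n)), 1))
    then .correct else .buggy

/-- From generators `(k₁, k₂, τ)` of the subgroup hidden in `G ≀ ℤ/2` and a coset representative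
`u'`, generators of the subgroup hidden in `G`. -/
def shiftGens {n : ℕ} (u' : Equiv.Perm (Fin n))
    (l : List (Equiv.Perm (Fin n) × Equiv.Perm (Fin n) × Fin 2)) : List (Equiv.Perm (Fin n)) :=
  l.flatMap fun t => if t.2.2 = 0 then [t.1, u' * t.2.1 * u'⁻¹] else [u' * t.1, t.2.1 * u'⁻¹]

/-- One round of the checker for generators: read the output of `P` on the shifted input as a list
of elements of `Sₙ ≀ ℤ/2`, take the first one of the form `(k₁, u', 1)`, and compare
the resulting generators and `u'` with `P x` and `u`. -/
def RoundPasses (P : GeneratorProgram) (x : Input) (u : x.G) : Prop :=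
  ∃ (l : List (Equiv.Perm (Fin x.n) × Equiv.Perm (Fin x.n) × Fin 2))
    (t : Equiv.Perm (Fin x.n) × Equiv.Perm (Fin x.n) × Fin 2),
    P (shiftInput x u) = l.map wr ∧
    l.find? (fun s => decide (s.2.2 = 1)) = some t ∧
    span (shiftGens t.2.1 l) = span (P x) ∧
    (u : Equiv.Perm (Fin x.n)) * t.2.1⁻¹ ∈ span (P x)

open Classical in
/-- The checker for generators, once its random elements `u` have been drawn. -/
def checkGenerators (P : GeneratorProgram) (x : Input) {k : ℕ} (u : Fin k → x.G) : Verdict :=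
  if (∀ s ∈ P x, s ∈ x.G ∧ x.ev s = x.ev 1) ∧ ∀ r, RoundPasses P x (u r)
  then .correct else .buggy

open Classical in
/-- Law of the verdict of the checker for the decision version, for independent uniform `u`. -/
def decisionChecker (R : StabRoutine) (P : DecisionProgram) (x : Input) (k : ℕ) : PMF Verdict :=
  (PMF.uniformOfFintype (Fin k → x.G)).map (checkDecision R P x)

open Classical in
/-- Law of the verdict of the checker for generators, for independent uniform `u`. -/
def generatorChecker (P : GeneratorProgram) (x : Input) (k : ℕ) : PMF Verdict :=
  (PMF.uniformOfFintype (Fin k → x.G)).map (checkGenerators P x)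

/-! ## Nonadaptive probabilistic oracle machines -/

/-- A nonadaptive oracle machine: `ask` tosses coins and writes down all queries, `query` evaluates
the function of a query, and `decide` computes the verdict from the answers.  All three programs
have access to the black box for `f`. -/
structure Machine : Type where
  ask : Prog
  query : Prog
  decide : Prog

namespace Machine

/-- On the black box of `x`, the tree `d` describes the query `q`: it starts with the degree
and generators of `q`, and the program `query` with data `d` computes the function of `q`. -/
def Describes (M : Machine) (x : Input) (d : Data) (q : Input) : Prop :=
  d.head = Input.code q.n q.gens ∧
    ∀ g : q.G, ∃ t, Run x.oracle M.query (.cons d (.ofPerm (g : Equiv.Perm (Fin q.n)))) [] t (q.f g)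

/-- With coins `w`, the machine takes time `t` to write `out`, whose tail describes the list
of queries `qs`. -/
def Asks (M : Machine) (x : Input) (k : ℕ) (w : List Bool) (t : ℕ) (out : Data)
    (qs : List Input) : Prop :=
  Run x.oracle M.ask (x.tape k) w t out ∧
    ∃ ds, out.tail = .ofList ds ∧ List.Forall₂ (M.Describes x) ds qs

/-- With coins `w` and answers given by `P`, the machine halts with verdict `v` after time `t`. -/
def Halts (M : Machine) (P : Input → Data) (x : Input) (k : ℕ) (w : List Bool) (t : ℕ)
    (v : Verdict) : Prop :=
  ∃ t₁ t₂ out qs, M.Asks x k w t₁ out qs ∧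
    Run x.oracle M.decide (.cons out (.ofList (qs.map P))) [] t₂ v.code ∧ t = t₁ + t₂

open Classical in
/-- Probability of a verdict, over the finite sequences of coin tosses of halting runs. -/
def prob (M : Machine) (P : Input → Data) (x : Input) (k : ℕ) (v : Verdict) : ℝ≥0∞ :=
  ∑' w : List Bool, if ∃ t, M.Halts P x k w t v then 2⁻¹ ^ w.length else 0

/-- Expected running time, over the same sample space. -/
def expectedTime (M : Machine) (P : Input → Data) (x : Input) (k : ℕ) : ℝ≥0∞ :=
  ∑' r : {r : List Bool × ℕ // ∃ v, M.Halts P x k r.1 r.2 v}, 2⁻¹ ^ r.1.1.length * (r.1.2 : ℝ≥0∞)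

/-- The verdict of the machine has the law `C`, for all programs `P` to be checked and all `(G, f)`
where `f` hides a subgroup; `answer P q` is the answer of `P` to the query `q`. -/
def Implements {Program : Type} (M : Machine) (answer : Program → Input → Data)
    (C : Program → Input → ℕ → PMF Verdict) : Prop :=
  ∀ (P : Program) (x : Input) (k : ℕ), (∃ H, x.Hides H) →
    ∀ v, M.prob (answer P) x k v = C P x k v

/-- The expected running time is polynomial in the length of the input and a bound `a` on the
length of the answers; and the functions of all queries are computed in time polynomial
in the length of the input. -/
def PolyTime {Program : Type} (M : Machine) (answer : Program → Input → Data) : Prop :=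
  ∃ p : Polynomial ℕ, ∀ (x : Input) (k : ℕ), (∃ H, x.Hides H) →
    (∀ (P : Program) (a : ℕ),
      (∀ w t out qs, M.Asks x k w t out qs → ∀ q ∈ qs, (answer P q).size ≤ a) →
      M.expectedTime (answer P) x k ≤ (p.eval (x.size k + a) : ℕ)) ∧
    ∀ w t out ds, Run x.oracle M.ask (x.tape k) w t out → out.tail = .ofList ds →
      ∀ d ∈ ds, ∀ q, M.Describes x d q → ∀ g : q.G, ∃ t' ≤ p.eval (x.size k),
        Run x.oracle M.query (.cons d (.ofPerm (g : Equiv.Perm (Fin q.n)))) [] t' (q.f g)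

end Machine

end HSP

end

/-! ### A calculus of polynomial-time programs on trees -/

noncomputable section

namespace HSP

/-! ## Polynomial bounds -/

/-! Soundness rests on a symmetry that hides the drawn element. On `G ≀ ℤ/2` the function `f * f^u`
is the right translate of `f * f` by `(1, u, 0)`, so it hides the conjugate of `H ≀ ℤ/2` under this
element (`HidesOn.shiftSub`, `wr_mem_shiftSub`); for trivial `H` this is just `{1, (u⁻¹, u, 1)}`. On
the other hand `f^u` depends only on the coset `Hu`: for `d ∈ H` the elements `u` and `du` lead to
the same input (`shiftInput_congr`), hence to the same answers of `P`. If `P` wrongly claims that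
`H` is trivial, pick `d ≠ 1` in `H`: the search cannot return both `(u⁻¹, u, 1)` and the element
that belongs to `du`. If the list of `P` generates a proper subgroup of `H`, pick `d` in `H` outside
this subgroup: `u'` is the same for `u` and `du`, and both cannot lie in `⟨S⟩u'`. So at most one of
`u`, `du` passes a round, and each independent round is passed with probability at most 1/2
(`card_filter_forall_mul_le`). The other errors are detected with certainty by evaluating `f`.

Completeness of the search uses two facts. The query hides a diagonal copy of the intersection of a
wreath product with three setwise stabilizers (`hidesOn_searchQuery`). At the largest `i` moved by
an element of `H` fixing all earlier points, elements without swap in this intersection are trivial,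
and elements with swap are the pairs `(g, g⁻¹)` for `g ∈ H` with prescribed values
(`searchQuery_eq_nontrivial_iff`). Since the value at `i` determines `g`, the answers spell out one
permutation (`exists_search_eq`).

For the machines, uniform elements of `G` are needed. A strong generating set is built by sifting
(`isComplete_chain`); its transversals give each group element exactly one factorization
(`IsComplete.existsUnique_factorization`), so one draws uniformly from each transversal. With fair
coins this is done exactly by padding to a power of two and rejecting. The law and the expected
number of coins of this walk come from a bounded harmonic function and a potential
(`tsum_walkTerm_eq`, `tsum_walkTerm_length_le`).

Running times are handled by `FP`: one program serves a whole family of inputs, with time polynomial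
in a weight. Families may be indexed by anything, including group elements, intermediate states and
the checked program `P`, so facts that hold only on part of the data can be used inside a
computation. `exists_machine` turns a list of questions and a verdict, both in `FP`, into a
nonadaptive machine with the right law and expected time. -/

theorem eval_le_eval_of_le (P : Polynomial ℕ) {a b : ℕ} (h : a ≤ b) : P.eval a ≤ P.eval b := by
  rw [Polynomial.eval_eq_sum, Polynomial.eval_eq_sum]
  exact Finset.sum_le_sum fun i _ => Nat.mul_le_mul_left _ (Nat.pow_le_pow_left h i)

/-- `b` is bounded by a polynomial in `N`. -/
def PBd {ι : Type} (N b : ι → ℕ) : Prop := ∃ P : Polynomial ℕ, ∀ i, b i ≤ P.eval (N i)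

namespace PBd

variable {ι κ : Type} {N b b' : ι → ℕ}

theorem mono (h : PBd N b) (h' : ∀ i, b' i ≤ b i) : PBd N b' :=
  h.imp fun _ hP i => (h' i).trans (hP i)

theorem const (N : ι → ℕ) (n : ℕ) : PBd N fun _ => n := ⟨Polynomial.C n, fun i => by simp⟩

theorem self (N : ι → ℕ) : PBd N N := ⟨Polynomial.X, fun i => by simp⟩

theorem add (h : PBd N b) (h' : PBd N b') : PBd N fun i => b i + b' i := by
  obtain ⟨P, hP⟩ := h
  obtain ⟨Q, hQ⟩ := h'
  exact ⟨P + Q, fun i => by simpa using add_le_add (hP i) (hQ i)⟩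

theorem mul (h : PBd N b) (h' : PBd N b') : PBd N fun i => b i * b' i := by
  obtain ⟨P, hP⟩ := h
  obtain ⟨Q, hQ⟩ := h'
  exact ⟨P * Q, fun i => by simpa using Nat.mul_le_mul (hP i) (hQ i)⟩

/-- Polynomials compose. This transports the cost of a subroutine, measured in its own weight, to
the weight of the caller. -/
theorem subst {N : ι → ℕ} {N' c : κ → ℕ} (h : PBd N' c) (π : ι → κ)
    (h' : PBd N fun i => N' (π i)) : PBd N fun i => c (π i) := by
  obtain ⟨P, hP⟩ := h
  obtain ⟨Q, hQ⟩ := h'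
  refine ⟨P.comp Q, fun i => (hP _).trans ?_⟩
  rw [Polynomial.eval_comp]
  exact eval_le_eval_of_le P (hQ i)

end PBd

/-! ## Sizes of encodings -/

theorem Data.size_pos (d : Data) : 0 < d.size := by cases d <;> simp [Data.size]

/-- A list, written down elementwise. -/
def encL {β : Type} (e : β → Data) (l : List β) : Data := .ofList (l.map e)

section encL

variable {β γ : Type} (e : β → Data)

@[simp] theorem encL_nil : encL e [] = .nil := rfl

@[simp] theorem encL_cons (b : β) (l : List β) : encL e (b :: l) = .cons (e b) (encL e l) := rfl

theorem encL_map (f : γ → β) (l : List γ) : encL e (l.map f) = encL (fun c => e (f c)) l := by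
  simp [encL, Function.comp_def]

theorem encL_eq_nil {l : List β} : encL e l = .nil ↔ l = [] := by cases l <;> simp

theorem encL_tail (l : List β) : (encL e l).tail = encL e l.tail := by cases l <;> rfl

theorem encL_injective {e : β → Data} (he : Function.Injective e) :
    Function.Injective (encL e) := by
  intro l l' h
  induction l generalizing l' with
  | nil => cases l' with
    | nil => rfl
    | cons => simp at h
  | cons a l ih => cases l' with
    | nil => simp at h
    | cons b l' =>
      simp only [encL_cons, Data.cons.injEq] at h
      rw [he h.1, ih h.2]

theorem size_le_size_encL {e : β → Data} {b : β} {l : List β} (h : b ∈ l) :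
    (e b).size ≤ (encL e l).size := by
  induction l with
  | nil => simp at h
  | cons a l ih =>
    simp only [encL_cons, Data.size]
    rcases List.mem_cons.1 h with rfl | h
    · omega
    · have := ih h; omega

theorem length_lt_size_encL (l : List β) : l.length < (encL e l).size := by
  induction l with
  | nil => simp [Data.size]
  | cons a l ih => simp only [encL_cons, Data.size, List.length_cons]; omega

theorem size_encL_le {e : β → Data} {l : List β} {B : ℕ} (h : ∀ b ∈ l, (e b).size ≤ B) :
    (encL e l).size ≤ l.length * (B + 1) + 1 := by
  induction l with
  | nil => simp [Data.size]
  | cons a l ih =>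
    simp only [encL_cons, Data.size, List.length_cons, add_mul, one_mul]
    have := ih fun b hb => h b (List.mem_cons_of_mem _ hb)
    have := h a List.mem_cons_self
    omega

theorem size_encL_append (l l' : List β) :
    (encL e (l ++ l')).size + 1 = (encL e l).size + (encL e l').size := by
  induction l with
  | nil => simp [Data.size]; omega
  | cons a l ih => simp only [List.cons_append, encL_cons, Data.size]; omega

theorem size_encL_reverse (l : List β) : (encL e l.reverse).size = (encL e l).size := by
  induction l with
  | nil => rfl
  | cons a l ih =>
    have := size_encL_append e l.reverse [a]
    simp only [List.reverse_cons, encL_cons, encL_nil, Data.size] at this ⊢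
    omega

theorem size_encL_sublist {l l' : List β} (h : l.Sublist l') :
    (encL e l).size ≤ (encL e l').size := by
  induction h with
  | slnil => rfl
  | cons a _ ih => simp only [encL_cons, Data.size]; omega
  | cons_cons a _ ih => simp only [encL_cons, Data.size]; omega

end encL

theorem ofNat_eq_encL (n : ℕ) :
    Data.ofNat n = encL (fun _ : Unit => .nil) (List.replicate n ()) := by
  induction n with
  | zero => rfl
  | succ n ih => simp [Data.ofNat, ih, List.replicate_succ]

theorem Data.ofNat_injective : Function.Injective Data.ofNat := by
  intro a b h
  induction a generalizing b with
  | zero => cases b with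
    | zero => rfl
    | succ b => simp [Data.ofNat] at h
  | succ a ih => cases b with
    | zero => simp [Data.ofNat] at h
    | succ b =>
      simp only [Data.ofNat, Data.cons.injEq, true_and] at h
      rw [ih h]

theorem Data.size_ofNat (n : ℕ) : (Data.ofNat n).size = 2 * n + 1 := by
  induction n with
  | zero => rfl
  | succ n ih => simp only [Data.ofNat, Data.size, ih]; omega

/-- Every instruction is charged for the tree it reads, and an oracle call also for its answer, so
no output outgrows the time spent. The extra one is needed for a coin tossed on the tree `nil`. -/
theorem Run.size_le {O p d w t a} (h : Run O p d w t a) : a.size ≤ t + 1 := by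
  induction h with
  | copy d => omega
  | nil d => simp [Data.size]
  | head d => cases d <;> simp [Data.head, Data.size]; omega
  | tail d => cases d <;> simp [Data.tail, Data.size]; omega
  | coin d b => have := d.size_pos; cases b <;> simp [Data.ofBool, Data.size]; omega
  | oracle d => omega
  | @pair _ _ d _ _ _ _ _ _ _ _ _ _ => have := d.size_pos; simp only [Data.size]; omega
  | comp => omega
  | cond_true => omega
  | cond_false => omega
  | loop_done => omega
  | loop_step => omega

/-! ## Families of computations in polynomial time -/

/-- A family of inputs `c i`, with oracles `O i` and weights `N i`. -/
structure Ctx (ι : Type) : Type where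
  O : ι → Data → Data
  N : ι → ℕ
  c : ι → Data
  size_le : ∀ i, (c i).size ≤ N i

/-- A program computes `y i` from `Γ.c i` in time polynomial in `Γ.N i`, without tossing coins. -/
def FP {ι : Type} (Γ : Ctx ι) (y : ι → Data) : Prop :=
  ∃ (p : Prog) (t : ι → ℕ), PBd Γ.N t ∧ ∀ i, Run (Γ.O i) p (Γ.c i) [] (t i) (y i)

namespace Ctx

variable {ι κ : Type}

/-- The family with the additional datum `e`. -/
@[simps] def ext (Γ : Ctx ι) (π : κ → ι) (e : κ → Data) : Ctx κ where
  O j := Γ.O (π j)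
  N j := Γ.N (π j) + (e j).size + 1
  c j := .cons (Γ.c (π j)) (e j)
  size_le j := by have := Γ.size_le (π j); simp only [Data.size]; omega

@[simps] def reindex (Γ : Ctx ι) (π : κ → ι) : Ctx κ where
  O j := Γ.O (π j)
  N j := Γ.N (π j)
  c j := Γ.c (π j)
  size_le j := Γ.size_le (π j)

theorem size_pBd (Γ : Ctx ι) : PBd Γ.N fun i => (Γ.c i).size := (PBd.self _).mono Γ.size_le

end Ctx

namespace FP

variable {ι κ : Type} {Γ : Ctx ι} {y z : ι → Data}

theorem congr (h : FP Γ y) (h' : ∀ i, y i = z i) : FP Γ z := by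
  rwa [show z = y from funext fun i => (h' i).symm]

theorem size_pBd (h : FP Γ y) : PBd Γ.N fun i => (y i).size := by
  obtain ⟨p, t, ht, h⟩ := h
  exact (ht.add (.const _ 1)).mono fun i => (h i).size_le

theorem self (Γ : Ctx ι) : FP Γ Γ.c :=
  ⟨.copy, _, (PBd.const _ 1).add Γ.size_pBd, fun _ => .copy _⟩

theorem nil (Γ : Ctx ι) : FP Γ fun _ => .nil :=
  ⟨.nil, _, (PBd.const _ 1).add Γ.size_pBd, fun _ => .nil _⟩

theorem cons (h : FP Γ y) (h' : FP Γ z) : FP Γ fun i => .cons (y i) (z i) := by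
  obtain ⟨p, t, ht, h⟩ := h
  obtain ⟨p', t', ht', h'⟩ := h'
  exact ⟨.pair p p', _, (((PBd.const _ 1).add Γ.size_pBd).add ht).add ht',
    fun i => .pair (h i) (h' i)⟩

/-- Subroutine call: a program for the family `Δ` is applied to the member `π i`. The oracles must
agree, and the weight of the callee must be polynomial in that of the caller. -/
theorem call {Δ : Ctx κ} {y : κ → Data} (h : FP Δ y) (π : ι → κ)
    (hO : ∀ i, Δ.O (π i) = Γ.O i) (hN : PBd Γ.N fun i => Δ.N (π i))
    (hc : FP Γ fun i => Δ.c (π i)) : FP Γ fun i => y (π i) := by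
  obtain ⟨p, t, ht, h⟩ := h
  obtain ⟨p', t', ht', h'⟩ := hc
  exact ⟨.comp p p', _, (((PBd.const _ 1).add Γ.size_pBd).add ht').add (ht.subst π hN),
    fun i => .comp (h' i) (hO i ▸ h (π i))⟩

theorem reindex (h : FP Γ y) (π : κ → ι) : FP (Γ.reindex π) fun j => y (π j) :=
  h.call π (fun _ => rfl) (PBd.self _) (self _)

/-- The family `y`, as a family of inputs. -/
@[simps] def _root_.HSP.Ctx.of (Γ : Ctx ι) (y : ι → Data) : Ctx ι where
  O := Γ.O
  N i := Γ.N i + (y i).size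
  c := y
  size_le i := by omega

theorem comp (h : FP Γ y) (h' : FP (Γ.of y) z) : FP Γ z :=
  h'.call id (fun _ => rfl) ((PBd.self _).add h.size_pBd) h

theorem head (h : FP Γ y) : FP Γ fun i => (y i).head :=
  h.comp ⟨.head, _, (PBd.const _ 1).add (Ctx.size_pBd _), fun _ => .head _⟩

theorem tail (h : FP Γ y) : FP Γ fun i => (y i).tail :=
  h.comp ⟨.tail, _, (PBd.const _ 1).add (Ctx.size_pBd _), fun _ => .tail _⟩

theorem oracle (h : FP Γ y) (h' : PBd Γ.N fun i => (Γ.O i (y i)).size) :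
    FP Γ fun i => Γ.O i (y i) :=
  h.comp ⟨.oracle, _, ((PBd.const _ 1).add (Ctx.size_pBd _)).add
    (h'.subst id ((PBd.self _).mono fun i => by simp)), fun i => .oracle _⟩

theorem fst {y z : ι → Data} (h : FP Γ fun i => .cons (y i) (z i)) : FP Γ y := h.head

theorem snd {y z : ι → Data} (h : FP Γ fun i => .cons (y i) (z i)) : FP Γ z := h.tail

theorem var (Γ : Ctx ι) (π : κ → ι) (e : κ → Data) : FP (Γ.ext π e) e := (self (Γ.ext π e)).tail

theorem weaken (h : FP Γ y) (π : κ → ι) (e : κ → Data) : FP (Γ.ext π e) fun j => y (π j) :=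
  h.call π (fun _ => rfl) ((PBd.self _).mono fun i => by simp; omega) (self (Γ.ext π e)).head

theorem const (Γ : Ctx ι) (d : Data) : FP Γ fun _ => d := by
  induction d with
  | nil => exact nil Γ
  | cons a b iha ihb => exact iha.cons ihb

open Classical in
-- Each branch has to be computed only on the subfamily where it is taken, so that it may use data
-- that exist only there.
theorem by_cases {c : ι → Data} (hc : FP Γ c)
    (h₁ : FP (Γ.reindex (Subtype.val : {i // c i ≠ .nil} → ι)) fun j => y j)
    (h₂ : FP (Γ.reindex (Subtype.val : {i // c i = .nil} → ι)) fun j => y j) : FP Γ y := by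
  obtain ⟨q, t, ht, hc⟩ := hc
  obtain ⟨p₁, t₁, ht₁, h₁⟩ := h₁
  obtain ⟨p₂, t₂, ht₂, h₂⟩ := h₂
  have htt : PBd Γ.N fun i => if h : c i = .nil then t₂ ⟨i, h⟩ else t₁ ⟨i, h⟩ := by
    obtain ⟨P, hP⟩ := ht₁
    obtain ⟨Q, hQ⟩ := ht₂
    refine ⟨P + Q, fun i => ?_⟩
    rw [Polynomial.eval_add]
    beta_reduce
    split
    · exact (hQ ⟨i, _⟩).trans (by simp)
    · exact (hP ⟨i, _⟩).trans (by simp)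
  refine ⟨.cond q p₁ p₂, _, (((PBd.const _ 1).add Γ.size_pBd).add ht).add htt, fun i => ?_⟩
  by_cases h : c i = .nil
  · simp only [h, dif_pos]
    exact .cond_false (hc i) h (h₂ ⟨i, h⟩)
  · simp only [h, dif_neg, not_false_eq_true]
    exact .cond_true (hc i) h (h₁ ⟨i, h⟩)

theorem cond {c : ι → Data} [∀ i, Decidable (c i = .nil)] (hc : FP Γ c) (hy : FP Γ y)
    (hz : FP Γ z) : FP Γ fun i => if c i = .nil then y i else z i :=
  hc.by_cases ((hz.reindex _).congr fun j => (if_neg j.2).symm)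
    ((hy.reindex _).congr fun j => (if_pos j.2).symm)

/-- A single number `B` bounds both the states and the times of the bodies; each of the `m` rounds
and the final test costs at most `1 + B + B`. -/
theorem _root_.HSP.exists_run_loop {O : Data → Data} {p : Prog} {B : ℕ} (m : ℕ) :
    ∀ {s : ℕ → Data}, (∀ j < m, (s j).head ≠ .nil) → (s m).head = .nil →
      (∀ j < m, ∃ t ≤ B, Run O p (s j) [] t (s (j + 1))) → (∀ j ≤ m, (s j).size ≤ B) →
      ∃ t ≤ (m + 1) * (1 + B + B), Run O (.loop p) (s 0) [] t (s m) := by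
  induction m with
  | zero =>
    intro s _ h' _ hB
    have := hB 0 le_rfl
    exact ⟨_, by omega, .loop_done h'⟩
  | succ m ih =>
    intro s h h' hs hB
    obtain ⟨t, ht, hr⟩ := ih (s := fun j => s (j + 1)) (fun j hj => h _ (by omega)) h'
      (fun j hj => hs _ (by omega)) (fun j hj => hB _ (by omega))
    obtain ⟨t', ht', hr'⟩ := hs 0 (by omega)
    refine ⟨_, ?_, .loop_step (h 0 (by omega)) hr' hr⟩
    have := hB 0 (by omega)
    have : (m + 1 + 1) * (1 + B + B) = (m + 1) * (1 + B + B) + (1 + B + B) := by ring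
    omega

theorem _root_.HSP.exists_time {ι : Type} {N b : ι → ℕ} {R : ι → ℕ → Prop} (hb : PBd N b)
    (h : ∀ i, ∃ t ≤ b i, R i t) : ∃ t : ι → ℕ, PBd N t ∧ ∀ i, R i (t i) := by
  choose t ht hR using h
  exact ⟨t, hb.mono ht, hR⟩

/-- Iteration as long as the head of the state is not `nil`. -/
theorem loop {s : ι → ℕ → Data} {m B : ι → ℕ} (hm : PBd Γ.N m) (hB : PBd Γ.N B)
    (hs : ∀ i, ∀ j ≤ m i, (s i j).size ≤ B i)
    (h : ∀ i, ∀ j < m i, (s i j).head ≠ .nil) (h' : ∀ i, (s i (m i)).head = .nil)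
    (h₀ : FP Γ fun i => s i 0)
    (hstep : FP ((Γ.reindex fun p : {p : ι × ℕ // p.2 < m p.1} => p.1.1).of
      fun p => s p.1.1 p.1.2) fun p => s p.1.1 (p.1.2 + 1)) : FP Γ fun i => s i (m i) := by
  refine h₀.comp ?_
  obtain ⟨p, t, ⟨P, hP⟩, hr⟩ := hstep
  -- The body is one program for all states, with time polynomial `P` in weight plus state size. The
  -- bound `B` on the states makes this uniform over the rounds, so it does not compound.
  have key : PBd (Γ.of fun i => s i 0).N fun i => P.eval (Γ.N i + B i) + B i := by
    obtain ⟨Q, hQ⟩ := hB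
    refine ⟨P.comp (Polynomial.X + Q) + Q, fun i => ?_⟩
    simp only [Polynomial.eval_add, Polynomial.eval_comp, Polynomial.eval_X]
    have hN : Γ.N i ≤ (Γ.of fun i => s i 0).N i := by simp
    refine add_le_add (eval_le_eval_of_le _ (add_le_add hN ?_)) ?_ <;>
    exact (hQ i).trans (eval_le_eval_of_le _ hN)
  have hm' : PBd (Γ.of fun i => s i 0).N m :=
    hm.subst id ((PBd.self _).mono fun i => by simp)
  obtain ⟨t', ht', hr'⟩ := exists_time
    (R := fun i t => Run (Γ.O i) (.loop p) (s i 0) [] t (s i (m i)))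
    ((hm'.add (.const _ 1)).mul (((PBd.const _ 1).add key).add key))
    fun i => exists_run_loop (m i) (h i) (h' i)
      (fun j hj => ⟨t ⟨(i, j), hj⟩, (hP ⟨(i, j), hj⟩).trans ((eval_le_eval_of_le _
        (add_le_add_right (hs i j hj.le) _)).trans (Nat.le_add_right _ _)), hr ⟨(i, j), hj⟩⟩)
      (fun j hj => (hs i j hj).trans (Nat.le_add_left _ _))
  exact ⟨_, t', ht', hr'⟩

end FP

end HSP

end

noncomputable section

namespace HSP

/-! ## Lists -/

/-- Indices for the steps of a left fold. -/
structure FoldIx {ι : Type} {β σ : ι → Type} (l : ∀ i, List (β i)) (f : ∀ i, σ i → β i → σ i)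
    (s₀ : ∀ i, σ i) : Type where
  i : ι
  s : σ i
  b : β i
  reach : ∃ l', l' ++ [b] <+: l i ∧ s = l'.foldl (f i) (s₀ i)

/-- Indices for the members of a family of lists. -/
structure MemIx {ι : Type} {β : ι → Type} (l : ∀ i, List (β i)) : Type where
  i : ι
  b : β i
  mem : b ∈ l i

theorem FoldIx.mem {ι : Type} {β σ : ι → Type} {l : ∀ i, List (β i)} {f : ∀ i, σ i → β i → σ i}
    {s₀ : ∀ i, σ i} (p : FoldIx l f s₀) : p.b ∈ l p.i := by
  obtain ⟨l', h, -⟩ := p.reach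
  exact h.subset (by simp)

namespace FP

variable {ι κ : Type} {Γ : Ctx ι} {y z : ι → Data}

/-- Loop on the triple of remaining list, context and accumulator. The bound `B` on all intermediate
accumulators is essential: polynomial steps alone may blow up exponentially when iterated. The step
is needed only at states that the fold reaches. -/
theorem foldl {β σ : ι → Type} {l : ∀ i, List (β i)} {e : ∀ i, β i → Data}
    {es : ∀ i, σ i → Data} {f : ∀ i, σ i → β i → σ i} {s₀ : ∀ i, σ i} {B : ι → ℕ}
    (hl : FP Γ fun i => encL (e i) (l i)) (hs : FP Γ fun i => es i (s₀ i)) (hB : PBd Γ.N B)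
    (hb : ∀ i l', l' <+: l i → (es i (l'.foldl (f i) (s₀ i))).size ≤ B i)
    (hf : FP ((Γ.ext (fun p : FoldIx l f s₀ => p.i) fun p => es p.i p.s).ext id
      fun p => e p.i p.b) fun p => es p.i (f p.i p.s p.b)) :
    FP Γ fun i => es i ((l i).foldl (f i) (s₀ i)) := by
  have hL := hl.size_pBd
  have key := loop (Γ := Γ) (m := fun i => (l i).length)
    (s := fun i j => .cons (encL (e i) ((l i).drop j))
      (.cons (Γ.c i) (es i (((l i).take j).foldl (f i) (s₀ i)))))
    (B := fun i => (encL (e i) (l i)).size + Γ.N i + B i + 2)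
    (hL.mono fun i => (length_lt_size_encL _ _).le)
    (((hL.add (.self _)).add hB).add (.const _ 2))
    (fun i j _ => by
      have h₁ := size_encL_sublist (e i) (List.drop_sublist j (l i))
      have h₂ := hb i _ (List.take_prefix j (l i))
      have := Γ.size_le i
      simp only [Data.size]
      omega)
    (fun i j hj => by
      simp only [Data.head, ne_eq, encL_eq_nil, List.drop_eq_nil_iff]
      omega)
    (fun i => by simp [Data.head])
    (by simpa using hl.cons ((self Γ).cons hs)) ?_
  · have := key.tail.tail
    simpa [Data.tail] using this
  · set Δ := (Γ.reindex fun p : {p : ι × ℕ // p.2 < (l p.1).length} => p.1.1).of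
      fun p => .cons (encL (e p.1.1) ((l p.1.1).drop p.1.2))
        (.cons (Γ.c p.1.1) (es p.1.1 (((l p.1.1).take p.1.2).foldl (f p.1.1) (s₀ p.1.1))))
      with hΔ
    have h0 : FP Δ Δ.c := self Δ
    have h1 : FP Δ fun p => encL (e p.1.1) ((l p.1.1).drop p.1.2) := h0.fst
    have h2 : FP Δ fun p => Γ.c p.1.1 := h0.snd.fst
    have h3 : FP Δ fun p => es p.1.1 (((l p.1.1).take p.1.2).foldl (f p.1.1) (s₀ p.1.1)) :=
      h0.snd.snd
    have h4 : FP Δ fun p => e p.1.1 (l p.1.1)[p.1.2] := by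
      refine h1.head.congr fun p => ?_
      rw [List.drop_eq_getElem_cons p.2]
      rfl
    have h5 : FP Δ fun p => encL (e p.1.1) ((l p.1.1).drop (p.1.2 + 1)) :=
      h1.tail.congr fun p => by simp [encL_tail, List.tail_drop]
    let π : {p : ι × ℕ // p.2 < (l p.1).length} → FoldIx l f s₀ := fun p =>
      ⟨p.1.1, ((l p.1.1).take p.1.2).foldl (f p.1.1) (s₀ p.1.1), (l p.1.1)[p.1.2],
        (l p.1.1).take p.1.2, by
          rw [List.take_concat_get' (l p.1.1) p.1.2 p.2]
          exact ⟨List.take_prefix _ _, rfl⟩⟩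
    have h6 := hf.call (Γ := Δ) π (fun _ => rfl) (by
      refine ((((PBd.self _).add h3.size_pBd).add h4.size_pBd).add (.const _ 2)).mono fun p => ?_
      simp [π, Δ]
      omega) ((h2.cons h3).cons h4)
    refine (h5.cons (h2.cons h6)).congr fun p => ?_
    have : (l p.1.1).take (p.1.2 + 1) = (l p.1.1).take p.1.2 ++ [(l p.1.1)[p.1.2]'p.2] :=
      (List.take_concat_get' (l p.1.1) p.1.2 p.2).symm
    rw [this, List.foldl_append]
    rfl

/-- The code of a member is part of the code of the list, so a cost polynomial in the member is
bounded uniformly over all members. -/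
theorem _root_.HSP.PBd.of_mem {β : ι → Type} {l : ∀ i, List (β i)} {e : ∀ i, β i → Data}
    {b : MemIx l → ℕ} (hl : PBd Γ.N fun i => (encL (e i) (l i)).size)
    (h : PBd (Γ.ext (fun p : MemIx l => p.i) fun p => e p.i p.b).N b) :
    ∃ B : ι → ℕ, PBd Γ.N B ∧ ∀ p, b p ≤ B p.i := by
  obtain ⟨P, hP⟩ := h
  obtain ⟨Q, hQ⟩ := hl
  refine ⟨fun i => (P.comp (Polynomial.X + Q + 1)).eval (Γ.N i), ⟨_, fun i => le_rfl⟩,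
    fun p => (hP p).trans ?_⟩
  have h₁ := size_le_size_encL (e := e p.i) p.mem
  have h₂ : _ ≤ _ := hQ p.i
  beta_reduce at h₂
  simp only [Polynomial.eval_add, Polynomial.eval_comp, Polynomial.eval_X, Polynomial.eval_one,
    Ctx.ext_N]
  exact eval_le_eval_of_le _ (by omega)

theorem encL_reverse {β : ι → Type} {l : ∀ i, List (β i)} {e : ∀ i, β i → Data}
    (hl : FP Γ fun i => encL (e i) (l i)) : FP Γ fun i => encL (e i) (l i).reverse := by
  have key := hl.foldl (σ := fun i => List (β i)) (es := fun i => encL (e i))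
    (f := fun i s b => b :: s) (s₀ := fun i => []) (nil Γ) hl.size_pBd
    (fun i l' h => by simpa [size_encL_reverse] using size_encL_sublist (e i) h.sublist)
    ((var _ _ _).cons ((var _ _ _).weaken _ _))
  simpa using key

theorem foldr {β σ : ι → Type} {l : ∀ i, List (β i)} {e : ∀ i, β i → Data}
    {es : ∀ i, σ i → Data} {f : ∀ i, β i → σ i → σ i} {s₀ : ∀ i, σ i} {B : ι → ℕ}
    (hl : FP Γ fun i => encL (e i) (l i)) (hs : FP Γ fun i => es i (s₀ i)) (hB : PBd Γ.N B)
    (hb : ∀ i l', l' <:+ l i → (es i (l'.foldr (f i) (s₀ i))).size ≤ B i)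
    (hf : FP ((Γ.ext (fun p : FoldIx (fun i => (l i).reverse) (fun i s b => f i b s) s₀ => p.i)
      fun p => es p.i p.s).ext id fun p => e p.i p.b) fun p => es p.i (f p.i p.b p.s)) :
    FP Γ fun i => es i ((l i).foldr (f i) (s₀ i)) := by
  have := hl.encL_reverse.foldl hs hB (fun i l' h => by
    have := hb i l'.reverse (by simpa using List.reverse_suffix.2 h)
    rwa [List.foldr_reverse] at this) hf
  simpa using this

theorem encL_append {β : ι → Type} {l l' : ∀ i, List (β i)} {e : ∀ i, β i → Data}
    (hl : FP Γ fun i => encL (e i) (l i)) (hl' : FP Γ fun i => encL (e i) (l' i)) :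
    FP Γ fun i => encL (e i) (l i ++ l' i) := by
  have key := hl.foldr (σ := fun i => List (β i)) (es := fun i => encL (e i))
    (f := fun i b s => b :: s) (s₀ := l') hl' (hl.size_pBd.add hl'.size_pBd)
    (fun i l₁ h => by
      have h₁ := size_encL_append (e i) l₁ (l' i)
      have h₂ := size_encL_sublist (e i) h.sublist
      rw [List.foldr_cons_eq_append']
      omega)
    ((var _ _ _).cons ((var _ _ _).weaken _ _))
  simpa using key

theorem map {β γ : ι → Type} {l : ∀ i, List (β i)} {e : ∀ i, β i → Data}
    {e' : ∀ i, γ i → Data} {y : ∀ i, β i → γ i}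
    (hl : FP Γ fun i => encL (e i) (l i))
    (hf : FP (Γ.ext (fun p : MemIx l => p.i) fun p => e p.i p.b) fun p => e' p.i (y p.i p.b)) :
    FP Γ fun i => encL (e' i) ((l i).map (y i)) := by
  obtain ⟨B, hB, hb⟩ := PBd.of_mem hl.size_pBd hf.size_pBd
  have key := hl.foldr (σ := fun i => List (γ i)) (es := fun i => encL (e' i))
    (f := fun i b s => y i b :: s) (s₀ := fun i => []) (B := fun i =>
      (encL (e i) (l i)).size * (B i + 1) + 1) (nil Γ)
    ((hl.size_pBd.mul (hB.add (.const _ 1))).add (.const _ 1))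
    (fun i l' h => by
      have : l'.foldr (fun b s => y i b :: s) [] = l'.map (y i) := by
        rw [List.map_eq_foldr]
      rw [this]
      refine (size_encL_le (B := B i) ?_).trans ?_
      · intro c hc
        obtain ⟨b, hb', rfl⟩ := List.mem_map.1 hc
        exact hb ⟨i, b, h.subset hb'⟩
      · gcongr
        rw [List.length_map]
        exact h.length_le.trans (length_lt_size_encL _ _).le)
    ?_
  · refine key.congr fun i => ?_
    rw [List.map_eq_foldr]
  · refine cons ?_ ((var _ _ _).weaken _ _)
    refine hf.call (κ := MemIx l) (fun p : FoldIx (fun i => (l i).reverse) _ _ =>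
      ⟨p.i, p.b, List.mem_reverse.1 p.mem⟩) (fun _ => rfl) ?_ ?_
    · refine ((PBd.self _)).mono fun p => ?_
      simp
      omega
    · exact ((self Γ).weaken _ _ |>.weaken _ _).cons (var _ _ _)

theorem flatten {β : ι → Type} {l : ∀ i, List (List (β i))} {e : ∀ i, β i → Data}
    (hl : FP Γ fun i => encL (encL (e i)) (l i)) : FP Γ fun i => encL (e i) (l i).flatten := by
  have key := hl.foldr (σ := fun i => List (β i)) (es := fun i => encL (e i))
    (f := fun i b s => b ++ s) (s₀ := fun i => []) (nil Γ) hl.size_pBd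
    (fun i l' h => by
      refine le_trans ?_ (size_encL_sublist (encL (e i)) h.sublist)
      clear h
      induction l' with
      | nil => simp
      | cons a l' ih =>
        have := size_encL_append (e i) a (l'.foldr (fun b s => b ++ s) [])
        simp only [List.foldr_cons, encL_cons, Data.size] at this ⊢
        omega)
    ?_
  · refine key.congr fun i => ?_
    congr 1
    induction l i with
    | nil => rfl
    | cons a l ih => simp [ih]
  · refine encL_append ?_ ?_
    · exact var _ _ _
    · exact (var _ _ _).weaken _ _

theorem flatMap {β γ : ι → Type} {l : ∀ i, List (β i)} {e : ∀ i, β i → Data}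
    {e' : ∀ i, γ i → Data} {y : ∀ i, β i → List (γ i)}
    (hl : FP Γ fun i => encL (e i) (l i))
    (hf : FP (Γ.ext (fun p : MemIx l => p.i) fun p => e p.i p.b)
      fun p => encL (e' p.i) (y p.i p.b)) :
    FP Γ fun i => encL (e' i) ((l i).flatMap (y i)) :=
  (hl.map (e' := fun i => encL (e' i)) hf).flatten

theorem product {β γ : ι → Type} {l : ∀ i, List (β i)} {l' : ∀ i, List (γ i)}
    {e : ∀ i, β i → Data} {e' : ∀ i, γ i → Data}
    (hl : FP Γ fun i => encL (e i) (l i)) (hl' : FP Γ fun i => encL (e' i) (l' i)) :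
    FP Γ fun i => encL (fun p : β i × γ i => .cons (e i p.1) (e' i p.2)) (l i ×ˢ l' i) := by
  refine hl.flatMap (y := fun i b => (l' i).map (Prod.mk b)) ?_
  refine FP.map (β := fun p => γ (MemIx.i p)) (e := fun p => e' (MemIx.i p)) (hl'.weaken _ _) ?_
  exact ((var _ _ _).weaken _ _).cons (var _ _ _)

end FP

/-! ## Decidable predicates -/

open Classical in
/-- The predicate `p` is decided in polynomial time. -/
def FPd {ι : Type} (Γ : Ctx ι) (p : ι → Prop) : Prop := FP Γ fun i => .ofBool (decide (p i))

namespace FPd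

variable {ι κ : Type} {Γ : Ctx ι} {y z : ι → Data} {p q : ι → Prop}

theorem congr (h : FPd Γ p) (h' : ∀ i, p i ↔ q i) : FPd Γ q := by
  rwa [show q = p from funext fun i => propext (h' i).symm]

theorem _root_.HSP.ofBool_eq_nil {b : Bool} : Data.ofBool b = .nil ↔ b = false := by
  cases b <;> simp [Data.ofBool]

theorem by_cases (hp : FPd Γ p) (h₁ : FP (Γ.reindex (Subtype.val : {i // p i} → ι)) fun j => y j)
    (h₂ : FP (Γ.reindex (Subtype.val : {i // ¬ p i} → ι)) fun j => y j) : FP Γ y := by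
  classical
  refine FP.by_cases hp ?_ ?_
  · exact h₁.call (fun j : {i // Data.ofBool (decide (p i)) ≠ .nil} =>
      (⟨j.1, by simpa [ofBool_eq_nil] using j.2⟩ : {i // p i})) (fun _ => rfl)
      (PBd.self _) (FP.self _)
  · exact h₂.call (fun j : {i // Data.ofBool (decide (p i)) = .nil} =>
      (⟨j.1, by simpa [ofBool_eq_nil] using j.2⟩ : {i // ¬ p i})) (fun _ => rfl)
      (PBd.self _) (FP.self _)

theorem ite {β : ι → Type} {e : ∀ i, β i → Data} {a b : ∀ i, β i} [∀ i, Decidable (p i)]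
    (hp : FPd Γ p) (h₁ : FP Γ fun i => e i (a i))
    (h₂ : FP Γ fun i => e i (b i)) : FP Γ fun i => e i (if p i then a i else b i) :=
  hp.by_cases ((h₁.reindex _).congr fun j => by rw [if_pos j.2])
    ((h₂.reindex _).congr fun j => by rw [if_neg j.2])

theorem of_true (Γ : Ctx ι) (h : ∀ i, p i) : FPd Γ p :=
  (FP.const Γ (.ofBool true)).congr fun i => by simp [h i]

theorem of_false (Γ : Ctx ι) (h : ∀ i, ¬ p i) : FPd Γ p :=
  (FP.const Γ (.ofBool false)).congr fun i => by simp [h i]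

theorem cases (hp : FPd Γ p) (h₁ : FPd (Γ.reindex (Subtype.val : {i // p i} → ι)) fun j => q j)
    (h₂ : FPd (Γ.reindex (Subtype.val : {i // ¬ p i} → ι)) fun j => q j) : FPd Γ q :=
  hp.by_cases h₁ h₂

theorem reindex (h : FPd Γ p) (π : κ → ι) : FPd (Γ.reindex π) fun j => p (π j) := FP.reindex h π

theorem weaken (h : FPd Γ p) (π : κ → ι) (e : κ → Data) : FPd (Γ.ext π e) fun j => p (π j) :=
  FP.weaken h π e

theorem eq_nil (h : FP Γ y) : FPd Γ fun i => y i = .nil := by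
  classical
  exact (h.cond (.const Γ (.ofBool true)) (.const Γ (.ofBool false))).congr fun i => by
    by_cases h : y i = .nil <;> simp [h]

theorem not (hp : FPd Γ p) : FPd Γ fun i => ¬ p i :=
  hp.cases (of_false _ fun j => not_not.2 j.2) (of_true _ fun j => j.2)

theorem and (hp : FPd Γ p) (hq : FPd Γ q) : FPd Γ fun i => p i ∧ q i :=
  hp.cases ((hq.reindex _).congr fun j => (and_iff_right j.2).symm)
    (of_false _ fun j h => j.2 h.1)

theorem or (hp : FPd Γ p) (hq : FPd Γ q) : FPd Γ fun i => p i ∨ q i :=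
  (hp.not.and hq.not).not.congr fun i => by tauto

theorem imp (hp : FPd Γ p) (hq : FPd Γ q) : FPd Γ fun i => p i → q i :=
  (hp.not.or hq).congr fun i => by tauto

theorem iff (hp : FPd Γ p) (hq : FPd Γ q) : FPd Γ fun i => p i ↔ q i :=
  ((hp.imp hq).and (hq.imp hp)).congr fun i => by tauto

theorem eq_nil_list {β : ι → Type} {l : ∀ i, List (β i)} {e : ∀ i, β i → Data}
    (hl : FP Γ fun i => encL (e i) (l i)) : FPd Γ fun i => l i = [] :=
  (eq_nil hl).congr fun _ => encL_eq_nil _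

theorem _root_.HSP.FP.filter {β : ι → Type} {l : ∀ i, List (β i)} {e : ∀ i, β i → Data}
    {r : ∀ i, β i → Bool} (hl : FP Γ fun i => encL (e i) (l i))
    (hr : FPd (Γ.ext (fun p : MemIx l => p.i) fun p => e p.i p.b) fun p => r p.i p.b) :
    FP Γ fun i => encL (e i) ((l i).filter (r i)) := by
  refine (hl.flatMap (e' := e) (y := fun i b => if r i b then [b] else []) ?_).congr fun i => ?_
  · exact hr.ite (β := fun p => List (β (MemIx.i p))) (e := fun p => encL (e (MemIx.i p)))
      ((FP.var _ _ _).cons (.nil _)) (.nil _)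
  · congr 1
    induction l i with
    | nil => rfl
    | cons a l ih => simp only [List.flatMap_cons, ih, List.filter_cons]; split <;> rfl

theorem exists_mem {β : ι → Type} {l : ∀ i, List (β i)} {e : ∀ i, β i → Data}
    {r : ∀ i, β i → Prop} (hl : FP Γ fun i => encL (e i) (l i))
    (hr : FPd (Γ.ext (fun p : MemIx l => p.i) fun p => e p.i p.b) fun p => r p.i p.b) :
    FPd Γ fun i => ∃ b ∈ l i, r i b := by
  classical
  refine (eq_nil_list (hl.filter (r := fun i b => decide (r i b)) (hr.congr ?_))).not.congr ?_
  · simp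
  · intro i
    simp [List.filter_eq_nil_iff]

theorem forall_mem {β : ι → Type} {l : ∀ i, List (β i)} {e : ∀ i, β i → Data}
    {r : ∀ i, β i → Prop} (hl : FP Γ fun i => encL (e i) (l i))
    (hr : FPd (Γ.ext (fun p : MemIx l => p.i) fun p => e p.i p.b) fun p => r p.i p.b) :
    FPd Γ fun i => ∀ b ∈ l i, r i b :=
  (exists_mem (r := fun i b => ¬ r i b) hl hr.not).not.congr fun i => by simp

end FPd

/-- An option, written down as a list. -/
def encO {β : Type} (e : β → Data) (o : Option β) : Data := encL e o.toList

theorem encO_some {β : Type} (e : β → Data) (b : β) : encO e (some b) = .cons (e b) .nil := rfl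

theorem encO_injective {β : Type} {e : β → Data} (he : Function.Injective e) :
    Function.Injective (encO e) := fun a b h => by
  have := encL_injective he h
  cases a <;> cases b <;> simp_all

namespace FP

variable {ι κ : Type} {Γ : Ctx ι} {y z : ι → Data}

theorem encO_some {β : ι → Type} {e : ∀ i, β i → Data} {b : ∀ i, β i}
    (h : FP Γ fun i => e i (b i)) : FP Γ fun i => encO (e i) (some (b i)) := h.cons (nil Γ)

theorem head? {β : ι → Type} {l : ∀ i, List (β i)} {e : ∀ i, β i → Data}
    (hl : FP Γ fun i => encL (e i) (l i)) : FP Γ fun i => encO (e i) (l i).head? := by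
  classical
  refine (hl.cond (.nil _) (hl.head.cons (.nil _))).congr fun i => ?_
  cases l i <;> simp [encO, Data.head]

theorem encL_tail {β : ι → Type} {l : ∀ i, List (β i)} {e : ∀ i, β i → Data}
    (hl : FP Γ fun i => encL (e i) (l i)) : FP Γ fun i => encL (e i) (l i).tail :=
  hl.tail.congr fun _ => HSP.encL_tail _ _

theorem find? {β : ι → Type} {l : ∀ i, List (β i)} {e : ∀ i, β i → Data}
    {r : ∀ i, β i → Bool} (hl : FP Γ fun i => encL (e i) (l i))
    (hr : FPd (Γ.ext (fun p : MemIx l => p.i) fun p => e p.i p.b) fun p => r p.i p.b) :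
    FP Γ fun i => encO (e i) ((l i).find? (r i)) :=
  (hl.filter hr).head?.congr fun i => by rw [List.head?_filter]

/-- Case distinction on an optional value. -/
theorem option {β : ι → Type} {e : ∀ i, β i → Data} {o : ∀ i, Option (β i)}
    (ho : FP Γ fun i => encO (e i) (o i))
    (h₁ : FP (Γ.reindex (Subtype.val : {i // o i = none} → ι)) fun j => y j)
    (h₂ : FP (Γ.ext (fun p : MemIx (fun i => (o i).toList) => p.i) fun p => e p.i p.b)
      fun p => y p.i) : FP Γ y := by
  refine (FPd.eq_nil_list ho).by_cases ?_ ?_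
  · exact h₁.call (fun j : {i // (o i).toList = []} => (⟨j.1, by simpa using j.2⟩ : {i // o i = none}))
       (fun _ => rfl) (PBd.self _) (self _)
  · have h : ∀ j : {i // ¬ (o i).toList = []}, ∃ b, o j.1 = some b := fun j =>
      Option.ne_none_iff_exists'.1 (by simpa using j.2)
    choose b hb using h
    have hj : FP (Γ.reindex (Subtype.val : {i // ¬ (o i).toList = []} → ι))
        fun j => e j.1 (b j) :=
      (ho.reindex Subtype.val).head.congr fun j => by simp [encO, hb j, Data.head]
    exact h₂.call (fun j : {i // ¬ (o i).toList = []} =>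
      (⟨j.1, b j, by simp [hb]⟩ : MemIx fun i => (o i).toList)) (fun _ => rfl)
      (((PBd.self _).add hj.size_pBd).add (.const _ 1)) ((self _).cons hj)

/-- Recover the value from an option that is known not to be empty. -/
theorem of_some {β : ι → Type} {e : ∀ i, β i → Data} {o : ∀ i, Option (β i)} {b : ∀ i, β i}
    (ho : FP Γ fun i => encO (e i) (o i)) (h : ∀ i, o i = some (b i)) :
    FP Γ fun i => e i (b i) :=
  ho.head.congr fun i => by rw [h]; rfl

end FP

/-! ## Equality of trees -/

/-- One step of the comparison of the pairs of trees on a stack. -/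
def eqStep : List (Data × Data) × Bool → List (Data × Data) × Bool
  | ([], b) => ([], b)
  | ((.nil, .nil) :: l, b) => (l, b)
  | ((.cons a a', .cons c c') :: l, b) => ((a, c) :: (a', c') :: l, b)
  | ((.nil, .cons _ _) :: _, _) => ([], false)
  | ((.cons _ _, .nil) :: _, _) => ([], false)

def encPair : Data × Data → Data := fun p => .cons p.1 p.2

def eqState (s : List (Data × Data) × Bool) : Data := .cons (encL encPair s.1) (.ofBool s.2)

theorem eqStep_correct (s : List (Data × Data) × Bool) :
    ((eqStep s).2 = true ∧ ∀ p ∈ (eqStep s).1, p.1 = p.2) ↔ (s.2 = true ∧ ∀ p ∈ s.1, p.1 = p.2) := by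
  fun_cases eqStep s <;> simp [and_assoc]

theorem eqStep_size (s : List (Data × Data) × Bool) :
    (eqState (eqStep s)).size ≤ (eqState s).size := by
  fun_cases eqStep s <;> simp [eqState, encPair, Data.size, Data.ofBool] <;> omega

def eqMeasure (s : List (Data × Data) × Bool) : ℕ := (s.1.map fun p => p.1.size).sum

/-- Each step removes at least one node from the first components on the stack; hence the comparison
ends within the size of the first tree. -/
theorem eqStep_measure (s : List (Data × Data) × Bool) (h : s.1 ≠ []) :
    eqMeasure (eqStep s) < eqMeasure s := by
  fun_cases eqStep s
  · simp at h
  all_goals simp [eqMeasure, Data.size]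
  all_goals omega

theorem exists_eqStep_nil (m : ℕ) (s : List (Data × Data) × Bool) (h : eqMeasure s ≤ m) :
    ∃ j ≤ m, (eqStep^[j] s).1 = [] := by
  induction m generalizing s with
  | zero =>
    refine ⟨0, le_rfl, ?_⟩
    by_contra h'
    have := eqStep_measure s h'
    omega
  | succ m ih =>
    by_cases h' : s.1 = []
    · exact ⟨0, by omega, h'⟩
    · obtain ⟨j, hj, hs⟩ := ih (eqStep s) (by have := eqStep_measure s h'; omega)
      exact ⟨j + 1, by omega, hs⟩

theorem FP.eqState_eqStep {ι : Type} {Γ : Ctx ι} {s : ι → List (Data × Data) × Bool}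
    (h : FP Γ fun i => eqState (s i)) : FP Γ fun i => eqState (eqStep (s i)) := by
  classical
  have hl : FP Γ fun i => encL encPair (s i).1 := h.fst
  have hb : FP Γ fun i => .ofBool (s i).2 := h.snd
  have ha := hl.head.head
  have hc := hl.head.tail
  have hf : FP Γ fun _ => .cons .nil .nil := .const Γ _
  refine (hl.cond h (ha.cond (hc.cond (hl.tail.cons hb) hf) (hc.cond hf
    (((ha.head.cons hc.head).cons ((ha.tail.cons hc.tail).cons hl.tail)).cons hb)))).congr
    fun i => ?_
  generalize s i = s
  fun_cases eqStep s <;> simp [eqState, encPair, Data.head, Data.tail, Data.ofBool]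

open Classical in
-- Recursion over two trees becomes a loop over a stack of pairs still to be compared. The states
-- never grow, and the truth of "flag set and all stacked pairs equal" is invariant; with an empty
-- stack the flag is the answer.
theorem FPd.eq_data {ι : Type} {Γ : Ctx ι} {y z : ι → Data} (hy : FP Γ y) (hz : FP Γ z) :
    FPd Γ fun i => y i = z i := by
  have hex : ∀ i, ∃ j, (eqStep^[j] ([(y i, z i)], true)).1 = [] := fun i =>
    (exists_eqStep_nil _ _ le_rfl).imp fun _ h => h.2
  have hsize : ∀ (s) (j : ℕ), (eqState (eqStep^[j] s)).size ≤ (eqState s).size := by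
    intro s j
    induction j with
    | zero => rfl
    | succ j ih =>
      rw [Function.iterate_succ_apply']
      exact (eqStep_size _).trans ih
  have hcorr : ∀ (s) (j : ℕ), ((eqStep^[j] s).2 = true ∧ ∀ p ∈ (eqStep^[j] s).1, p.1 = p.2) ↔
      (s.2 = true ∧ ∀ p ∈ s.1, p.1 = p.2) := by
    intro s j
    induction j with
    | zero => rfl
    | succ j ih =>
      rw [Function.iterate_succ_apply']
      exact (eqStep_correct _).trans ih
  have h0 : FP Γ fun i => eqState ([(y i, z i)], true) :=
    ((hy.cons hz).cons (.nil Γ)).cons (.const Γ (.ofBool true))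
  have key := FP.loop (Γ := Γ) (s := fun i j => eqState (eqStep^[j] ([(y i, z i)], true)))
    (m := fun i => Nat.find (hex i)) (hy.size_pBd.mono fun i => ?_) h0.size_pBd
    (fun i j _ => hsize _ _) ?_ ?_ h0 ?_
  · refine key.tail.congr fun i => ?_
    have h₁ := Nat.find_spec (hex i)
    have h₂ := hcorr ([(y i, z i)], true) (Nat.find (hex i))
    rw [h₁] at h₂
    simp only [eqState, Data.tail]
    congr 1
    rw [Bool.eq_iff_iff]
    simpa using h₂
  · obtain ⟨j, hj, hs⟩ := exists_eqStep_nil _ ([(y i, z i)], true) le_rfl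
    exact (Nat.find_min' (hex i) hs).trans (hj.trans (by simp [eqMeasure]))
  · intro i j hj
    simpa [eqState, Data.head, encL_eq_nil] using Nat.find_min (hex i) hj
  · intro i
    simpa [eqState, Data.head, encL_eq_nil] using Nat.find_spec (hex i)
  · simp only [Function.iterate_succ_apply']
    exact FP.eqState_eqStep (.self _)

theorem FPd.eq {ι : Type} {Γ : Ctx ι} {β : ι → Type} {e : ∀ i, β i → Data} {a b : ∀ i, β i}
    (he : ∀ i, Function.Injective (e i)) (ha : FP Γ fun i => e i (a i))
    (hb : FP Γ fun i => e i (b i)) : FPd Γ fun i => a i = b i :=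
  (FPd.eq_data ha hb).congr fun i => (he i).eq_iff

end HSP

end

/-! ### Polynomial-time arithmetic with numerals, permutations and their products -/

noncomputable section

namespace HSP

open Equiv

/-- Indices for the points of a family of sets `Fin n`. -/
abbrev FinIx {ι : Type} (n : ι → ℕ) : Type := MemIx fun i => List.finRange (n i)

/-- A point, written down as a unary numeral. -/
def encF {n : ℕ} (a : Fin n) : Data := .ofNat a

theorem encF_injective {n : ℕ} : Function.Injective (encF (n := n)) := fun _ _ h =>
  Fin.ext (Data.ofNat_injective h)

theorem ofPerm_eq_encL {n : ℕ} (g : Perm (Fin n)) :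
    Data.ofPerm g = encL encF ((List.finRange n).map g) := by
  rw [encL_map]; rfl

theorem ofPerm_injective {n : ℕ} : Function.Injective (Data.ofPerm (n := n)) := by
  intro g h hgh
  rw [ofPerm_eq_encL, ofPerm_eq_encL] at hgh
  have := List.map_inj_left.1 (encL_injective encF_injective hgh)
  ext a
  rw [this a (List.mem_finRange a)]

theorem encL_finRange (n : ℕ) : encL encF (List.finRange n) = encL .ofNat (List.range n) := by
  rw [← List.map_coe_finRange_eq_range, encL_map]; rfl

theorem size_ofPerm_le {n : ℕ} (g : Perm (Fin n)) :
    (Data.ofPerm g).size ≤ n * (2 * n + 1) + 1 := by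
  rw [ofPerm_eq_encL]
  refine (size_encL_le (B := 2 * n) fun b _ => ?_).trans (by simp)
  rw [encF, Data.size_ofNat]
  have := b.2
  omega

namespace FP

variable {ι κ : Type} {Γ : Ctx ι} {y z : ι → Data} {a b n m : ι → ℕ}

/-! ## Unary numerals -/

theorem pBd_ofNat (h : FP Γ fun i => .ofNat (a i)) : PBd Γ.N a :=
  h.size_pBd.mono fun i => by rw [Data.size_ofNat]; omega

theorem nat (Γ : Ctx ι) (n : ℕ) : FP Γ fun _ => .ofNat n := const Γ _

theorem succ (h : FP Γ fun i => .ofNat (a i)) : FP Γ fun i => .ofNat (a i + 1) := (nil Γ).cons h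

theorem pred (h : FP Γ fun i => .ofNat (a i)) : FP Γ fun i => .ofNat (a i - 1) :=
  h.tail.congr fun i => by cases a i <;> rfl

theorem add (h : FP Γ fun i => .ofNat (a i)) (h' : FP Γ fun i => .ofNat (b i)) :
    FP Γ fun i => .ofNat (a i + b i) := by
  simp only [ofNat_eq_encL] at *
  exact (h.encL_append h').congr fun i => by rw [List.replicate_append_replicate]

theorem sub (h : FP Γ fun i => .ofNat (a i)) (h' : FP Γ fun i => .ofNat (b i)) :
    FP Γ fun i => .ofNat (a i - b i) := by
  rw [funext fun i => ofNat_eq_encL (b i)] at h'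
  have hf : ∀ s : ℕ, ∀ l : List Unit, l.foldl (fun s _ => s - 1) s = s - l.length := by
    intro s l
    induction l generalizing s with
    | nil => rfl
    | cons u l ih => simp only [List.foldl_cons, ih, List.length_cons]; omega
  have key := h'.foldl (σ := fun _ => ℕ) (es := fun _ => Data.ofNat) (f := fun _ s _ => s - 1)
    (s₀ := a) h h.size_pBd (fun i l' _ => by
      rw [hf, Data.size_ofNat, Data.size_ofNat]; omega)
    (by
      refine FP.pred ?_
      exact (var _ _ _).weaken _ _)
  exact key.congr fun i => by rw [hf, List.length_replicate]

theorem mul (h : FP Γ fun i => .ofNat (a i)) (h' : FP Γ fun i => .ofNat (b i)) :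
    FP Γ fun i => .ofNat (a i * b i) := by
  simp only [ofNat_eq_encL] at *
  exact (h.flatMap (e' := fun _ _ => Data.nil) (y := fun i _ => List.replicate (b i) ())
    (h'.weaken _ _)).congr fun i => by
      simp [List.flatMap_def]

theorem _root_.HSP.FPd.nat_lt (h : FP Γ fun i => .ofNat (a i)) (h' : FP Γ fun i => .ofNat (b i)) :
    FPd Γ fun i => a i < b i :=
  (FPd.eq_nil (h'.sub h)).not.congr fun i => by
    rw [show Data.nil = .ofNat 0 from rfl, Data.ofNat_injective.eq_iff]
    omega

theorem _root_.HSP.FPd.nat_le (h : FP Γ fun i => .ofNat (a i)) (h' : FP Γ fun i => .ofNat (b i)) :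
    FPd Γ fun i => a i ≤ b i :=
  (FPd.nat_lt h' h).not.congr fun i => by omega

theorem range (h : FP Γ fun i => .ofNat (n i)) : FP Γ fun i => encL .ofNat (List.range (n i)) := by
  have hn := h.pBd_ofNat
  rw [funext fun i => ofNat_eq_encL (n i)] at h
  have hf : ∀ l : List Unit, l.foldr (fun _ s => 0 :: s.map (· + 1)) [] = List.range l.length := by
    intro l
    induction l with
    | nil => rfl
    | cons u l ih => simp [ih, List.range_succ_eq_map]
  have key := h.foldr (σ := fun _ => List ℕ) (es := fun _ => encL Data.ofNat)
    (f := fun _ _ s => 0 :: s.map (· + 1)) (s₀ := fun _ => []) (nil Γ)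
    ((hn.mul ((hn.add hn).add (.const _ 2))).add (.const _ 1)) (fun i l' h => by
      have := h.length_le
      rw [List.length_replicate] at this
      rw [hf]
      refine (size_encL_le (B := n i + n i + 1) fun b hb => ?_).trans ?_
      · rw [Data.size_ofNat]
        have := List.mem_range.1 hb
        omega
      · rw [List.length_range]
        gcongr) ?_
  · exact key.congr fun i => by rw [hf, List.length_replicate]
  · refine (nil _).cons (FP.map (β := fun _ => ℕ) (e := fun _ => Data.ofNat)
      (e' := fun _ => Data.ofNat) (y := fun _ b => b + 1) ?_ ?_)
    · exact (var _ _ _).weaken _ _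
    · exact succ (var _ _ _)

theorem finRange (h : FP Γ fun i => .ofNat (n i)) :
    FP Γ fun i => encL encF (List.finRange (n i)) :=
  h.range.congr fun _ => (encL_finRange _).symm

theorem drop {β : ι → Type} {l : ∀ i, List (β i)} {e : ∀ i, β i → Data}
    (hl : FP Γ fun i => encL (e i) (l i)) (h : FP Γ fun i => .ofNat (a i)) :
    FP Γ fun i => encL (e i) ((l i).drop (a i)) := by
  rw [funext fun i => ofNat_eq_encL (a i)] at h
  have hf : ∀ i (l : List (β i)) (l' : List Unit), l'.foldl (fun s _ => s.tail) l =
      l.drop l'.length := by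
    intro i l l'
    induction l' generalizing l with
    | nil => rfl
    | cons u l' ih => simp [ih]
  have key := h.foldl (σ := fun i => List (β i)) (es := fun i => encL (e i))
    (f := fun _ s _ => s.tail) (s₀ := l) hl hl.size_pBd (fun i l' _ => by
      rw [hf]
      exact size_encL_sublist _ (List.drop_sublist _ _)) ?_
  · exact key.congr fun i => by rw [hf, List.length_replicate]
  · refine FP.encL_tail ?_
    exact (var _ _ _).weaken _ _

theorem getElem {β : ι → Type} {l : ∀ i, List (β i)} {e : ∀ i, β i → Data}
    (hl : FP Γ fun i => encL (e i) (l i)) (h : FP Γ fun i => .ofNat (a i))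
    (ha : ∀ i, a i < (l i).length) : FP Γ fun i => e i ((l i)[a i]'(ha i)) :=
  (hl.drop h).head.congr fun i => by
    rw [List.drop_eq_getElem_cons (ha i)]
    rfl

/-! ## Permutations -/

variable {g h : ∀ i, Perm (Fin (n i))} {x x' : ∀ i, Fin (n i)}

theorem fin {n : ℕ} (Γ : Ctx ι) (x : Fin n) : FP Γ fun _ => encF x := const Γ _

theorem _root_.HSP.FPd.fin_eq (h : FP Γ fun i => encF (x i)) (h' : FP Γ fun i => encF (x' i)) :
    FPd Γ fun i => x i = x' i :=
  FPd.eq (e := fun _ => encF) (fun _ => encF_injective) h h'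

theorem _root_.HSP.FPd.fin_lt (h : FP Γ fun i => encF (x i)) (h' : FP Γ fun i => encF (x' i)) :
    FPd Γ fun i => x i < x' i := FPd.nat_lt h h'

theorem _root_.HSP.FPd.fin_le (h : FP Γ fun i => encF (x i)) (h' : FP Γ fun i => encF (x' i)) :
    FPd Γ fun i => x i ≤ x' i := FPd.nat_le h h'

theorem _root_.HSP.FPd.perm_eq (hg : FP Γ fun i => .ofPerm (g i)) (hh : FP Γ fun i => .ofPerm (h i)) :
    FPd Γ fun i => g i = h i :=
  FPd.eq (e := fun _ => Data.ofPerm) (fun _ => ofPerm_injective) hg hh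

theorem _root_.HSP.FPd.forall_fin {r : ∀ i, Fin (n i) → Prop} (hn : FP Γ fun i => .ofNat (n i))
    (hr : FPd (Γ.ext (fun p : FinIx n => p.i) fun p => encF p.b)
      fun p => r p.i p.b) : FPd Γ fun i => ∀ a, r i a :=
  (FPd.forall_mem hn.finRange hr).congr fun i => by simp

theorem _root_.HSP.FPd.exists_fin {r : ∀ i, Fin (n i) → Prop} (hn : FP Γ fun i => .ofNat (n i))
    (hr : FPd (Γ.ext (fun p : FinIx n => p.i) fun p => encF p.b)
      fun p => r p.i p.b) : FPd Γ fun i => ∃ a, r i a :=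
  (FPd.exists_mem hn.finRange hr).congr fun i => by simp

/-- A point characterized by a decidable property is found by trying all points; degrees are written
in unary, so this is affordable. Inverse permutations are computed in this way. -/
theorem fin_unique {r : ∀ i, Fin (n i) → Prop} (hn : FP Γ fun i => .ofNat (n i))
    (hr : FPd (Γ.ext (fun p : FinIx n => p.i) fun p => encF p.b)
      fun p => r p.i p.b) (h : ∀ i a, r i a ↔ a = x i) : FP Γ fun i => encF (x i) := by
  classical
  refine (hn.finRange.find? (r := fun i a => decide (r i a))
    (hr.congr fun _ => by simp)).of_some fun i => ?_
  simp only [h]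
  have : (List.finRange (n i)).find? (fun a => decide (a = x i)) ≠ none := by
    simp
  obtain ⟨c, hc⟩ := Option.ne_none_iff_exists'.1 this
  have := List.find?_some hc
  rw [hc, of_decide_eq_true this]

theorem perm (hn : FP Γ fun i => .ofNat (n i))
    (h : FP (Γ.ext (fun p : FinIx n => p.i) fun p => encF p.b)
      fun p => encF (g p.i p.b)) : FP Γ fun i => .ofPerm (g i) :=
  (hn.finRange.map (e' := fun _ => encF) (y := fun i => g i) h).congr fun _ =>
    (ofPerm_eq_encL _).symm

theorem apply (hg : FP Γ fun i => .ofPerm (g i)) (hx : FP Γ fun i => encF (x i)) :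
    FP Γ fun i => encF (g i (x i)) := by
  simp only [ofPerm_eq_encL] at hg
  exact (hg.getElem hx fun i => by simp).congr fun i => by simp

theorem symm_apply (hn : FP Γ fun i => .ofNat (n i)) (hg : FP Γ fun i => .ofPerm (g i))
    (hx : FP Γ fun i => encF (x i)) : FP Γ fun i => encF ((g i)⁻¹ (x i)) := by
  refine hn.fin_unique (r := fun i a => g i a = x i) ?_ fun _ _ => Perm.eq_inv_iff_eq.symm
  exact FPd.fin_eq (apply (hg.weaken _ _) (var _ _ _)) (hx.weaken _ _)

theorem perm_mul (hn : FP Γ fun i => .ofNat (n i)) (hg : FP Γ fun i => .ofPerm (g i))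
    (hh : FP Γ fun i => .ofPerm (h i)) : FP Γ fun i => .ofPerm (g i * h i) :=
  perm hn (apply (x := fun p : FinIx n => h p.i p.b) (hg.weaken _ _)
    (apply (hh.weaken _ _) (var _ _ _)))

theorem perm_inv (hn : FP Γ fun i => .ofNat (n i)) (hg : FP Γ fun i => .ofPerm (g i)) :
    FP Γ fun i => .ofPerm (g i)⁻¹ :=
  perm hn (symm_apply (hn.weaken _ _) (hg.weaken _ _) (var _ _ _))

theorem perm_one (hn : FP Γ fun i => .ofNat (n i)) :
    FP Γ fun i => .ofPerm (1 : Perm (Fin (n i))) :=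
  perm hn (var _ _ _)

theorem perm_swap (hn : FP Γ fun i => .ofNat (n i)) (hx : FP Γ fun i => encF (x i))
    (hx' : FP Γ fun i => encF (x' i)) : FP Γ fun i => .ofPerm (swap (x i) (x' i)) := by
  refine perm hn ?_
  simp only [swap_apply_def]
  exact (FPd.fin_eq (var _ _ _) (hx.weaken _ _)).ite (e := fun _ => encF) (hx'.weaken _ _)
    ((FPd.fin_eq (var _ _ _) (hx'.weaken _ _)).ite (e := fun _ => encF) (hx.weaken _ _)
      (var _ _ _))

/-! ## Wreath and direct products -/

theorem finProd {u : ∀ i, Fin (m i)} (hn : FP Γ fun i => .ofNat (n i))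
    (hu : FP Γ fun i => encF (u i)) (hx : FP Γ fun i => encF (x i)) :
    FP Γ fun i => encF (finProdFinEquiv (u i, x i)) :=
  hx.add (hn.mul hu)

/-- Division with remainder is avoided: all pairs are tried until one is mapped to the given point.
-/
theorem finProd_symm {c : ∀ i, Fin (m i * n i)} (hm : FP Γ fun i => .ofNat (m i))
    (hn : FP Γ fun i => .ofNat (n i)) (hc : FP Γ fun i => encF (c i)) :
    FP Γ fun i => .cons (encF (finProdFinEquiv.symm (c i)).1)
      (encF (finProdFinEquiv.symm (c i)).2) := by
  classical
  have hl := hm.finRange.product hn.finRange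
  have key := hl.find? (r := fun i p => decide (finProdFinEquiv p = c i)) ?_
  · refine key.of_some (b := fun i => finProdFinEquiv.symm (c i)) fun i => ?_
    have : (List.finRange (m i) ×ˢ List.finRange (n i)).find?
        (fun p => decide (finProdFinEquiv p = c i)) ≠ none := by
      simp only [ne_eq, List.find?_eq_none, decide_eq_true_eq, not_forall, not_not]
      exact ⟨finProdFinEquiv.symm (c i), by
        rw [show finProdFinEquiv.symm (c i) = ((finProdFinEquiv.symm (c i)).1,
          (finProdFinEquiv.symm (c i)).2) from rfl]
        exact List.pair_mem_product.2 ⟨List.mem_finRange _, List.mem_finRange _⟩,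
        Equiv.apply_symm_apply _ _⟩
    obtain ⟨d, hd⟩ := Option.ne_none_iff_exists'.1 this
    have := List.find?_some hd
    rw [hd, Option.some_inj, Equiv.eq_symm_apply]
    exact of_decide_eq_true this
  · refine FPd.congr (p := fun p => finProdFinEquiv p.b = c p.i) ?_ fun p => by simp
    have h1 : FP _ (fun p : MemIx (fun i => List.finRange (m i) ×ˢ List.finRange (n i)) =>
      .cons (encF p.b.1) (encF p.b.2)) := var Γ MemIx.i _
    exact FPd.fin_eq (finProd (hn.weaken _ _) h1.fst h1.snd) (hc.weaken _ _)

theorem wr_apply {n : ℕ} (t : Perm (Fin n) × Perm (Fin n) × Fin 2) (i : Fin n) (j : Fin 2) :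
    wr t (finProdFinEquiv (i, j)) =
      finProdFinEquiv (if j = 0 then t.1 i else t.2.1 i, t.2.2 + j) := by
  simp only [wr, permCongr_apply, symm_apply_apply, trans_apply, prodCongrLeft_apply,
    prodCongr_apply, Prod.map, coe_refl, id, coe_addLeft]
  fin_cases j <;> rfl

theorem block_apply {N : ℕ} (v : Fin 4 → Perm (Fin N)) (i : Fin 4) (a : Fin N) :
    block v (finProdFinEquiv (i, a)) = finProdFinEquiv (i, v i a) := by
  simp [block, permCongr_apply, prodCongrRight_apply]

theorem perm_wr {t : ∀ i, Perm (Fin (n i)) × Perm (Fin (n i)) × Fin 2}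
    (hn : FP Γ fun i => .ofNat (n i)) (h₁ : FP Γ fun i => .ofPerm (t i).1)
    (h₂ : FP Γ fun i => .ofPerm (t i).2.1) (h₃ : FP Γ fun i => encF (t i).2.2) :
    FP Γ fun i => .ofPerm (wr (t i)) := by
  refine perm (hn.mul (nat _ 2)) ?_
  set Δ := Γ.ext (fun p : FinIx fun i => n i * 2 => p.i) fun p => encF p.b
  have hb : FP Δ fun p => encF p.b := var _ _ _
  have hs := finProd_symm (m := fun p : FinIx fun i => n i * 2 => n p.i) (n := fun _ => 2) (c := fun p => p.b)
    (hn.weaken _ _) (nat _ 2) hb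
  have hj := FPd.fin_eq (n := fun _ => 2) hs.snd (fin _ 0)
  have hτ := FPd.fin_eq (n := fun _ => 2) (h₃.weaken (fun p : FinIx fun i => n i * 2 => p.i) fun p => encF p.b) (fin _ 0)
  have key := finProd (m := fun p : FinIx fun i => n i * 2 => n p.i) (n := fun _ => 2) (nat _ 2)
    (hj.ite (e := fun _ => encF) (apply (h₁.weaken _ _) hs.fst) (apply (h₂.weaken _ _) hs.fst))
    (hτ.ite (e := fun _ => encF) hs.snd (hj.ite (e := fun _ => encF) (fin _ 1) (fin _ 0)))
  refine key.congr fun p => ?_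
  obtain ⟨⟨a, j⟩, h⟩ := finProdFinEquiv.surjective p.b
  rw [← h, wr_apply, symm_apply_apply]
  congr 3
  generalize (t p.i).2.2 = τ
  fin_cases j <;> fin_cases τ <;> rfl

theorem perm_wr_fst {t : ∀ i, Perm (Fin (n i)) × Perm (Fin (n i)) × Fin 2}
    (hn : FP Γ fun i => .ofNat (n i)) (h : FP Γ fun i => .ofPerm (wr (t i))) :
    FP Γ fun i => .ofPerm (t i).1 := by
  refine perm hn ?_
  refine (finProd_symm (m := fun p : FinIx n => n p.i) (n := fun _ => 2) (hn.weaken _ _) (nat _ 2)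
    (apply (h.weaken _ _) (finProd (nat _ 2) (var Γ (fun p : FinIx n => p.i) fun p => encF p.b)
      (fin _ 0)))).fst.congr fun p => ?_
  rw [wr_apply, symm_apply_apply, if_pos rfl]

theorem perm_wr_snd {t : ∀ i, Perm (Fin (n i)) × Perm (Fin (n i)) × Fin 2}
    (hn : FP Γ fun i => .ofNat (n i)) (h : FP Γ fun i => .ofPerm (wr (t i))) :
    FP Γ fun i => .ofPerm (t i).2.1 := by
  refine perm hn ?_
  refine (finProd_symm (m := fun p : FinIx n => n p.i) (n := fun _ => 2) (hn.weaken _ _) (nat _ 2)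
    (apply (h.weaken _ _) (finProd (nat _ 2) (var Γ (fun p : FinIx n => p.i) fun p => encF p.b)
      (fin _ 1)))).fst.congr fun p => ?_
  rw [wr_apply, symm_apply_apply, if_neg (by decide)]

/-- The swap component is visible on the second coordinate of the image of `(0, 0)`; this point
exists only for positive degree. -/
theorem perm_wr_third {t : ∀ i, Perm (Fin (n i)) × Perm (Fin (n i)) × Fin 2}
    (hn : FP Γ fun i => .ofNat (n i)) (hpos : ∀ i, 0 < n i)
    (h : FP Γ fun i => .ofPerm (wr (t i))) : FP Γ fun i => encF (t i).2.2 := by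
  have h0 : FP Γ fun i => encF (⟨0, hpos i⟩ : Fin (n i)) := nat Γ 0
  refine (finProd_symm hn (nat _ 2) (apply h (finProd (nat _ 2) h0 (fin _ 0)))).snd.congr
    fun p => ?_
  rw [wr_apply, symm_apply_apply, add_zero]

theorem perm_block {v : ∀ i, Fin 4 → Perm (Fin (n i))} (hn : FP Γ fun i => .ofNat (n i))
    (h : FP (Γ.ext (fun p : ι × Fin 4 => p.1) fun p => encF p.2) fun p => .ofPerm (v p.1 p.2)) :
    FP Γ fun i => .ofPerm (block (v i)) := by
  refine perm ((nat _ 4).mul hn) ?_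
  set Δ := Γ.ext (fun p : FinIx fun i => 4 * n i => p.i) fun p => encF p.b
  have hb : FP Δ fun p => encF p.b := var _ _ _
  have hs := finProd_symm (n := fun p : FinIx fun i => 4 * n i => n p.i) (m := fun _ => 4) (c := fun p => p.b)
    (nat _ 4) (hn.weaken _ _) hb
  have hv := h.call (Γ := Δ) (fun p => (p.i, (finProdFinEquiv.symm p.b).1))
    (fun _ => rfl) (((((PBd.self Δ.N)).add hs.fst.size_pBd).add (.const _ 1)).mono fun p => by
      simp [Δ]; omega) (((self Γ).weaken (fun p : FinIx fun i => 4 * n i => p.i) fun p => encF p.b).cons hs.fst)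
  refine (finProd (m := fun _ => 4) (hn.weaken _ _) hs.fst (apply hv hs.snd)).congr fun p => ?_
  obtain ⟨⟨a, j⟩, h⟩ := finProdFinEquiv.surjective p.b
  rw [← h, block_apply, symm_apply_apply]

theorem perm_block_apply {v : ∀ i, Fin 4 → Perm (Fin (n i))} (hn : FP Γ fun i => .ofNat (n i))
    (c : Fin 4) (h : FP Γ fun i => .ofPerm (block (v i))) :
    FP Γ fun i => .ofPerm (v i c) := by
  refine perm hn ?_
  refine (finProd_symm (n := fun p : FinIx n => n p.i) (m := fun _ => 4) (nat _ 4) (hn.weaken _ _)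
    (apply (h.weaken _ _) (finProd (hn.weaken _ _) (fin _ c)
      (var Γ (fun p : FinIx n => p.i) fun p => encF p.b)))).snd.congr fun p => ?_
  rw [block_apply, symm_apply_apply]

end FP

end HSP

end

/-! ### Strong generating sets by sifting -/

noncomputable section

namespace HSP

open Equiv

/-! ## Stabilizer chains -/

section chain

variable {n : ℕ}

/-- `g` fixes all points before `i`. -/
def FixesBelow (i : ℕ) (g : Perm (Fin n)) : Prop := ∀ a : Fin n, (a : ℕ) < i → g a = a

theorem FixesBelow.mono {i j : ℕ} {g : Perm (Fin n)} (h : FixesBelow j g) (hij : i ≤ j) :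
    FixesBelow i g := fun a ha => h a (by omega)

theorem fixesBelow_one (i : ℕ) : FixesBelow i (1 : Perm (Fin n)) := fun _ _ => rfl

theorem FixesBelow.mul {i : ℕ} {g h : Perm (Fin n)} (hg : FixesBelow i g) (hh : FixesBelow i h) :
    FixesBelow i (g * h) := fun a ha => by rw [Perm.mul_apply, hh a ha, hg a ha]

theorem FixesBelow.inv {i : ℕ} {g : Perm (Fin n)} (hg : FixesBelow i g) : FixesBelow i g⁻¹ :=
  fun a ha => by rw [Perm.inv_eq_iff_eq, hg a ha]

theorem fixesBelow_zero (g : Perm (Fin n)) : FixesBelow 0 g := fun _ h => by omega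

theorem FixesBelow.eq_one {g : Perm (Fin n)} (h : FixesBelow n g) : g = 1 := by
  ext a
  rw [h a a.2]
  rfl

theorem fixesBelow_succ {i : Fin n} {g : Perm (Fin n)} :
    FixesBelow (i + 1) g ↔ FixesBelow i g ∧ g i = i := by
  constructor
  · exact fun h => ⟨h.mono (by omega), h i (by omega)⟩
  · intro h a ha
    rcases eq_or_ne a i with rfl | hai
    · exact h.2
    · exact h.1 a (by have := Fin.val_ne_of_ne hai; omega)

theorem FixesBelow.succ_inv_mul {i : Fin n} {g t : Perm (Fin n)} (ht : FixesBelow i t)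
    (hg : FixesBelow i g) (h : t i = g i) : FixesBelow (i + 1) (t⁻¹ * g) :=
  fixesBelow_succ.2 ⟨ht.inv.mul hg, by
    rw [Perm.mul_apply, ← h, Perm.inv_eq_iff_eq]⟩

open Classical in
/-- The first member of `T` that fixes all points before `i` and agrees with `g` at `i`. -/
def matching (T : List (Perm (Fin n))) (g : Perm (Fin n)) (i : Fin n) : Option (Perm (Fin n)) :=
  T.find? fun t => decide (FixesBelow i t ∧ FixesBelow i g ∧ t i = g i)

/-- Without a match the default `1` leaves `g` unchanged. As `matching` demands that `g` fix all
points before `i`, an element that got stuck at one level is not altered at later ones. -/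
def siftStep (T : List (Perm (Fin n))) (g : Perm (Fin n)) (i : Fin n) : Perm (Fin n) :=
  ((matching T g i).getD 1)⁻¹ * g

/-- Divide `g` by members of `T`, so that more and more initial points are fixed. -/
def sift (T : List (Perm (Fin n))) (g : Perm (Fin n)) : Perm (Fin n) :=
  (List.finRange n).foldl (siftStep T) g

/-- The elements that have to be sifted for `T` to be complete. -/
def candidates (gens T : List (Perm (Fin n))) : List (Perm (Fin n)) :=
  gens ++ (T ×ˢ T).map fun p => p.1 * p.2

open Classical in
/-- The first nontrivial residue of a candidate. -/
def residue (gens T : List (Perm (Fin n))) : Option (Perm (Fin n)) :=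
  ((candidates gens T).map (sift T)).find? fun r => decide (r ≠ 1)

def chainStep (gens T : List (Perm (Fin n))) : List (Perm (Fin n)) := T ++ (residue gens T).toList

/-- A strong generating set, together with all members of its transversals. -/
def chain (gens : List (Perm (Fin n))) : List (Perm (Fin n)) :=
  (List.finRange n ×ˢ List.finRange n).foldl (fun T _ => chainStep gens T) [1]

open Classical in
/-- The members of `T` that fix all points before `i`. -/
def level (T : List (Perm (Fin n))) (i : ℕ) : List (Perm (Fin n)) :=
  T.filter fun t => decide (FixesBelow i t)

variable {T gens : List (Perm (Fin n))} {g : Perm (Fin n)} {i : Fin n}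

theorem mem_level {t : Perm (Fin n)} {i : ℕ} : t ∈ level T i ↔ t ∈ T ∧ FixesBelow i t := by
  simp [level]

theorem level_zero : level T 0 = T := by simp [level, fixesBelow_zero]

theorem matching_spec {t : Perm (Fin n)} (h : matching T g i = some t) :
    t ∈ T ∧ FixesBelow i t ∧ FixesBelow i g ∧ t i = g i :=
  ⟨List.mem_of_find?_eq_some h, by simpa using List.find?_some h⟩

theorem matching_eq_none :
    matching T g i = none ↔ ∀ t ∈ T, FixesBelow i t → FixesBelow i g → t i ≠ g i := by
  simp [matching]

theorem subset_span {G : Type*} [Group G] {l : List G} {g : G} (h : g ∈ l) : g ∈ span l :=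
  Subgroup.subset_closure h

theorem span_le {G : Type*} [Group G] {l : List G} {K : Subgroup G} :
    span l ≤ K ↔ ∀ g ∈ l, g ∈ K := Subgroup.closure_le K

theorem span_level_mono {i j : ℕ} (h : i ≤ j) : span (level T j) ≤ span (level T i) :=
  span_le.2 fun _ ht => subset_span (mem_level.2 ⟨(mem_level.1 ht).1, (mem_level.1 ht).2.mono h⟩)

theorem fixesBelow_of_mem_span {i : ℕ} (h : g ∈ span (level T i)) : FixesBelow i g := by
  induction h using Subgroup.closure_induction with
  | mem x hx => exact (mem_level.1 hx).2
  | one => exact fixesBelow_one i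
  | mul x y _ _ hx hy => exact hx.mul hy
  | inv x _ hx => exact hx.inv

/-- Each step multiplies from the left by the inverse of a member of `T` that fixes all points
before some `j ≥ m`. -/
theorem siftStep_foldl_mem (m : ℕ) (l : List (Fin n)) (hl : ∀ j ∈ l, m ≤ (j : ℕ))
    (g : Perm (Fin n)) : ∃ k ∈ span (level T m), l.foldl (siftStep T) g = k * g := by
  induction l generalizing g with
  | nil => exact ⟨1, one_mem _, by simp⟩
  | cons j l ih =>
    obtain ⟨k, hk, h⟩ := ih (fun j hj => hl j (List.mem_cons_of_mem _ hj)) (siftStep T g j)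
    refine ⟨k * ((matching T g j).getD 1)⁻¹, mul_mem hk (inv_mem ?_), ?_⟩
    · rcases h' : matching T g j with _ | t
      · exact one_mem _
      · have := matching_spec h'
        exact subset_span (mem_level.2 ⟨this.1, this.2.1.mono (hl j List.mem_cons_self)⟩)
    · rw [List.foldl_cons, h, siftStep, mul_assoc]

theorem siftStep_foldl_of_not_fixesBelow {m : ℕ} (l : List (Fin n)) (hl : ∀ j ∈ l, m ≤ (j : ℕ))
    (hg : ¬ FixesBelow m g) : l.foldl (siftStep T) g = g := by
  induction l with
  | nil => rfl
  | cons j l ih =>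
    have : matching T g j = none := matching_eq_none.2 fun t _ _ h =>
      absurd (h.mono (hl j List.mem_cons_self)) hg
    rw [List.foldl_cons, siftStep, this, Option.getD_none, inv_one, one_mul]
    exact ih fun j hj => hl j (List.mem_cons_of_mem _ hj)

/-- The identity stands first in `T`, so it is the match found whenever `g` already fixes the point
in question. This is why `T` is kept with head `1`. -/
theorem siftStep_foldl_of_fixesBelow (h1 : T.head? = some 1) {m : ℕ} (l : List (Fin n))
    (hl : ∀ j ∈ l, (j : ℕ) < m) (hg : FixesBelow m g) : l.foldl (siftStep T) g = g := by
  induction l with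
  | nil => rfl
  | cons j l ih =>
    have : matching T g j = some 1 := by
      cases T with
      | nil => simp at h1
      | cons t T =>
        simp only [List.head?_cons, Option.some.injEq] at h1
        subst h1
        have hj := hl j List.mem_cons_self
        simp [matching, fixesBelow_one, hg.mono hj.le, hg j hj]
    rw [List.foldl_cons, siftStep, this, Option.getD_some, inv_one, one_mul]
    exact ih fun j hj => hl j (List.mem_cons_of_mem _ hj)

theorem finRange_split (i : Fin n) : ∃ l₁ l₂, List.finRange n = l₁ ++ i :: l₂ ∧
    (∀ j ∈ l₁, j < i) ∧ ∀ j ∈ l₂, i < j := by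
  obtain ⟨l₁, l₂, h⟩ := List.mem_iff_append.1 (List.mem_finRange i)
  have := List.pairwise_lt_finRange n
  rw [h, List.pairwise_append, List.pairwise_cons] at this
  exact ⟨l₁, l₂, h, fun j hj => this.2.2 j hj i List.mem_cons_self, this.2.1.1⟩

/-- All products of two members of `T` sift to the identity. -/
structure IsComplete (gens T : List (Perm (Fin n))) : Prop where
  head : T.head? = some 1
  gens : ∀ g ∈ gens, sift T g = 1
  mul : ∀ a ∈ T, ∀ b ∈ T, sift T (a * b) = 1

/-- Steps before `i` do nothing, the step at `i` divides by some `t`, and the later steps multiply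
by an element `k` of the next level. From `k * (t⁻¹ * g) = 1` the quotient lies in that level. If
there was no match, `t = 1` serves. -/
theorem exists_of_sift_eq_one (h1 : T.head? = some 1) (hg : FixesBelow i g) (h : sift T g = 1) :
    ∃ t ∈ T, FixesBelow i t ∧ t i = g i ∧ t⁻¹ * g ∈ span (level T (i + 1)) := by
  obtain ⟨l₁, l₂, hl, hl₁, hl₂⟩ := finRange_split i
  rw [sift, hl, List.foldl_append, siftStep_foldl_of_fixesBelow h1 l₁ hl₁ hg,
    List.foldl_cons] at h
  obtain ⟨k, hk, hk'⟩ := siftStep_foldl_mem (T := T) (i + 1) l₂ (fun j hj => hl₂ j hj)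
    (siftStep T g i)
  rw [h] at hk'
  have hm : siftStep T g i ∈ span (level T (i + 1)) := by
    rw [← inv_eq_of_mul_eq_one_right hk'.symm]
    exact inv_mem hk
  rcases h' : matching T g i with _ | t
  · rw [siftStep, h', Option.getD_none, inv_one, one_mul] at hm
    refine ⟨1, List.mem_of_head? h1, fixesBelow_one _, ?_, by simpa using hm⟩
    exact (fixesBelow_of_mem_span hm i (by omega)).symm
  · have := matching_spec h'
    rw [siftStep, h', Option.getD_some] at hm
    exact ⟨t, this.1, this.2.1, this.2.2.2, hm⟩

/-- In a finite group the generated submonoid is already the subgroup, so inverses of generators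
need no separate case. -/
theorem span_induction_left {G : Type*} [Group G] [Finite G] {l : List G} {p : G → Prop}
    (one : p 1) (mul : ∀ a ∈ l, ∀ b, p b → p (a * b)) {g : G} (hg : g ∈ span l) : p g := by
  have : g ∈ Submonoid.closure {g | g ∈ l} := by
    rw [← Subgroup.closure_toSubmonoid_of_finite]
    exact hg
  clear hg
  induction this using Submonoid.closure_induction_left with
  | one => exact one
  | mul_left x hx y _ ih => exact mul x hx y ih

namespace IsComplete

variable (hT : IsComplete gens T)
include hT

theorem one_mem : (1 : Perm (Fin n)) ∈ T := List.mem_of_head? hT.head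

/-- This replaces Schreier's lemma. If `b = t * k` with `k` in the next level and `a` is a
generator, then `a * t` is a product of two members of `T`, so it sifts to the identity and again
has such a decomposition. -/
theorem exists_mem (h : g ∈ span (level T i)) :
    ∃ t ∈ T, FixesBelow i t ∧ t i = g i ∧ t⁻¹ * g ∈ span (level T (i + 1)) := by
  suffices ∃ t ∈ T, FixesBelow i t ∧ t⁻¹ * g ∈ span (level T (i + 1)) by
    obtain ⟨t, ht, ht', hk⟩ := this
    refine ⟨t, ht, ht', ?_, hk⟩
    have := fixesBelow_of_mem_span hk i (by omega)
    rwa [Perm.mul_apply, Perm.inv_eq_iff_eq, eq_comm] at this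
  refine span_induction_left (p := fun g => ∃ t ∈ T, FixesBelow i t ∧
    t⁻¹ * g ∈ span (level T (i + 1))) ?_ (fun a ha b hb => ?_) h
  · exact ⟨1, hT.one_mem, fixesBelow_one _, by simp⟩
  · obtain ⟨t, ht, ht', hk⟩ := hb
    rw [mem_level] at ha
    obtain ⟨t', h₁, h₂, h₃, h₄⟩ := exists_of_sift_eq_one hT.head (ha.2.mul ht')
      (hT.mul a ha.1 t ht)
    refine ⟨t', h₁, h₂, ?_⟩
    convert mul_mem h₄ hk using 1
    group

/-- Induction on the level: write `g = t * k` as in `exists_mem`. If `g` fixes the point `i`, so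
does `t`, and both factors belong to the next level. -/
theorem mem_span_level_iff {i : ℕ} (hi : i ≤ n) :
    g ∈ span (level T i) ↔ g ∈ span T ∧ FixesBelow i g := by
  induction i with
  | zero => simp [level_zero, fixesBelow_zero]
  | succ i ih =>
    constructor
    · refine fun h => ⟨?_, fixesBelow_of_mem_span h⟩
      rw [← level_zero (T := T)]
      exact span_level_mono (Nat.zero_le _) h
    · rintro ⟨h, h'⟩
      obtain ⟨t, h₁, h₂, h₃, h₄⟩ := hT.exists_mem (i := ⟨i, hi⟩)
        ((ih (by omega)).2 ⟨h, h'.mono (by omega)⟩)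
      have ht : t ∈ span (level T (i + 1)) := subset_span (mem_level.2 ⟨h₁,
        fixesBelow_succ (i := ⟨i, hi⟩).2 ⟨h₂, by rw [h₃]; exact h' _ (by simp)⟩⟩)
      simpa using mul_mem ht h₄

/-- For an element of the group, every level offers a match, so after `m` steps the residue stays in
the group and fixes the first `m` points; after all steps it is the identity. -/
theorem sift_eq_one_iff : sift T g = 1 ↔ g ∈ span T := by
  constructor
  · intro h
    obtain ⟨k, hk, h'⟩ := siftStep_foldl_mem (T := T) 0 (List.finRange n)
      (fun j _ => Nat.zero_le _) g
    rw [level_zero] at hk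
    rw [← sift, h] at h'
    rw [← inv_eq_of_mul_eq_one_right h'.symm]
    exact inv_mem hk
  · intro h
    have key : ∀ m ≤ n, ((List.finRange n).take m).foldl (siftStep T) g ∈ span T ∧
        FixesBelow m (((List.finRange n).take m).foldl (siftStep T) g) := by
      intro m hm
      induction m with
      | zero => simpa [fixesBelow_zero] using h
      | succ m ih =>
        obtain ⟨h₁, h₂⟩ := ih (by omega)
        rw [← List.take_concat_get' _ m (by simpa using hm), List.foldl_append]
        simp only [List.foldl_cons, List.foldl_nil, List.getElem_finRange, Fin.cast_mk]
        generalize ((List.finRange n).take m).foldl (siftStep T) g = g' at h₁ h₂ ⊢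
        obtain ⟨t, ht₁, ht₂, ht₃, -⟩ := hT.exists_mem (i := ⟨m, hm⟩)
          ((hT.mem_span_level_iff (by simp; omega)).2 ⟨h₁, h₂⟩)
        rcases h' : matching T g' ⟨m, hm⟩ with _ | s
        · exact absurd ht₃ (matching_eq_none.1 h' t ht₁ ht₂ h₂)
        · have hs := matching_spec h'
          rw [siftStep, h', Option.getD_some]
          exact ⟨mul_mem (inv_mem (subset_span hs.1)) h₁, hs.2.1.succ_inv_mul h₂ hs.2.2.2⟩
    have := (key n le_rfl).2
    rw [List.take_of_length_le (by simp)] at this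
    exact this.eq_one

end IsComplete

open Classical in
/-- The pairs `(i, j)` such that `T` has a member that fixes all points before `i` and moves `i`
to `j ≠ i`. -/
def slots (T : List (Perm (Fin n))) : Finset (Fin n × Fin n) :=
  {p | p.1 ≠ p.2 ∧ ∃ t ∈ T, FixesBelow p.1 t ∧ t p.1 = p.2}

/-- If there had been a match at `i`, the residue would fix `i`, since later steps do not move `i`
again. So sifting got stuck at `i` for lack of a member with this image, and the residue would fill
a new slot. -/
theorem sift_not_mem_slots {i : Fin n} (h : FixesBelow i (sift T g))
    (h' : sift T g i ≠ i) : (i, sift T g i) ∉ slots T := by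
  obtain ⟨l₁, l₂, hl, hl₁, hl₂⟩ := finRange_split i
  set g₀ := l₁.foldl (siftStep T) g
  have hs : sift T g = l₂.foldl (siftStep T) (siftStep T g₀ i) := by
    rw [sift, hl, List.foldl_append, List.foldl_cons]
  -- Once all points up to `i` were fixed they would stay fixed in the residue, against the choice
  -- of `i`.
  have hn : ¬ FixesBelow (i + 1) (siftStep T g₀ i) := by
    intro hf
    obtain ⟨k, hk, hk'⟩ := siftStep_foldl_mem (T := T) (i + 1) l₂ (fun j hj => hl₂ j hj)
      (siftStep T g₀ i)
    rw [← hs] at hk'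
    refine h' ?_
    rw [hk']
    exact (fixesBelow_of_mem_span hk).mul hf i (by omega)
  rw [siftStep_foldl_of_not_fixesBelow l₂ (fun j hj => hl₂ j hj) hn] at hs
  rcases hm : matching T g₀ i with _ | t
  · rw [siftStep, hm, Option.getD_none, inv_one, one_mul] at hs
    rw [hs] at h ⊢
    simp only [slots, Finset.mem_filter, Finset.mem_univ, true_and, not_and, not_exists]
    exact fun _ t ht ht' => matching_eq_none.1 hm t ht ht' h
  · rw [siftStep, hm, Option.getD_some] at hn
    have := matching_spec hm
    exact absurd (this.2.1.succ_inv_mul this.2.2.1 this.2.2.2) hn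

theorem exists_first_moved (h : g ≠ 1) : ∃ i : Fin n, FixesBelow i g ∧ g i ≠ i := by
  classical
  have : ∃ i : Fin n, g i ≠ i := by
    by_contra h'
    push Not at h'
    exact h (Equiv.ext h')
  have hne : (Finset.univ.filter fun i : Fin n => g i ≠ i).Nonempty := by
    obtain ⟨i, hi⟩ := this
    exact ⟨i, by simpa using hi⟩
  refine ⟨Finset.min' _ hne, fun a ha => ?_, by simpa using Finset.min'_mem _ hne⟩
  by_contra h'
  exact absurd (Finset.min'_le _ a (by simpa using h')) (not_le.2 ha)

theorem chainStep_head (h : T.head? = some 1) : (chainStep gens T).head? = some 1 := by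
  simp [chainStep, h]

theorem residue_spec {r : Perm (Fin n)} (h : residue gens T = some r) :
    r ≠ 1 ∧ ∃ g ∈ candidates gens T, sift T g = r :=
  ⟨by simpa using List.find?_some h, List.mem_map.1 (List.mem_of_find?_eq_some h)⟩

theorem residue_eq_none : residue gens T = none ↔ ∀ g ∈ candidates gens T, sift T g = 1 := by
  simp [residue]

theorem mem_candidates :
    g ∈ candidates gens T ↔ g ∈ gens ∨ ∃ a ∈ T, ∃ b ∈ T, a * b = g := by
  simp only [candidates, List.mem_append, List.mem_map, Prod.exists]
  refine or_congr_right ⟨?_, ?_⟩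
  · rintro ⟨a, b, h, rfl⟩
    exact ⟨a, (List.pair_mem_product.1 h).1, b, (List.pair_mem_product.1 h).2, rfl⟩
  · rintro ⟨a, ha, b, hb, rfl⟩
    exact ⟨a, b, List.pair_mem_product.2 ⟨ha, hb⟩, rfl⟩

theorem IsComplete.chainStep_eq (h : IsComplete gens T) : chainStep gens T = T := by
  rw [chainStep, residue_eq_none.2, Option.toList_none, List.append_nil]
  intro g hg
  rcases mem_candidates.1 hg with hg | ⟨a, ha, b, hb, rfl⟩
  · exact h.gens g hg
  · exact h.mul a ha b hb

/-- A round either finds nothing to add, and then `T` is complete, or adds a nontrivial residue; at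
the first point moved by it, this residue occupies a slot that was free. -/
theorem isComplete_or (h : T.head? = some 1) :
    IsComplete gens T ∨ (slots T).card < (slots (chainStep gens T)).card := by
  classical
  rcases hf : residue gens T with _ | r
  · left
    rw [residue_eq_none] at hf
    exact ⟨h, fun g hg => hf g (mem_candidates.2 (Or.inl hg)), fun a ha b hb =>
      hf _ (mem_candidates.2 (Or.inr ⟨a, ha, b, hb, rfl⟩))⟩
  · right
    obtain ⟨hr, g, -, rfl⟩ := residue_spec hf
    obtain ⟨i, hi, hi'⟩ := exists_first_moved hr
    rw [chainStep, hf, Option.toList_some]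
    refine Finset.card_lt_card (Finset.ssubset_iff.2 ⟨_, sift_not_mem_slots hi hi', ?_⟩)
    intro p hp
    rw [Finset.mem_insert] at hp
    rcases hp with rfl | hp
    · simp only [slots, Finset.mem_filter, Finset.mem_univ, true_and]
      exact ⟨hi'.symm, sift T g, by simp, hi, rfl⟩
    · simp only [slots, Finset.mem_filter, Finset.mem_univ, true_and] at hp ⊢
      obtain ⟨h₁, t, ht, h₂⟩ := hp
      exact ⟨h₁, t, List.mem_append_left _ ht, h₂⟩

theorem slots_card_lt (hn : 0 < n) (T : List (Perm (Fin n))) : (slots T).card < n * n := by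
  have : slots T ⊆ (Finset.univ : Finset (Fin n)).offDiag := fun p hp => by
    simp only [slots, Finset.mem_filter] at hp
    simp [hp.2.1]
  have h := Finset.card_le_card this
  rw [Finset.offDiag_card, Finset.card_univ, Fintype.card_fin] at h
  have : n ≤ n * n := Nat.le_mul_self n
  omega

/-- There are `n * n` rounds, and fewer than `n * n` slots to fill when `n` is positive, so one
round must have been idle; from then on the list is complete and stays unchanged. -/
theorem isComplete_chain (gens : List (Perm (Fin n))) : IsComplete gens (chain gens) := by
  have key : ∀ l : List (Fin n × Fin n), ∀ T : List (Perm (Fin n)), T.head? = some 1 →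
      (l.foldl (fun T _ => chainStep gens T) T).head? = some 1 ∧
      (IsComplete gens (l.foldl (fun T _ => chainStep gens T) T) ∨
        (slots T).card + l.length ≤ (slots (l.foldl (fun T _ => chainStep gens T) T)).card) := by
    intro l
    induction l using List.reverseRecOn with
    | nil => exact fun T h => ⟨h, Or.inr (by simp)⟩
    | append_singleton l a ih =>
      intro T h
      obtain ⟨h₁, h₂⟩ := ih T h
      rw [List.foldl_append, List.foldl_cons, List.foldl_nil, List.length_append,
        List.length_singleton]
      refine ⟨chainStep_head h₁, ?_⟩
      rcases isComplete_or (gens := gens) h₁ with h₃ | h₃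
      · left
        rwa [h₃.chainStep_eq]
      · rcases h₂ with h₂ | h₂
        · left
          rwa [h₂.chainStep_eq]
        · right
          omega
  obtain ⟨h₁, h₂⟩ := key (List.finRange n ×ˢ List.finRange n) [1] rfl
  rw [← chain] at h₁ h₂
  rcases h₂ with h₂ | h₂
  · exact h₂
  -- In degree zero no round is executed and the count says nothing, but there all permutations
  -- coincide.
  · rcases Nat.eq_zero_or_pos n with rfl | hn
    · exact ⟨h₁, fun _ _ => Subsingleton.elim _ _, fun _ _ _ _ => Subsingleton.elim _ _⟩
    · have := slots_card_lt hn (chain gens)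
      have h₃ : (List.finRange n ×ˢ List.finRange n).length = n * n := by
        rw [List.length_product]; simp
      omega

theorem mem_chain (h : g ∈ chain gens) : g ∈ span gens := by
  suffices ∀ l : List (Fin n × Fin n), ∀ T : List (Perm (Fin n)), (∀ t ∈ T, t ∈ span gens) →
      ∀ t ∈ l.foldl (fun T _ => chainStep gens T) T, t ∈ span gens from
    this _ [1] (by simp [one_mem]) g h
  intro l
  induction l with
  | nil => exact fun T h => h
  | cons a l ih =>
    intro T hT
    refine ih _ fun t ht => ?_
    replace ht : t ∈ T ++ (residue gens T).toList := ht
    rw [List.mem_append, Option.mem_toList] at ht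
    rcases ht with ht | ht
    · exact hT t ht
    · obtain ⟨-, g, hg, rfl⟩ := residue_spec ht
      have hTs : span T ≤ span gens := span_le.2 hT
      obtain ⟨k, hk, h'⟩ := siftStep_foldl_mem (T := T) 0 (List.finRange n)
        (fun j _ => Nat.zero_le _) g
      rw [level_zero] at hk
      rw [sift, h']
      refine mul_mem (hTs hk) ?_
      rcases mem_candidates.1 hg with hg | ⟨a, ha, b, hb, rfl⟩
      · exact subset_span hg
      · exact mul_mem (hT a ha) (hT b hb)

theorem span_chain (gens : List (Perm (Fin n))) : span (chain gens) = span gens := by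
  refine le_antisymm (span_le.2 fun t ht => mem_chain ht) (span_le.2 fun g hg => ?_)
  exact (isComplete_chain gens).sift_eq_one_iff.1 ((isComplete_chain gens).gens g hg)

theorem sift_chain_eq_one_iff : sift (chain gens) g = 1 ↔ g ∈ span gens := by
  rw [(isComplete_chain gens).sift_eq_one_iff, span_chain]

theorem mem_span_level_chain_iff {i : ℕ} (hi : i ≤ n) :
    g ∈ span (level (chain gens) i) ↔ g ∈ span gens ∧ FixesBelow i g := by
  rw [(isComplete_chain gens).mem_span_level_iff hi, span_chain]

end chain

/-- Stabilizers of initial segments, read off from a stabilizer chain. -/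
def chainRoutine : StabRoutine := fun _ gens i => level (chain gens) i

theorem chainRoutine_isCorrect : chainRoutine.IsCorrect := by
  intro n gens i
  ext g
  rw [chainRoutine, mem_span_level_chain_iff i.2.le, Subgroup.mem_inf, mem_fixingSubgroup_iff]
  rfl

end HSP

end

noncomputable section

namespace HSP

open Equiv

/-! ## Transversals and factorizations -/

section transversal

variable {n : ℕ} {gens T : List (Perm (Fin n))} {g : Perm (Fin n)}

/-- Representatives in `T` of the cosets of the stabilizer of `i` in the stabilizer of all points
before `i`. -/
def transversal (T : List (Perm (Fin n))) (i : Fin n) : List (Perm (Fin n)) :=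
  (List.finRange n).flatMap fun j => ((level T i).find? fun t => decide (t i = j)).toList

theorem mem_transversal {i : Fin n} {t : Perm (Fin n)} (h : t ∈ transversal T i) :
    t ∈ T ∧ FixesBelow i t := by
  simp only [transversal, List.mem_flatMap, Option.mem_toList] at h
  obtain ⟨j, -, h⟩ := h
  exact mem_level.1 (List.mem_of_find?_eq_some h)

theorem transversal_injOn {i : Fin n} {t t' : Perm (Fin n)} (h : t ∈ transversal T i)
    (h' : t' ∈ transversal T i) (he : t i = t' i) : t = t' := by
  simp only [transversal, List.mem_flatMap, Option.mem_toList] at h h'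
  obtain ⟨j, -, h⟩ := h
  obtain ⟨j', -, h'⟩ := h'
  have hj : t i = j := by simpa using List.find?_some h
  have hj' : t' i = j' := by simpa using List.find?_some h'
  rw [← hj, he, hj', h'] at h
  exact (Option.some.inj h).symm

theorem exists_mem_transversal {i : Fin n} {t : Perm (Fin n)} (h : t ∈ T) (h' : FixesBelow i t) :
    ∃ t' ∈ transversal T i, t' i = t i := by
  have : (level T i).find? (fun s => decide (s i = t i)) ≠ none := by
    simp only [ne_eq, List.find?_eq_none, decide_eq_true_eq, not_forall, not_not]
    exact ⟨t, mem_level.2 ⟨h, h'⟩, rfl⟩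
  obtain ⟨s, hs⟩ := Option.ne_none_iff_exists'.1 this
  refine ⟨s, ?_, by simpa using List.find?_some hs⟩
  simp only [transversal, List.mem_flatMap, Option.mem_toList]
  refine ⟨t i, List.mem_finRange _, ?_⟩
  convert hs

theorem nodup_transversal (i : Fin n) : (transversal T i).Nodup := by
  classical
  rw [transversal, List.nodup_flatMap]
  refine ⟨fun j _ => ?_, (List.nodup_finRange n).imp_of_mem ?_⟩
  · generalize (level T i).find? _ = o
    cases o <;> simp
  · intro j j' _ _ hne t h h'
    rw [Option.mem_toList] at h h'
    have hj : t i = j := by simpa using List.find?_some h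
    have hj' : t i = j' := by simpa using List.find?_some h'
    exact hne (hj.symm.trans hj')

theorem length_transversal_le (i : Fin n) : (transversal T i).length ≤ n := by
  rw [transversal, List.length_flatMap]
  refine (List.sum_le_card_nsmul _ 1 ?_).trans (by simp)
  intro m hm
  obtain ⟨j, -, rfl⟩ := List.mem_map.1 hm
  generalize (level T i).find? _ = o
  cases o <;> simp

theorem transversal_ne_nil (hT : IsComplete gens T) (i : Fin n) : transversal T i ≠ [] := by
  obtain ⟨t, ht, -⟩ := exists_mem_transversal hT.one_mem (fixesBelow_one i)
  exact List.ne_nil_of_mem ht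

/-- Every element of the group has exactly one factorization into members of the transversals. -/
theorem IsComplete.existsUnique_factorization (hT : IsComplete gens T) {m k : ℕ} (hm : m + k = n)
    (hg : g ∈ span (level T m)) :
    ∃! c, List.Forall₂ (· ∈ ·) c (((List.finRange n).drop m).map (transversal T)) ∧ c.prod = g := by
  induction k generalizing m g with
  | zero =>
    have : g = 1 := by
      obtain rfl : m = n := by omega
      exact (fixesBelow_of_mem_span hg).eq_one
    rw [List.drop_of_length_le (by simp; omega)]
    exact ⟨[], by simp [this], fun c hc => by simpa using hc.1⟩
  | succ k ih =>
    have hmn : m < n := by omega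
    rw [List.drop_eq_getElem_cons (by simpa using hmn)]
    simp only [List.map_cons, List.getElem_finRange, Fin.cast_mk]
    set i : Fin n := ⟨m, hmn⟩ with hi
    obtain ⟨s, hs, hs', hs'', -⟩ := hT.exists_mem (i := i) hg
    obtain ⟨t, ht, hti⟩ := exists_mem_transversal hs hs'
    obtain ⟨htT, htm⟩ := mem_transversal ht
    have htg : t i = g i := hti.trans hs''
    have hmem : t⁻¹ * g ∈ span (level T (m + 1)) := by
      rw [hT.mem_span_level_iff hmn]
      refine ⟨mul_mem (inv_mem (subset_span htT)) ((hT.mem_span_level_iff hmn.le).1 hg).1, ?_⟩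
      exact htm.succ_inv_mul (i := i) (fixesBelow_of_mem_span hg) htg
    obtain ⟨c, ⟨hc, hcg⟩, huniq⟩ := ih (by omega) hmem
    refine ⟨t :: c, ⟨.cons ht hc, by rw [List.prod_cons, hcg, mul_inv_cancel_left]⟩, ?_⟩
    rintro c' ⟨hc', rfl⟩
    obtain ⟨t', d, ht', hd, rfl⟩ := List.forall₂_cons_right_iff.1 hc'
    have hdm : d.prod ∈ span (level T (m + 1)) := by
      refine Subgroup.list_prod_mem _ fun x hx => ?_
      obtain ⟨l, hl, hxl⟩ : ∃ l ∈ ((List.finRange n).drop (m + 1)).map (transversal T), x ∈ l := by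
        obtain ⟨j, hj, rfl⟩ := List.getElem_of_mem hx
        exact ⟨_, List.getElem_mem _, hd.get hj (hd.length_eq ▸ hj)⟩
      obtain ⟨j, hj, rfl⟩ := List.mem_map.1 hl
      have := mem_transversal hxl
      refine subset_span (mem_level.2 ⟨this.1, this.2.mono ?_⟩)
      obtain ⟨a, ha, rfl⟩ := List.getElem_of_mem hj
      simp
    -- The remaining factors fix `i`, so the first factor has the same value at `i` as the product,
    -- and members of a transversal are told apart by this value.
    obtain rfl : t' = t := by
      refine transversal_injOn ht' ht ?_
      rw [htg, List.prod_cons, Perm.mul_apply, fixesBelow_of_mem_span hdm i (by simp [hi])]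
    rw [huniq d ⟨hd, by simp⟩]

end transversal

/-! ## Running times -/

namespace FP

variable {ι : Type} {Γ : Ctx ι} {n : ι → ℕ} {T gens : ∀ i, List (Perm (Fin (n i)))}
  {g : ∀ i, Perm (Fin (n i))} {a : ι → ℕ} {x : ∀ i, Fin (n i)}

theorem pBd_perm (hn : FP Γ fun i => .ofNat (n i)) :
    PBd Γ.N fun i => n i * (2 * n i + 1) + 1 :=
  (hn.pBd_ofNat.mul (((PBd.const _ 2).mul hn.pBd_ofNat).add (.const _ 1))).add (.const _ 1)

theorem _root_.HSP.FPd.fixesBelow (hn : FP Γ fun i => .ofNat (n i))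
    (ha : FP Γ fun i => .ofNat (a i)) (hg : FP Γ fun i => .ofPerm (g i)) :
    FPd Γ fun i => FixesBelow (a i) (g i) := by
  refine FPd.forall_fin hn (FPd.imp ?_ ?_)
  · exact FPd.nat_lt (var _ _ _) (ha.weaken _ _)
  · exact FPd.fin_eq (apply (hg.weaken _ _) (var _ _ _)) (var _ _ _)

theorem matching (hn : FP Γ fun i => .ofNat (n i)) (hT : FP Γ fun i => encL .ofPerm (T i))
    (hg : FP Γ fun i => .ofPerm (g i)) (hx : FP Γ fun i => encF (x i)) :
    FP Γ fun i => encO .ofPerm (matching (T i) (g i) (x i)) := by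
  classical
  refine hT.find? (e := fun _ => Data.ofPerm) (FPd.congr (p := fun p : MemIx T =>
    FixesBelow (x p.i) p.b ∧ FixesBelow (x p.i) (g p.i) ∧ p.b (x p.i) = g p.i (x p.i)) ?_
      fun p => by simp)
  refine (FPd.fixesBelow (hn.weaken _ _) (hx.weaken _ _) (var _ _ _)).and
    ((FPd.fixesBelow (hn.weaken _ _) (hx.weaken _ _) (hg.weaken _ _)).and (FPd.fin_eq ?_ ?_))
  · exact apply (var _ _ _) (hx.weaken _ _)
  · exact apply (hg.weaken _ _) (hx.weaken _ _)

theorem getD_perm {o : ∀ i, Option (Perm (Fin (n i)))} (hn : FP Γ fun i => .ofNat (n i))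
    (ho : FP Γ fun i => encO .ofPerm (o i)) : FP Γ fun i => .ofPerm ((o i).getD 1) := by
  refine ho.option (e := fun _ => Data.ofPerm) ((hn.reindex _).perm_one.congr fun j => by simp [j.2])
    ((var _ _ _).congr fun p => ?_)
  rw [Option.mem_def.1 (Option.mem_toList.1 p.mem), Option.getD_some]

theorem siftStep (hn : FP Γ fun i => .ofNat (n i)) (hT : FP Γ fun i => encL .ofPerm (T i))
    (hg : FP Γ fun i => .ofPerm (g i)) (hx : FP Γ fun i => encF (x i)) :
    FP Γ fun i => .ofPerm (siftStep (T i) (g i) (x i)) :=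
  perm_mul hn (perm_inv hn (getD_perm hn (matching hn hT hg hx))) hg

theorem sift (hn : FP Γ fun i => .ofNat (n i)) (hT : FP Γ fun i => encL .ofPerm (T i))
    (hg : FP Γ fun i => .ofPerm (g i)) : FP Γ fun i => .ofPerm (sift (T i) (g i)) := by
  refine hn.finRange.foldl (es := fun _ => Data.ofPerm) hg hn.pBd_perm
    (fun i l' _ => size_ofPerm_le _) ?_
  refine siftStep ((hn.weaken _ _).weaken _ _) ((hT.weaken _ _).weaken _ _) ?_ ?_
  · exact (var _ _ _).weaken _ _
  · exact var _ _ _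

theorem candidates (hn : FP Γ fun i => .ofNat (n i)) (hG : FP Γ fun i => encL .ofPerm (gens i))
    (hT : FP Γ fun i => encL .ofPerm (T i)) :
    FP Γ fun i => encL .ofPerm (candidates (gens i) (T i)) := by
  refine hG.encL_append ((hT.product hT).map (e' := fun _ => Data.ofPerm) ?_)
  have h := var Γ (fun p : MemIx fun i => T i ×ˢ T i => p.i)
    fun p => .cons (.ofPerm p.b.1) (.ofPerm p.b.2)
  exact perm_mul (hn.weaken _ _) h.fst h.snd

theorem residue (hn : FP Γ fun i => .ofNat (n i)) (hG : FP Γ fun i => encL .ofPerm (gens i))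
    (hT : FP Γ fun i => encL .ofPerm (T i)) :
    FP Γ fun i => encO .ofPerm (residue (gens i) (T i)) := by
  refine ((candidates hn hG hT).map (e' := fun _ => Data.ofPerm) ?_).find? ?_
  · exact sift (hn.weaken _ _) (hT.weaken _ _) (var _ _ _)
  · have h : FP (Γ.ext (fun p : MemIx fun i =>
        (HSP.candidates (gens i) (T i)).map (HSP.sift (T i)) => p.i) fun p => .ofPerm p.b)
        fun p => .ofPerm p.b := var _ _ _
    exact (FPd.perm_eq h (perm_one (hn.weaken _ _))).not.congr fun p => by simp

theorem chainStep (hn : FP Γ fun i => .ofNat (n i)) (hG : FP Γ fun i => encL .ofPerm (gens i))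
    (hT : FP Γ fun i => encL .ofPerm (T i)) :
    FP Γ fun i => encL .ofPerm (chainStep (gens i) (T i)) :=
  hT.encL_append (residue hn hG hT)

theorem chain (hn : FP Γ fun i => .ofNat (n i)) (hG : FP Γ fun i => encL .ofPerm (gens i)) :
    FP Γ fun i => encL .ofPerm (chain (gens i)) := by
  -- Each round adds at most one permutation, which bounds the list in all intermediate states.
  have hlen : ∀ i (l : List (Fin (n i) × Fin (n i))) (T : List (Perm (Fin (n i)))),
      (l.foldl (fun T _ => HSP.chainStep (gens i) T) T).length ≤ T.length + l.length := by
    intro i l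
    induction l with
    | nil => simp
    | cons a l ih =>
      intro T
      refine (ih _).trans ?_
      have : (HSP.residue (gens i) T).toList.length ≤ 1 := by
        cases HSP.residue (gens i) T <;> simp
      simp only [HSP.chainStep, List.length_append, List.length_cons]
      omega
  refine (hn.finRange.product hn.finRange).foldl (es := fun _ => encL Data.ofPerm)
    ((perm_one hn).cons (.nil _))
    (((((PBd.const _ 1).add (hn.pBd_ofNat.mul hn.pBd_ofNat)).mul
      (hn.pBd_perm.add (.const _ 1)))).add (.const _ 1))
    (fun i l' h => (size_encL_le fun g _ => size_ofPerm_le g).trans ?_) ?_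
  · gcongr
    refine (hlen i l' [1]).trans ?_
    have := h.length_le
    rw [List.length_product, List.length_finRange] at this
    simpa using this
  · refine chainStep ((hn.weaken _ _).weaken _ _) ((hG.weaken _ _).weaken _ _) ?_
    exact (var _ _ _).weaken _ _

theorem level (hn : FP Γ fun i => .ofNat (n i)) (hT : FP Γ fun i => encL .ofPerm (T i))
    (ha : FP Γ fun i => .ofNat (a i)) : FP Γ fun i => encL .ofPerm (level (T i) (a i)) := by
  refine hT.filter (e := fun _ => Data.ofPerm)
    ((FPd.fixesBelow (hn.weaken _ _) (ha.weaken _ _) (g := fun p => p.b) ?_).congr fun p => ?_)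
  · exact var _ _ _
  · simp

theorem transversal (hn : FP Γ fun i => .ofNat (n i)) (hT : FP Γ fun i => encL .ofPerm (T i))
    (hx : FP Γ fun i => encF (x i)) : FP Γ fun i => encL .ofPerm (transversal (T i) (x i)) := by
  refine hn.finRange.flatMap (e' := fun _ => Data.ofPerm) ?_
  refine FP.find? (e := fun _ => Data.ofPerm) (level (hn.weaken _ _) (hT.weaken _ _)
    (hx.weaken _ _)) ((FPd.fin_eq (x := fun p => p.b (x p.i.i)) (x' := fun p => p.i.b)
      (apply ?_ ((hx.weaken _ _).weaken _ _)) ?_).congr fun p => ?_)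
  · exact var _ _ _
  · exact (var _ _ _).weaken _ _
  · simp

end FP

end HSP

end

/-! ### Exact sampling with fair coins -/

noncomputable section

namespace HSP

open scoped ENNReal NNReal

/-! ## Runs are determined by the coins -/

/-- Coin sequences of halting runs form a prefix code. The arbitrary continuations `r`, `r'` make
the induction work: in a composed program it is not known beforehand where the coins of the first
part end. -/
theorem Run.unique {O p d w t a} (h : Run O p d w t a) : ∀ {w' t' a' r r'}, Run O p d w' t' a' →
    w ++ r = w' ++ r' → w = w' ∧ t = t' ∧ a = a' := by
  induction h with
  | copy d => rintro _ _ _ _ _ ⟨⟩ _; simp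
  | nil d => rintro _ _ _ _ _ ⟨⟩ _; simp
  | head d => rintro _ _ _ _ _ ⟨⟩ _; simp
  | tail d => rintro _ _ _ _ _ ⟨⟩ _; simp
  | coin d b => rintro _ _ _ _ _ ⟨⟩ h; simp_all
  | oracle d => rintro _ _ _ _ _ ⟨⟩ _; simp
  | pair _ _ ih₁ ih₂ =>
    intro _ _ _ r r' h' hw
    cases h' with
    | pair h₁ h₂ =>
      rw [List.append_assoc, List.append_assoc] at hw
      obtain ⟨rfl, rfl, rfl⟩ := ih₁ h₁ hw
      obtain ⟨rfl, rfl, rfl⟩ := ih₂ h₂ (List.append_cancel_left hw)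
      simp
  | comp _ _ ih₁ ih₂ =>
    intro _ _ _ r r' h' hw
    cases h' with
    | comp h₁ h₂ =>
      rw [List.append_assoc, List.append_assoc] at hw
      obtain ⟨rfl, rfl, rfl⟩ := ih₁ h₁ hw
      obtain ⟨rfl, rfl, rfl⟩ := ih₂ h₂ (List.append_cancel_left hw)
      simp
  | cond_true _ hne _ ih₁ ih₂ =>
    intro _ _ _ r r' h' hw
    cases h' with
    | cond_true h₁ _ h₂ =>
      rw [List.append_assoc, List.append_assoc] at hw
      obtain ⟨rfl, rfl, rfl⟩ := ih₁ h₁ hw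
      obtain ⟨rfl, rfl, rfl⟩ := ih₂ h₂ (List.append_cancel_left hw)
      simp
    | cond_false h₁ he h₂ =>
      rw [List.append_assoc, List.append_assoc] at hw
      obtain ⟨rfl, rfl, rfl⟩ := ih₁ h₁ hw
      exact absurd he hne
  | cond_false _ he _ ih₁ ih₂ =>
    intro _ _ _ r r' h' hw
    cases h' with
    | cond_false h₁ _ h₂ =>
      rw [List.append_assoc, List.append_assoc] at hw
      obtain ⟨rfl, rfl, rfl⟩ := ih₁ h₁ hw
      obtain ⟨rfl, rfl, rfl⟩ := ih₂ h₂ (List.append_cancel_left hw)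
      simp
    | cond_true h₁ hne h₂ =>
      rw [List.append_assoc, List.append_assoc] at hw
      obtain ⟨rfl, rfl, rfl⟩ := ih₁ h₁ hw
      exact absurd he hne
  | loop_done he =>
    intro _ _ _ r r' h' hw
    cases h' with
    | loop_done => simp
    | loop_step hne => exact absurd he hne
  | loop_step hne _ _ ih₁ ih₂ =>
    intro _ _ _ r r' h' hw
    cases h' with
    | loop_done he => exact absurd he hne
    | loop_step _ h₁ h₂ =>
      rw [List.append_assoc, List.append_assoc] at hw
      obtain ⟨rfl, rfl, rfl⟩ := ih₁ h₁ hw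
      obtain ⟨rfl, rfl, rfl⟩ := ih₂ h₂ (List.append_cancel_left hw)
      simp

theorem Run.unique' {O p d w t a t' a'} (h : Run O p d w t a) (h' : Run O p d w t' a') :
    t = t' ∧ a = a' :=
  (h.unique h' (r := []) (r' := []) rfl).2

/-! ## Random walks driven by fair coins -/

theorem tsum_list_bool (f : List Bool → ℝ≥0∞) :
    ∑' w, f w = f [] + (∑' w, f (true :: w) + ∑' w, f (false :: w)) := by
  let e : Unit ⊕ List Bool ⊕ List Bool ≃ List Bool :=
    { toFun := fun o => match o with
        | .inl _ => []
        | .inr (.inl w) => true :: w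
        | .inr (.inr w) => false :: w
      invFun := fun w => match w with
        | [] => .inl ()
        | true :: w => .inr (.inl w)
        | false :: w => .inr (.inr w)
      left_inv := by rintro (_ | _ | _) <;> rfl
      right_inv := by rintro (_ | ⟨_ | _, _⟩) <;> rfl }
  rw [← e.tsum_eq, ENNReal.summable.tsum_sum ENNReal.summable,
    ENNReal.summable.tsum_sum ENNReal.summable, tsum_fintype]
  simp [e]

section walk

variable {σ : Type} (step : σ → Bool → σ) (done : σ → Prop) [DecidablePred done]

/-- The final state of the walk from `s`, if it stops exactly when the coins `w` are used up. -/
def haltsAt : σ → List Bool → Option σ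
  | s, [] => if done s then some s else none
  | s, b :: w => if done s then none else haltsAt (step s b) w

/-- The contribution of the coins `w` to the expectation of `χ a * c |w|`, with `a` the final
state. -/
def walkTerm (χ : σ → ℝ≥0∞) (c : ℕ → ℝ≥0∞) (s : σ) (w : List Bool) : ℝ≥0∞ :=
  ((haltsAt step done s w).elim 0 χ) * c w.length * 2⁻¹ ^ w.length

variable {step done} {χ : σ → ℝ≥0∞} {c : ℕ → ℝ≥0∞} {s : σ}

theorem haltsAt_of_done (h : done s) (w : List Bool) :
    haltsAt step done s w = if w = [] then some s else none := by
  cases w <;> simp [haltsAt, h]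

theorem walkTerm_cons (h : ¬ done s) (b : Bool) (w : List Bool) :
    walkTerm step done χ c s (b :: w) =
      2⁻¹ * walkTerm step done χ (fun k => c (k + 1)) (step s b) w := by
  simp only [walkTerm, haltsAt, h, if_false, List.length_cons, pow_succ]
  ring

theorem walkTerm_nil (h : ¬ done s) : walkTerm step done χ c s [] = 0 := by
  simp [walkTerm, haltsAt, h]

theorem tsum_walkTerm_of_done (h : done s) : ∑' w, walkTerm step done χ c s w = χ s * c 0 := by
  rw [tsum_eq_single []]
  · simp [walkTerm, haltsAt, h]
  · intro w hw
    simp [walkTerm, haltsAt_of_done h, hw]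

theorem tsum_walkTerm (h : ¬ done s) : ∑' w, walkTerm step done χ c s w =
    2⁻¹ * (∑' w, walkTerm step done χ (fun k => c (k + 1)) (step s true) w +
      ∑' w, walkTerm step done χ (fun k => c (k + 1)) (step s false) w) := by
  rw [tsum_list_bool]
  simp only [walkTerm_cons h, walkTerm_nil h, ENNReal.tsum_mul_left, zero_add, mul_add]

variable {I : σ → Prop} (hI : ∀ s b, I s → ¬ done s → I (step s b))
include hI

/-- Supermartingale argument: if a potential dominates the payoff at stopping states and does not
increase on average, it bounds the expected payoff. The first argument of `Φ` counts the coins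
already tossed. -/
theorem tsum_walkTerm_le (Φ : ℕ → σ → ℝ≥0∞) (h₁ : ∀ k s, I s → done s → χ s * c k ≤ Φ k s)
    (h₂ : ∀ k s, I s → ¬ done s →
      2⁻¹ * (Φ (k + 1) (step s true) + Φ (k + 1) (step s false)) ≤ Φ k s) (hs : I s) :
    ∑' w, walkTerm step done χ c s w ≤ Φ 0 s := by
  -- Truncated to fewer than `N` coins, the bound follows by induction on `N` from the first coin;
  -- every finite partial sum is covered by some `N`.
  have key : ∀ N k s, I s → ∑' w : List Bool, (if w.length < N then
      walkTerm step done χ (fun j => c (j + k)) s w else 0) ≤ Φ k s := by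
    intro N
    induction N with
    | zero => intro k s _; simp
    | succ N ih =>
      intro k s hs
      by_cases hd : done s
      · refine le_trans (ENNReal.tsum_le_tsum (g := walkTerm step done χ (fun j => c (j + k)) s)
          fun w => by split <;> simp) ?_
        rw [tsum_walkTerm_of_done hd, zero_add]
        exact h₁ k s hs hd
      · rw [tsum_list_bool]
        simp only [walkTerm_cons hd, walkTerm_nil hd, List.length_cons, Nat.add_lt_add_iff_right,
          ← mul_ite_zero, ENNReal.tsum_mul_left, ite_self, zero_add, ← mul_add]
        refine le_trans ?_ (h₂ k s hs hd)
        have e : ∀ j, j + 1 + k = j + (k + 1) := fun j => by omega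
        simp only [e]
        gcongr
        · exact ih _ _ (hI s true hs hd)
        · exact ih _ _ (hI s false hs hd)
  rw [ENNReal.tsum_eq_iSup_sum]
  refine iSup_le fun S => ?_
  obtain ⟨N, hN⟩ : ∃ N, ∀ w ∈ S, w.length < N :=
    ⟨S.sup List.length + 1, fun w hw => Nat.lt_succ_of_le (Finset.le_sup (f := List.length) hw)⟩
  refine le_trans ?_ (key N 0 s hs)
  refine le_trans (le_of_eq (Finset.sum_congr rfl fun w hw => ?_)) (ENNReal.sum_le_tsum S)
  rw [if_pos (hN w hw)]
  rfl

/-- The expected number of coins, plus one, is bounded by a potential. -/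
theorem tsum_walkTerm_length_le (Ψ : σ → ℝ≥0∞)
    (hΨ : ∀ s, I s → ¬ done s → 1 + 2⁻¹ * (Ψ (step s true) + Ψ (step s false)) ≤ Ψ s) (hs : I s) :
    ∑' w, walkTerm step done (fun _ => 1) (fun k => k + 1) s w ≤ Ψ s + 1 := by
  refine (tsum_walkTerm_le hI (fun k s => Ψ s + (k + 1)) (fun k s _ _ => by simp)
    (fun k s hs hd => ?_) hs).trans (by simp)
  refine le_trans (le_of_eq ?_) (add_le_add_left (hΨ s hs hd) _)
  have : (2⁻¹ : ℝ≥0∞) * (k + 2 + (k + 2)) = k + 2 := by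
    rw [← two_mul, ← mul_assoc, ENNReal.inv_mul_cancel (by simp) (by simp), one_mul]
  push_cast
  calc (2⁻¹ : ℝ≥0∞) * (Ψ (step s true) + (k + 1 + 1) + (Ψ (step s false) + (k + 1 + 1)))
      = 2⁻¹ * (Ψ (step s true) + Ψ (step s false)) + 2⁻¹ * (k + 2 + (k + 2)) := by
        rw [add_assoc (k : ℝ≥0∞), one_add_one_eq_two]; ring
    _ = _ := by rw [this, ← one_add_one_eq_two]; ring

/-- Bounded harmonic functions are determined by their values at the stopping states. -/
theorem tsum_walkTerm_eq (Ψ V : σ → ℝ≥0∞) (hΨ' : ∀ s, Ψ s ≠ ⊤)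
    (hΨ : ∀ s, I s → ¬ done s → 1 + 2⁻¹ * (Ψ (step s true) + Ψ (step s false)) ≤ Ψ s)
    (h₁ : ∀ s, I s → done s → V s = χ s)
    (h₂ : ∀ s, I s → ¬ done s → V s = 2⁻¹ * (V (step s true) + V (step s false)))
    (h₃ : ∀ s, I s → V s ≤ 1) (hs : I s) :
    ∑' w, walkTerm step done χ (fun _ => 1) s w = V s := by
  have hhalf : (2⁻¹ : ℝ≥0∞) * (1 + 1) = 1 := by
    rw [one_add_one_eq_two, ENNReal.inv_mul_cancel (by simp) (by simp)]
  refine le_antisymm (tsum_walkTerm_le hI (fun _ => V) (fun _ s hs hd => by simp [h₁ s hs hd])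
    (fun _ s hs hd => (h₂ s hs hd).ge) hs) ?_
  -- `U` plays the role of the probability of still walking after `N` coins. The potential `Ψ` pays
  -- at least one unit per coin, so `(N + 1) * U ≤ Ψ s` as in Markov's inequality, and the mass
  -- missing from the sum tends to zero.
  have key : ∀ N : ℕ, ∀ s, I s → ∃ U : ℝ≥0∞, U ≤ 1 ∧ (N + 1) * U ≤ Ψ s ∧
      V s ≤ ∑' w, walkTerm step done χ (fun _ => 1) s w + U := by
    intro N
    induction N with
    | zero =>
      intro s hs
      by_cases hd : done s
      · refine ⟨0, by simp, by simp, ?_⟩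
        rw [tsum_walkTerm_of_done hd, h₁ s hs hd]
        simp
      · refine ⟨1, le_rfl, ?_, ?_⟩
        · simpa using le_trans le_self_add (hΨ s hs hd)
        · exact (h₃ s hs).trans le_add_self
    | succ N ih =>
      intro s hs
      by_cases hd : done s
      · refine ⟨0, by simp, by simp, ?_⟩
        rw [tsum_walkTerm_of_done hd, h₁ s hs hd]
        simp
      · obtain ⟨U, hU, hU', hU''⟩ := ih _ (hI s true hs hd)
        obtain ⟨U₁, hU₁, hU₁', hU₁''⟩ := ih _ (hI s false hs hd)
        have hle : 2⁻¹ * (U + U₁) ≤ 1 := by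
          rw [← hhalf]
          gcongr
        refine ⟨2⁻¹ * (U + U₁), hle, ?_, ?_⟩
        · refine le_trans ?_ (hΨ s hs hd)
          push_cast
          calc ((N : ℝ≥0∞) + 1 + 1) * (2⁻¹ * (U + U₁))
              = 2⁻¹ * (U + U₁) + 2⁻¹ * ((N + 1) * U + (N + 1) * U₁) := by ring
            _ ≤ _ := by gcongr
        · rw [tsum_walkTerm hd, h₂ s hs hd, ← mul_add]
          refine mul_le_mul_right (le_trans (add_le_add hU'' hU₁'') (le_of_eq ?_)) _
          ring
  refine le_of_forall_pos_le_add fun ε hε => ?_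
  by_cases hεt : ε = ⊤
  · simp [hεt]
  obtain ⟨N, hN⟩ := ENNReal.exists_nat_gt (ENNReal.div_ne_top (hΨ' s) hε.ne')
  obtain ⟨U, -, hU, hU'⟩ := key N s hs
  refine hU'.trans (add_le_add_right ?_ _)
  rw [ENNReal.div_lt_iff (Or.inl hε.ne') (Or.inl hεt)] at hN
  have hN1 : ((N : ℝ≥0∞) + 1) * U ≤ (N + 1) * ε := hU.trans (hN.le.trans (by gcongr; simp))
  exact (ENNReal.mul_le_mul_iff_right (by simp) (by simp)).1 hN1

end walk

end HSP

end

noncomputable section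

namespace HSP

open Equiv
open scoped ENNReal NNReal

/-! ## Uniform samples from lists -/

section sampler

variable {β γ : Type}

/-- Distribute the members of a list alternately to two lists. -/
def halves (l : List γ) : List γ × List γ := l.foldr (fun x p => (x :: p.2, p.1)) ([], [])

theorem halves_cons (x : γ) (l : List γ) : halves (x :: l) = (x :: (halves l).2, (halves l).1) :=
  rfl

theorem halves_length (l : List γ) : (halves l).1.length = (l.length + 1) / 2 ∧
    (halves l).2.length = l.length / 2 := by
  induction l with
  | nil => simp [halves]
  | cons x l ih =>
    obtain ⟨h₁, h₂⟩ := ih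
    rw [halves_cons]
    simp only [List.length_cons, h₁, h₂]
    exact ⟨by omega, trivial⟩

theorem halves_countP (p : γ → Bool) (l : List γ) :
    (halves l).1.countP p + (halves l).2.countP p = l.countP p := by
  induction l with
  | nil => simp [halves]
  | cons x l ih => simp only [halves_cons, List.countP_cons]; omega

/-- The state of the sampler: the lists to be sampled from, the members of the first list
that are still possible, and the sample so far.  Members `none` stand for a rejection. -/
abbrev SampleState (β : Type) : Type := List (List (Option β)) × List (Option β) × List β

/-- Each step consumes exactly one coin: while several candidates remain the coin selects a half;
with one candidate the coin is ignored, and the candidate is accepted or, if it is `none`, the same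
list is started afresh. -/
def sampleStep (s : SampleState β) (b : Bool) : SampleState β :=
  if 1 < s.2.1.length then (s.1, if b then (halves s.2.1).1 else (halves s.2.1).2, s.2.2)
  else match s.2.1.head?.join with
    | some g => (s.1.tail, s.1.tail.head?.getD [], s.2.2 ++ [g])
    | none => (s.1, s.1.head?.getD [], s.2.2)

theorem sampleStep_of_lt {todo : List (List (Option β))} {cur : List (Option β)} {acc : List β}
    (h : 1 < cur.length) (b : Bool) : sampleStep (todo, cur, acc) b =
      (todo, if b then (halves cur).1 else (halves cur).2, acc) := if_pos h

def sampleStart (todo : List (List (Option β))) : SampleState β := (todo, todo.head?.getD [], [])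

def SampleDone (s : SampleState β) : Prop := s.1 = []

open Classical in
/-- A list of length `W`, consisting of distinct members and some rejections. -/
structure IsPadded (W : ℕ) (L : List (Option β)) : Prop where
  length : L.length = W
  pow : ∃ j, W = 2 ^ j
  nodup : ∀ r, L.countP (fun o => decide (o = some r)) ≤ 1
  pos : 0 < L.countP Option.isSome

/-- Before the end, the candidates number a power of two, so both halves always have equal length
and a fair coin selects uniformly. -/
structure SampleInv (W m : ℕ) (s : SampleState β) : Prop where
  padded : ∀ L ∈ s.1, IsPadded W L
  length : s.1.length + s.2.2.length = m
  le : s.2.1.length ≤ W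
  pow : s.1 ≠ [] → ∃ j, s.2.1.length = 2 ^ j

theorem sampleInv_start {W : ℕ} {todo : List (List (Option β))} (h : ∀ L ∈ todo, IsPadded W L) :
    SampleInv W todo.length (sampleStart todo) := by
  cases todo with
  | nil => exact ⟨by simp [sampleStart], rfl, by simp [sampleStart], by simp [sampleStart]⟩
  | cons L todo =>
    have hL := h L List.mem_cons_self
    exact ⟨h, rfl, hL.length.le, fun _ => by simpa [sampleStart, hL.length] using hL.pow⟩

theorem SampleInv.step {W m : ℕ} {s : SampleState β} (h : SampleInv W m s) (hd : ¬ SampleDone s)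
    (b : Bool) : SampleInv W m (sampleStep s b) := by
  obtain ⟨todo, cur, acc⟩ := s
  obtain ⟨h₁, h₂, h₃, h₄⟩ := h
  simp only [SampleDone] at *
  have head_le : ∀ l : List (List (Option β)), (∀ L ∈ l, IsPadded W L) →
      (l.head?.getD []).length ≤ W ∧ (l ≠ [] → ∃ j, (l.head?.getD []).length = 2 ^ j) := by
    rintro (_ | ⟨L, l⟩) hl
    · simp
    · have hL := hl L List.mem_cons_self
      exact ⟨hL.length.le, fun _ => by simpa [hL.length] using hL.pow⟩
  unfold sampleStep
  split
  · rename_i hlt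
    obtain ⟨j, hj⟩ := h₄ hd
    have hlen := halves_length cur
    simp only at hlt hj h₃
    have hj0 : j ≠ 0 := by rintro rfl; simp [hj] at hlt
    obtain ⟨j, rfl⟩ : ∃ j', j = j' + 1 := Nat.exists_eq_succ_of_ne_zero hj0
    rw [hj, pow_succ] at hlen
    rw [hj, pow_succ] at h₃
    refine ⟨h₁, h₂, ?_, fun _ => ⟨j, ?_⟩⟩ <;> simp only <;> split <;> omega
  · split
    · have := head_le todo.tail fun L hL => h₁ L (List.mem_of_mem_tail hL)
      refine ⟨fun L hL => h₁ L (List.mem_of_mem_tail hL), ?_, this.1, this.2⟩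
      have := List.length_pos_iff.2 hd
      simp only [List.length_tail, List.length_append, List.length_singleton] at *
      omega
    · have := head_le todo h₁
      exact ⟨h₁, h₂, this.1, this.2⟩

open Classical in
/-- The probability of the sample `r` from the padded list `L`. -/
def weight (L : List (Option β)) (r : β) : ℝ≥0 :=
  L.countP (fun o => decide (o = some r)) / L.countP Option.isSome

/-- The probability of the sample `z` from a list of padded lists. -/
def weights : List (List (Option β)) → List β → ℝ≥0
  | [], [] => 1
  | L :: todo, r :: z => weight L r * weights todo z
  | _, _ => 0

open Classical in
/-- The probability of the sample `r`, when the possible members of `L` are those in `cur`. -/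
def curWeight (L cur : List (Option β)) (r : β) : ℝ≥0 :=
  (cur.countP (fun o => decide (o = some r)) + cur.countP Option.isNone * weight L r) / cur.length

/-- The probability that the remaining sample is `z`. -/
def restWeight : List (List (Option β)) → List (Option β) → List β → ℝ≥0
  | [], _, [] => 1
  | L :: todo, cur, r :: z => curWeight L cur r * weights todo z
  | _, _, _ => 0

open Classical in
/-- The probability that the final sample is `z`. -/
def stateWeight (z : List β) (s : SampleState β) : ℝ≥0 :=
  if s.2.2 <+: z then restWeight s.1 s.2.1 (z.drop s.2.2.length) else 0

theorem countP_isNone_add (L : List (Option β)) :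
    L.countP Option.isNone + L.countP Option.isSome = L.length := by
  induction L with
  | nil => rfl
  | cons o L ih => cases o <;> simp <;> omega

theorem IsPadded.weight_le_one {W : ℕ} {L : List (Option β)} (h : IsPadded W L) (r : β) :
    weight L r ≤ 1 := by
  have h₁ := h.nodup r
  have h₂ := h.pos
  rw [weight]
  refine div_le_one_of_le₀ ?_ (by positivity)
  exact_mod_cast (show _ ≤ _ by omega)

/-- The weight of a sample solves the equation of a restart after rejection: with `W` candidates of
which `s` are accepted, `c / s = (c + (W - s) * (c / s)) / W`. -/
theorem IsPadded.curWeight_self {W : ℕ} {L : List (Option β)} (h : IsPadded W L) (r : β) :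
    curWeight L L r = weight L r := by
  have h₂ := h.pos
  rw [curWeight, weight, ← countP_isNone_add L]
  have : (L.countP Option.isSome : ℝ≥0) ≠ 0 := by exact_mod_cast h₂.ne'
  push_cast
  have h' : ((L.countP Option.isNone : ℝ≥0) + L.countP Option.isSome) ≠ 0 := by positivity
  field_simp
  ring

theorem weights_le_one {W : ℕ} {todo : List (List (Option β))} (h : ∀ L ∈ todo, IsPadded W L)
    (z : List β) : weights todo z ≤ 1 := by
  induction todo generalizing z with
  | nil => cases z <;> simp [weights]
  | cons L todo ih =>
    cases z with
    | nil => simp [weights]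
    | cons r z =>
      rw [weights]
      exact mul_le_one' ((h L List.mem_cons_self).weight_le_one r)
        (ih (fun L hL => h L (List.mem_cons_of_mem _ hL)) z)

theorem restWeight_start {W : ℕ} {todo : List (List (Option β))} (h : ∀ L ∈ todo, IsPadded W L)
    (z : List β) : restWeight todo (todo.head?.getD []) z = weights todo z := by
  cases todo with
  | nil => cases z <;> rfl
  | cons L todo =>
    cases z with
    | nil => rfl
    | cons r z =>
      simp only [restWeight, weights, List.head?_cons, Option.getD_some]
      rw [(h L List.mem_cons_self).curWeight_self]

theorem curWeight_le_one {W : ℕ} {L : List (Option β)} (h : IsPadded W L) (cur : List (Option β))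
    (r : β) : curWeight L cur r ≤ 1 := by
  rw [curWeight]
  refine div_le_one_of_le₀ ?_ (by positivity)
  rw [← countP_isNone_add cur, add_comm]
  push_cast
  refine add_le_add (mul_le_of_le_one_right' (h.weight_le_one r)) ?_
  refine Nat.cast_le.2 (List.countP_mono_left fun o _ ho => ?_)
  simp only [decide_eq_true_eq] at ho
  simp [ho]

theorem stateWeight_le_one {W m : ℕ} {s : SampleState β} (h : SampleInv W m s) (z : List β) :
    stateWeight z s ≤ 1 := by
  obtain ⟨todo, cur, acc⟩ := s
  rw [stateWeight]
  split
  · generalize z.drop _ = z'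
    cases todo with
    | nil => cases z' <;> simp [restWeight]
    | cons L todo =>
      cases z' with
      | nil => simp [restWeight]
      | cons r z' =>
        exact mul_le_one' (curWeight_le_one (h.padded L List.mem_cons_self) cur r)
          (weights_le_one (fun L hL => h.padded L (List.mem_cons_of_mem _ hL)) z')
  · simp

theorem stateWeight_done {s : SampleState β} (h : SampleDone s) (z : List β) [Decidable (s.2.2 = z)] :
    stateWeight z s = if s.2.2 = z then 1 else 0 := by
  obtain ⟨todo, cur, acc⟩ := s
  simp only [SampleDone] at h
  subst h
  rw [stateWeight]
  split
  · rename_i hp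
    obtain ⟨z', rfl⟩ := hp
    simp only [List.drop_left]
    cases z' <;> simp [restWeight]
  · rename_i hp
    rw [if_neg]
    rintro rfl
    exact hp (List.prefix_refl _)

/-- Both halves have the same length, so the mean of the two fractions is the fraction for the whole
list. -/
theorem curWeight_halves {L cur : List (Option β)} {j : ℕ} (h : cur.length = 2 ^ (j + 1)) (r : β) :
    curWeight L (halves cur).1 r + curWeight L (halves cur).2 r = 2 * curWeight L cur r := by
  have hl := halves_length cur
  rw [h, pow_succ] at hl
  have h₁ : (halves cur).1.length = 2 ^ j := by omega
  have h₂ : (halves cur).2.length = 2 ^ j := by omega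
  rw [curWeight, curWeight, curWeight, h₁, h₂, h, ← halves_countP _ cur, ← halves_countP _ cur]
  push_cast
  rw [pow_succ]
  field_simp
  ring

/-- Harmonicity. Halving averages the current weight, rejection returns to the full list with the
same weight by `curWeight_self`, and acceptance fixes the next entry of the sample. -/
theorem stateWeight_step {W m : ℕ} {s : SampleState β} (h : SampleInv W m s)
    (hd : ¬ SampleDone s) (z : List β) :
    stateWeight z (sampleStep s true) + stateWeight z (sampleStep s false) =
      2 * stateWeight z s := by
  obtain ⟨todo, cur, acc⟩ := s
  obtain ⟨j, hj⟩ := h.pow hd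
  have hp := h.padded
  cases todo with
  | nil => exact absurd rfl hd
  | cons L todo =>
  simp only at hj hp
  by_cases hlt : 1 < cur.length
  · have hj0 : j ≠ 0 := by rintro rfl; simp [hj] at hlt
    obtain ⟨j, rfl⟩ : ∃ j', j = j' + 1 := Nat.exists_eq_succ_of_ne_zero hj0
    rw [sampleStep_of_lt hlt, sampleStep_of_lt hlt]
    simp only [if_true, stateWeight, Bool.false_eq_true, if_false]
    split
    · generalize z.drop _ = z'
      cases z' with
      | nil => simp [restWeight]
      | cons r z' =>
        simp only [restWeight]
        rw [← add_mul, curWeight_halves hj, mul_assoc]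
    · simp
  · suffices ∀ b, stateWeight z (sampleStep (L :: todo, cur, acc) b) =
        stateWeight z (L :: todo, cur, acc) by rw [this, this, two_mul]
    intro b
    have hlen : cur.length = 1 := by
      have := Nat.one_le_two_pow (n := j)
      omega
    obtain ⟨o, rfl⟩ := List.length_eq_one_iff.1 hlen
    simp only [sampleStep, hlt, if_false, List.head?_cons, Option.join_some, List.tail_cons,
      Option.getD_some]
    cases o with
    | none =>
      simp only [stateWeight]
      split
      · generalize z.drop _ = z'
        cases z' with
        | nil => rfl
        | cons r z' =>
          simp only [restWeight]
          rw [(hp L List.mem_cons_self).curWeight_self]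
          simp [curWeight]
      · rfl
    | some g =>
      simp only [stateWeight]
      rw [restWeight_start fun L hL => hp L (List.mem_cons_of_mem _ hL)]
      by_cases hpre : acc <+: z
      · rw [if_pos hpre]
        obtain ⟨z', rfl⟩ := hpre
        rw [List.drop_left]
        cases z' with
        | nil =>
          rw [if_neg]
          · rfl
          · intro hc
            simpa using hc.length_le
        | cons r z' =>
          by_cases hr : g = r
          · subst hr
            rw [if_pos ⟨z', by simp⟩]
            have : (acc ++ g :: z').drop (acc ++ [g]).length = z' := by
              simp
            rw [this]
            simp [restWeight, curWeight]
          · rw [if_neg]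
            · simp [restWeight, curWeight, hr]
            · rw [List.prefix_append_right_inj]
              simpa using hr
      · rw [if_neg hpre, if_neg fun hc => hpre ((List.prefix_append _ _).trans hc)]

/-- A bound for the expected number of steps from a given state. -/
def samplePotential (W : ℕ) (s : SampleState β) : ℝ≥0 :=
  if s.1 = [] then 0 else
    s.2.1.length + s.2.1.countP Option.isNone / s.2.1.length * W ^ 2 + (s.1.length - 1 : ℕ) * W ^ 2

/-- A fresh padded list has at most `W - 1` rejections, so it costs `W + (W - 1) / W * W ^ 2 = W ^
2` at most. -/
theorem samplePotential_start {W : ℕ} {todo : List (List (Option β))}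
    (h : ∀ L ∈ todo, IsPadded W L) (acc : List β) :
    samplePotential W (todo, todo.head?.getD [], acc) ≤ todo.length * W ^ 2 := by
  cases todo with
  | nil => simp [samplePotential]
  | cons L todo =>
    have hL := h L List.mem_cons_self
    have h₁ := hL.pos
    have h₂ := countP_isNone_add L
    rw [hL.length] at h₂
    have hW : (W : ℝ≥0) ≠ 0 := by exact_mod_cast (show W ≠ 0 by omega)
    simp only [samplePotential, reduceCtorEq, if_false, List.head?_cons, Option.getD_some,
      hL.length, List.length_cons, Nat.add_sub_cancel]
    push_cast
    rw [add_mul, one_mul, add_comm _ ((W : ℝ≥0) ^ 2)]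
    gcongr
    have : (W : ℝ≥0) + L.countP Option.isNone / W * W ^ 2 = W * (1 + L.countP Option.isNone) := by
      field_simp
    rw [this, sq]
    gcongr
    exact_mod_cast (show _ ≤ _ by omega)

/-- The first summand pays for halvings, as `1 + 2 ^ j ≤ 2 ^ (j + 1)`, and leaves one unit for the
final step on a single candidate. The second is the chance of rejection times the price `W ^ 2` of a
restart, and is preserved on average. -/
theorem samplePotential_step {W m : ℕ} {s : SampleState β} (h : SampleInv W m s)
    (hd : ¬ SampleDone s) :
    2 + (samplePotential W (sampleStep s true) + samplePotential W (sampleStep s false)) ≤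
      2 * samplePotential W s := by
  obtain ⟨todo, cur, acc⟩ := s
  obtain ⟨j, hj⟩ := h.pow hd
  have hp := h.padded
  cases todo with
  | nil => exact absurd rfl hd
  | cons L todo =>
  simp only at hj hp
  by_cases hlt : 1 < cur.length
  · have hj0 : j ≠ 0 := by rintro rfl; simp [hj] at hlt
    obtain ⟨j, rfl⟩ : ∃ j', j = j' + 1 := Nat.exists_eq_succ_of_ne_zero hj0
    have hl := halves_length cur
    rw [hj, pow_succ] at hl
    have h₁ : (halves cur).1.length = 2 ^ j := by omega
    have h₂ : (halves cur).2.length = 2 ^ j := by omega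
    rw [sampleStep_of_lt hlt, sampleStep_of_lt hlt]
    simp only [if_true, samplePotential, Bool.false_eq_true, if_false,
      reduceCtorEq, h₁, h₂, hj, ← halves_countP Option.isNone cur]
    have h1 : (1 : ℝ≥0) ≤ 2 ^ j := one_le_pow₀ one_le_two
    generalize (((L :: todo).length - 1 : ℕ) : ℝ≥0) * W ^ 2 = c
    push_cast
    rw [pow_succ (2 : ℝ≥0)]
    calc _ ≤ 2 * 2 ^ j + (2 ^ j + ((halves cur).1.countP Option.isNone : ℝ≥0) / 2 ^ j * W ^ 2 + c +
          (2 ^ j + ((halves cur).2.countP Option.isNone : ℝ≥0) / 2 ^ j * W ^ 2 + c)) := by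
          gcongr
          calc (2 : ℝ≥0) = 2 * 1 := by ring
            _ ≤ _ := by gcongr
      _ = _ := by field_simp; ring
  · suffices ∀ b, 1 + samplePotential W (sampleStep (L :: todo, cur, acc) b) ≤
        samplePotential W (L :: todo, cur, acc) by
      calc _ = (1 + samplePotential W (sampleStep (L :: todo, cur, acc) true)) +
            (1 + samplePotential W (sampleStep (L :: todo, cur, acc) false)) := by
            rw [← one_add_one_eq_two]; ring
        _ ≤ _ := by rw [two_mul]; exact add_le_add (this _) (this _)
    intro b
    have hlen : cur.length = 1 := by
      have := Nat.one_le_two_pow (n := j)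
      omega
    obtain ⟨o, rfl⟩ := List.length_eq_one_iff.1 hlen
    have hstart := samplePotential_start hp acc
    have hstart' := fun acc => samplePotential_start
      (fun L' hL => hp L' (List.mem_cons_of_mem L hL)) acc
    simp only [sampleStep, hlt, if_false, List.head?_cons, Option.join_some, List.tail_cons,
      Option.getD_some] at *
    cases o with
    | none =>
      refine (add_le_add_right hstart _).trans (le_of_eq ?_)
      simp [samplePotential]
      ring
    | some g =>
      refine (add_le_add_right (hstart' _) _).trans (le_of_eq ?_)
      simp [samplePotential]

theorem half_two_mul (b : ℝ≥0) : (2⁻¹ : ℝ≥0∞) * (2 * b : ℝ≥0) = b := by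
  rw [ENNReal.coe_mul, ← mul_assoc, ENNReal.coe_ofNat,
    ENNReal.inv_mul_cancel (by simp) (by simp), one_mul]

theorem one_add_half_potential_le {W m : ℕ} {s : SampleState β} (hs : SampleInv W m s)
    (hd : ¬ SampleDone s) : 1 + 2⁻¹ * ((samplePotential W (sampleStep s true) : ℝ≥0∞) +
      samplePotential W (sampleStep s false)) ≤ samplePotential W s := by
  have := samplePotential_step hs hd
  rw [← half_two_mul (samplePotential W s), ← ENNReal.coe_add]
  have h2 : (1 : ℝ≥0∞) = 2⁻¹ * 2 := (ENNReal.inv_mul_cancel (by simp) (by simp)).symm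
  rw [h2, ← mul_add]
  gcongr
  exact_mod_cast this

variable [DecidablePred (SampleDone (β := β))]

/-- The law of the sample. -/
theorem tsum_sample [DecidableEq (List β)] {W : ℕ} {todo : List (List (Option β))}
    (h : ∀ L ∈ todo, IsPadded W L) (z : List β) :
    ∑' w, walkTerm sampleStep SampleDone (fun s => if s.2.2 = z then 1 else 0) (fun _ => 1)
      (sampleStart todo) w = weights todo z := by
  rw [tsum_walkTerm_eq (I := SampleInv W todo.length) (fun s b hs hd => hs.step hd b)
    (fun s => samplePotential W s) (fun s => stateWeight z s) (fun s => ENNReal.coe_ne_top)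
    ?_ ?_ ?_ ?_ (sampleInv_start h)]
  · rw [stateWeight, if_pos (by exact List.nil_prefix), ← restWeight_start h z]
    rfl
  · exact fun s hs hd => one_add_half_potential_le hs hd
  · intro s _ hd
    rw [stateWeight_done hd]
    split <;> simp
  · intro s hs hd
    rw [← ENNReal.coe_add]
    rw [stateWeight_step hs hd z, half_two_mul]
  · intro s hs
    exact_mod_cast stateWeight_le_one hs z

theorem tsum_sample_length_le {W : ℕ} {todo : List (List (Option β))}
    (h : ∀ L ∈ todo, IsPadded W L) :
    ∑' w, walkTerm sampleStep SampleDone (fun _ => 1) (fun k => k + 1) (sampleStart todo) w ≤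
      (todo.length * W ^ 2 + 1 : ℕ) := by
  refine (tsum_walkTerm_length_le (I := SampleInv W todo.length) (fun s b hs hd => hs.step hd b)
    (fun s => samplePotential W s) (fun s hs hd => one_add_half_potential_le hs hd)
    (sampleInv_start h)).trans ?_
  push_cast
  gcongr
  exact_mod_cast samplePotential_start h []

end sampler

end HSP

end

noncomputable section

namespace HSP

open Equiv
open scoped ENNReal NNReal

/-! ## Padding -/

section pad

variable {β : Type}

/-- Rejections fill the list up to a power of two, so that uniform candidates cost a whole number of
coins. -/
def pad (W : ℕ) (l : List β) : List (Option β) := l.map some ++ List.replicate (W - l.length) none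

theorem countP_isSome_pad (W : ℕ) (l : List β) : (pad W l).countP Option.isSome = l.length := by
  simp [pad, List.countP_append, List.countP_map, List.countP_replicate, Function.comp_def]

open Classical in
theorem countP_eq_some_pad (W : ℕ) {l : List β} (hl : l.Nodup) (r : β) :
    (pad W l).countP (fun o => decide (o = some r)) = if r ∈ l then 1 else 0 := by
  rw [pad, List.countP_append, List.countP_map, List.countP_replicate, ← hl.count]
  simp [Function.comp_def, List.count, BEq.beq]

theorem isPadded_pad {W : ℕ} {l : List β} (hl : l.Nodup) (h0 : l ≠ []) (hW : l.length ≤ W)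
    (hpow : ∃ j, W = 2 ^ j) : IsPadded W (pad W l) := by
  classical
  refine ⟨?_, hpow, fun r => ?_, ?_⟩
  · simp [pad, hW]
  · rw [countP_eq_some_pad W hl]
    split <;> simp
  · rw [countP_isSome_pad]
    exact List.length_pos_iff.2 h0

open Classical in
theorem weights_pad (W : ℕ) {todo : List (List β)} (h : ∀ l ∈ todo, l.Nodup) (z : List β) :
    weights (todo.map (pad W)) z = if List.Forall₂ (· ∈ ·) z todo then
      (todo.map fun l => (l.length : ℝ≥0)⁻¹).prod else 0 := by
  induction todo generalizing z with
  | nil => cases z <;> simp [weights]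
  | cons l todo ih =>
    cases z with
    | nil => simp [weights]
    | cons r z =>
      rw [List.map_cons, weights, ih fun l hl => h l (List.mem_cons_of_mem _ hl), weight,
        countP_isSome_pad, countP_eq_some_pad W (h l List.mem_cons_self)]
      by_cases h₁ : r ∈ l <;> by_cases h₂ : List.Forall₂ (· ∈ ·) z todo <;>
        simp [List.forall₂_cons, h₁, h₂]

end pad

/-- A power of two between `n` and `2 * n + 1`. -/
def powAbove (n : ℕ) : ℕ := (List.range n).foldl (fun a _ => if a < n then a + a else a) 1

theorem powAbove_foldl (n : ℕ) (l : List ℕ) :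
    (∃ j, l.foldl (fun a _ => if a < n then a + a else a) 1 = 2 ^ j) ∧
    l.foldl (fun a _ => if a < n then a + a else a) 1 ≤ 2 * n + 1 ∧
    min n l.length ≤ l.foldl (fun a _ => if a < n then a + a else a) 1 := by
  induction l using List.reverseRecOn with
  | nil => exact ⟨⟨0, rfl⟩, by simp, by simp⟩
  | append_singleton l b ih =>
    obtain ⟨⟨j, hj⟩, h₂, h₃⟩ := ih
    simp only [List.foldl_append, List.foldl_cons, List.foldl_nil, List.length_append,
      List.length_singleton]
    have := Nat.one_le_two_pow (n := j)
    split
    · exact ⟨⟨j + 1, by rw [hj, pow_succ]; ring⟩, by omega, by omega⟩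
    · exact ⟨⟨j, hj⟩, by omega, by omega⟩

theorem le_powAbove (n : ℕ) : n ≤ powAbove n := by
  simpa [powAbove] using (powAbove_foldl n (List.range n)).2.2

theorem powAbove_pow (n : ℕ) : ∃ j, powAbove n = 2 ^ j := (powAbove_foldl n (List.range n)).1

/-! ## The law of a decoded sample -/

/-- All possible samples have one common weight `c`, and decoding matches them bijectively with `U`.
Total mass one then forces `c` to be the inverse cardinality, so the product of the list lengths
need not be computed. -/
theorem tsum_walkTerm_sample {β U : Type} [Fintype U] [DecidablePred (SampleDone (β := β))]
    {W : ℕ} {todo : List (List (Option β))} (h : ∀ L ∈ todo, IsPadded W L) (dec : List β → U)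
    (c : ℝ≥0) (hdec : ∀ u, ∃ z, weights todo z = c ∧ ∀ z', weights todo z' ≠ 0 →
      (dec z' = u ↔ z' = z)) (F : U → ℝ≥0∞) :
    ∑' w, walkTerm sampleStep SampleDone (fun s => F (dec s.2.2)) (fun _ => 1)
      (sampleStart todo) w = ∑ u, F u * (Fintype.card U : ℝ≥0∞)⁻¹ := by
  classical
  choose z hz hzu using hdec
  have key : ∀ F : U → ℝ≥0∞, ∑' w, walkTerm sampleStep SampleDone (fun s => F (dec s.2.2))
      (fun _ => 1) (sampleStart todo) w = ∑ u, F u * c := by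
    intro F
    have hterm : ∀ w, walkTerm sampleStep SampleDone (fun s => F (dec s.2.2))
        (fun _ => 1) (sampleStart todo) w = ∑ u, F u * walkTerm sampleStep SampleDone
          (fun s => if s.2.2 = z u then 1 else 0) (fun _ => 1) (sampleStart todo) w := by
      intro w
      rcases ho : haltsAt sampleStep SampleDone (sampleStart todo) w with _ | s
      · simp [walkTerm, ho]
      · have hne : weights todo s.2.2 ≠ 0 := by
          intro h0
          have := tsum_sample h s.2.2
          rw [h0, ENNReal.coe_zero, ENNReal.tsum_eq_zero] at this
          have := this w
          simp [walkTerm, ho] at this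
        simp only [walkTerm, ho, Option.elim_some]
        have : ∀ u, s.2.2 = z u ↔ u = dec s.2.2 := fun u => (hzu u _ hne).symm.trans eq_comm
        simp only [this]
        rw [Finset.sum_eq_single (dec s.2.2)]
        · simp
        · intro u _ hu
          simp [hu]
        · simp
    simp only [hterm]
    rw [Summable.tsum_finsetSum fun _ _ => ENNReal.summable]
    refine Finset.sum_congr rfl fun u _ => ?_
    rw [ENNReal.tsum_mul_left, tsum_sample h, hz]
  rw [key]
  have hone : ∑' w, walkTerm sampleStep SampleDone (fun _ => 1) (fun _ => 1)
      (sampleStart todo) w = 1 := by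
    have hstep := fun (s : SampleState β) (b : Bool) (hs : SampleInv W todo.length s)
      (hd : ¬ SampleDone s) => hs.step hd b
    refine tsum_walkTerm_eq (I := SampleInv W todo.length) hstep
      (fun s => samplePotential W s) (fun _ => 1) (fun s => ENNReal.coe_ne_top) ?_ (by simp) ?_
      (by simp) (sampleInv_start h)
    · exact fun s hs hd => one_add_half_potential_le hs hd
    · intro s _ _
      rw [one_add_one_eq_two, ENNReal.inv_mul_cancel (by simp) (by simp)]
  have := key fun _ => 1
  rw [hone] at this
  simp only [one_mul, Finset.sum_const, Finset.card_univ, nsmul_eq_mul] at this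
  have hc : (c : ℝ≥0∞) = (Fintype.card U : ℝ≥0∞)⁻¹ :=
    ENNReal.eq_inv_of_mul_eq_one_left (by rw [mul_comm]; exact this.symm)
  rw [hc]

/-! ## The sampler as a program -/

theorem exists_run_walk {σ : Type} {step : σ → Bool → σ} {done : σ → Prop} [DecidablePred done]
    {I : σ → Prop} (hI : ∀ s b, I s → ¬ done s → I (step s b)) {O : Data → Data} {q : Prog}
    {enc : σ → Data} {B : ℕ} (hB : ∀ s, I s → (enc s).size ≤ B)
    (hdone : ∀ s, done s ↔ (enc s).head = .nil)
    (hq : ∀ s b, I s → ¬ done s → ∃ t ≤ B, Run O q (enc s) [b] t (enc (step s b)))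
    {s a : σ} {w : List Bool} (hs : I s) (h : haltsAt step done s w = some a) :
    I a ∧ ∃ t ≤ (1 + B + B) * (w.length + 1), Run O (.loop q) (enc s) w t (enc a) := by
  induction w generalizing s with
  | nil =>
    simp only [haltsAt, Option.ite_none_right_eq_some, Option.some.injEq] at h
    obtain ⟨hd, rfl⟩ := h
    have := hB s hs
    refine ⟨hs, _, ?_, .loop_done ((hdone s).1 hd)⟩
    simp only [List.length_nil]
    omega
  | cons b w ih =>
    by_cases hd : done s
    · simp [haltsAt, hd] at h
    · simp only [haltsAt, hd, if_false] at h
      obtain ⟨ha, t, ht, hr⟩ := ih (hI s b hs hd) h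
      obtain ⟨t', ht', hr'⟩ := hq s b hs hd
      refine ⟨ha, _, ?_, .loop_step (fun hn => hd ((hdone s).2 hn)) hr' hr⟩
      have := hB s hs
      simp only [List.length_cons]
      have e : (1 + B + B) * (w.length + 1 + 1) = (1 + B + B) * (w.length + 1) + (1 + B + B) := by
        ring
      omega

/-- Converse of `exists_run_walk`: for every coin there is a run of the body that follows the walk,
and runs are determined by their coins, so the loop has no other way to halt. -/
theorem exists_haltsAt_of_run {σ : Type} {step : σ → Bool → σ} {done : σ → Prop}
    [DecidablePred done] {I : σ → Prop} (hI : ∀ s b, I s → ¬ done s → I (step s b))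
    {O : Data → Data} {q : Prog} {enc : σ → Data} (hdone : ∀ s, done s ↔ (enc s).head = .nil)
    (hq : ∀ s b, I s → ¬ done s → ∃ t, Run O q (enc s) [b] t (enc (step s b)))
    {s : σ} {w : List Bool} {t : ℕ} {d : Data} (hs : I s) (h : Run O (.loop q) (enc s) w t d) :
    ∃ a, haltsAt step done s w = some a := by
  generalize hp : Prog.loop q = p at h
  generalize hc : enc s = c at h
  induction h generalizing s with
  | loop_done h => 
    subst hc
    exact ⟨s, by simp [haltsAt, (hdone s).2 h]⟩
  | @loop_step _ _ _ _ w w' _ _ h h₁ _ _ ih =>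
    subst hc
    obtain rfl := Prog.loop.inj hp
    have hd : ¬ done s := fun hd => h ((hdone s).1 hd)
    -- The given run of the body is compared, up to continuation of the coins, with the known run on
    -- one coin; so it uses exactly one coin.
    obtain ⟨b, rfl⟩ : ∃ b, w = [b] := by
      cases w with
      | nil =>
        obtain ⟨t, ht⟩ := hq s true hs hd
        have := (h₁.unique ht (r := [true]) (r' := []) rfl).1
        simp at this
      | cons b w =>
        obtain ⟨t, ht⟩ := hq s b hs hd
        exact ⟨b, (h₁.unique ht (r := []) (r' := w) (by simp)).1⟩
    obtain ⟨t, ht⟩ := hq s b hs hd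
    obtain ⟨-, rfl⟩ := h₁.unique' ht
    obtain ⟨a, ha⟩ := ih (hI s b hs hd) hp rfl
    exact ⟨a, by simpa [haltsAt, hd] using ha⟩
  | _ => simp at hp

def encState {β : Type} (e : β → Data) (s : SampleState β) : Data :=
  .cons (encL (encL (encO e)) s.1) (.cons (encL (encO e) s.2.1) (encL e s.2.2))

theorem halves_sublist {γ : Type} (l : List γ) :
    (halves l).1.Sublist l ∧ (halves l).2.Sublist l := by
  induction l with
  | nil => simp [halves]
  | cons x l ih => exact ⟨ih.2.cons_cons x, ih.1.cons x⟩

namespace FP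

variable {ι : Type} {Γ : Ctx ι} {β : ι → Type} {e : ∀ i, β i → Data} {n : ι → ℕ}

theorem halves {l : ∀ i, List (β i)} (hl : FP Γ fun i => encL (e i) (l i)) :
    FP Γ fun i => .cons (encL (e i) (halves (l i)).1) (encL (e i) (halves (l i)).2) := by
  refine hl.foldr (σ := fun i => List (β i) × List (β i))
    (es := fun i p => .cons (encL (e i) p.1) (encL (e i) p.2)) (s₀ := fun _ => ([], []))
    (f := fun i x p => (x :: p.2, p.1)) (const Γ (.cons .nil .nil))
    (((PBd.const _ 1).add hl.size_pBd).add hl.size_pBd) (fun i l' h => ?_) ?_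
  · have h₁ := halves_sublist l'
    have h₂ := size_encL_sublist (e i) (h₁.1.trans h.sublist)
    have h₃ := size_encL_sublist (e i) (h₁.2.trans h.sublist)
    simp only [Data.size]
    exact add_le_add (add_le_add le_rfl h₂) h₃
  · have h := (var Γ (fun p : FoldIx (fun i => (l i).reverse) (fun i s b => (b :: s.2, s.1))
      (fun i => (([], []) : List (β i) × List (β i))) => p.i)
      fun p => .cons (encL (e p.i) p.s.1) (encL (e p.i) p.s.2)).weaken id fun p => e p.i p.b
    refine cons (cons ?_ h.snd) h.fst
    exact var _ _ _

theorem sampleStep {s : ∀ i, SampleState (β i)} {b : ι → Bool}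
    (hs : FP Γ fun i => encState (e i) (s i)) (hb : FP Γ fun i => .ofBool (b i)) :
    FP Γ fun i => encState (e i) (sampleStep (s i) (b i)) := by
  classical
  have h₁ : FP Γ fun i => encL (encL (encO (e i))) (s i).1 := hs.fst
  have h₂ : FP Γ fun i => encL (encO (e i)) (s i).2.1 := hs.snd.fst
  have h₃ : FP Γ fun i => encL (e i) (s i).2.2 := hs.snd.snd
  have hh := h₂.halves
  have hcur := hb.cond hh.snd hh.fst
  have ht := h₁.encL_tail
  have happ := h₃.encL_append (l' := fun i => ((s i).2.1.head?.join).toList)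
    ((h₂.cond (.nil Γ) h₂.head).congr fun i => by
      rcases (s i).2.1 with _ | ⟨_ | _, _⟩ <;> simp [encO, Data.head])
  have hhead : FP Γ fun i => (encO (e i) ((s i).2.1.head?.join)) :=
    (h₂.cond (.nil Γ) h₂.head).congr fun i => by
      rcases (s i).2.1 with _ | ⟨_ | _, _⟩ <;> simp [encO, Data.head]
  have hlen : ∀ i, (s i).2.1.tail = [] ↔ ¬ 1 < (s i).2.1.length := fun i => by
    rw [← List.length_eq_zero_iff, List.length_tail]; omega
  have hd : ∀ i (l : List (List (Option (β i)))), (encL (encL (encO (e i))) l).head =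
      encL (encO (e i)) (l.head?.getD []) := fun i l => by cases l <;> rfl
  refine (FPd.eq_nil_list h₂.encL_tail).by_cases ?_ ?_
  · refine FP.congr ((hhead.cond (h₁.cons (h₁.head.cons h₃)) (ht.cons (ht.head.cons happ))).reindex Subtype.val) fun j => ?_
    obtain ⟨i, hi⟩ := j
    rw [hlen] at hi
    simp only [HSP.sampleStep, if_neg hi, hd]
    rcases (s i).2.1.head?.join with _ | g <;> simp [encO, encState]
  · refine FP.congr ((h₁.cons (hcur.cons h₃)).reindex Subtype.val) fun j => ?_
    obtain ⟨i, hi⟩ := j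
    rw [hlen, not_not] at hi
    simp only [HSP.sampleStep, if_pos hi, encState]
    rcases b i <;> simp [Data.ofBool]

theorem replicate {b : ∀ i, β i} (hn : FP Γ fun i => .ofNat (n i)) (hb : FP Γ fun i => e i (b i)) :
    FP Γ fun i => encL (e i) (List.replicate (n i) (b i)) := by
  rw [funext fun i => ofNat_eq_encL (n i)] at hn
  exact (hn.map (e' := e) (y := fun i _ => b i) (hb.weaken _ _)).congr fun i => by simp

theorem length {l : ∀ i, List (β i)} (hl : FP Γ fun i => encL (e i) (l i)) :
    FP Γ fun i => .ofNat (l i).length := by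
  refine (hl.map (e' := fun _ (_ : Unit) => Data.nil) (y := fun _ _ => ()) (nil _)).congr
    fun i => ?_
  rw [ofNat_eq_encL, List.map_const']

theorem powAbove (hn : FP Γ fun i => .ofNat (n i)) : FP Γ fun i => .ofNat (powAbove (n i)) := by
  refine hn.range.foldl (es := fun _ => Data.ofNat) (nat Γ 1)
    (B := fun i => 2 * (2 * n i + 1) + 1)
    (((PBd.const _ 2).mul (((PBd.const _ 2).mul hn.pBd_ofNat).add (.const _ 1))).add (.const _ 1))
    (fun i l' _ => ?_) ?_
  · rw [Data.size_ofNat]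
    have := (powAbove_foldl (n i) l').2.1
    omega
  · refine FPd.ite (β := fun _ => ℕ) (e := fun _ => Data.ofNat) ?_ ?_ ?_
    · refine FPd.nat_lt ?_ ((hn.weaken _ _).weaken _ _)
      exact (var _ _ _).weaken _ _
    · refine FP.add ?_ ?_ <;> exact (var _ _ _).weaken _ _
    · exact (var _ _ _).weaken _ _

theorem pad {l : ∀ i, List (β i)} {W : ι → ℕ} (hW : FP Γ fun i => .ofNat (W i))
    (hl : FP Γ fun i => encL (e i) (l i)) : FP Γ fun i => encL (encO (e i)) (pad (W i) (l i)) := by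
  refine encL_append (e := fun i => encO (e i)) (hl.map (e' := fun i => encO (e i)) ?_)
    (replicate (e := fun i => encO (e i)) (hW.sub hl.length) (nil Γ))
  exact (var _ _ _).cons (nil _)

end FP

end HSP

end

noncomputable section

namespace HSP

open Equiv
open scoped ENNReal NNReal

/-! ## Sampling as part of a longer computation -/

theorem size_encO_le {β : Type} {e : β → Data} {S : ℕ} (he : ∀ b, (e b).size ≤ S) (o : Option β) :
    (encO e o).size ≤ S + 2 := by
  cases o with
  | none => simp [encO, Data.size]
  | some b => have := he b; simp only [encO_some, Data.size]; omega

theorem SampleInv.size_le {β : Type} {e : β → Data} {S : ℕ} (he : ∀ b, (e b).size ≤ S) {W m : ℕ}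
    {s : SampleState β} (h : SampleInv W m s) : (encState e s).size ≤
      1 + (m * (W * (S + 2 + 1) + 1 + 1) + 1) +
        (1 + (W * (S + 2 + 1) + 1) + (m * (S + 1) + 1)) := by
  have hl := h.length
  have h₀ : ∀ L : List (Option β), L.length ≤ W →
      (encL (encO e) L).size ≤ W * (S + 2 + 1) + 1 := fun L hL =>
    (size_encL_le fun o _ => size_encO_le he o).trans (by gcongr)
  have h₁ : (encL (encL (encO e)) s.1).size ≤ m * (W * (S + 2 + 1) + 1 + 1) + 1 :=
    (size_encL_le fun L hL => h₀ L (h.padded L hL).length.le).trans (by gcongr; omega)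
  have h₂ := h₀ s.2.1 h.le
  have h₃ : (encL e s.2.2).size ≤ m * (S + 1) + 1 :=
    (size_encL_le fun b _ => he b).trans (by gcongr; omega)
  simp only [encState, Data.size]
  omega

/-- Draw a sample, and continue with a deterministic computation in polynomial time. -/
theorem exists_sampler {ι : Type} {Γ : Ctx ι} {β : ι → Type} {e : ∀ i, β i → Data}
    [∀ i, DecidablePred (SampleDone (β := β i))]
    {todo : ∀ i, List (List (Option (β i)))} {W S : ι → ℕ}
    (htodo : FP Γ fun i => encL (encL (encO (e i))) (todo i))
    (hpad : ∀ i, ∀ L ∈ todo i, IsPadded (W i) L) (hW : PBd Γ.N W) (hS : PBd Γ.N S)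
    (he : ∀ i b, (e i b).size ≤ S i) {y : (Σ i, List (β i)) → Data}
    (hy : FP (Γ.ext Sigma.fst fun p => encL (e p.1) p.2) y) :
    ∃ (p : Prog) (T : ι → ℕ), PBd Γ.N T ∧ ∀ i w,
      (∀ a, haltsAt sampleStep SampleDone (sampleStart (todo i)) w = some a →
        ∃ t ≤ T i * (w.length + 1), Run (Γ.O i) p (Γ.c i) w t (y ⟨i, a.2.2⟩)) ∧
      ∀ t d, Run (Γ.O i) p (Γ.c i) w t d →
        ∃ a, haltsAt sampleStep SampleDone (sampleStart (todo i)) w = some a := by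
  have hstart : FP Γ fun i => encState (e i) (sampleStart (todo i)) :=
    htodo.cons ((htodo.head.congr fun i => by cases todo i <;> rfl).cons (.nil Γ))
  obtain ⟨pre, t₀, ht₀, hpre⟩ := hstart
  let Δ : Ctx ((Σ i, SampleState (β i)) × Bool) :=
    { O := fun p => Γ.O p.1.1
      N := fun p => (encState (e p.1.1) p.1.2).size + 4
      c := fun p => .cons (encState (e p.1.1) p.1.2) (.ofBool p.2)
      size_le := fun p => by
        cases p.2 <;> simp [Data.size, Data.ofBool] <;> omega }
  have hΔ : FP Δ fun p => encState (e p.1.1) (sampleStep p.1.2 p.2) :=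
    FP.sampleStep (FP.self Δ).fst (FP.self Δ).snd
  obtain ⟨q, t₁, ⟨P, ht₁⟩, hq⟩ := hΔ
  obtain ⟨post, t₂, ⟨Q, ht₂⟩, hpost⟩ := hy
  let m : ι → ℕ := fun i => (todo i).length
  have hm : PBd Γ.N m := htodo.size_pBd.mono fun i => (length_lt_size_encL _ _).le
  let Z : ι → ℕ := fun i => 1 + (m i * (W i * (S i + 2 + 1) + 1 + 1) + 1) +
        (1 + (W i * (S i + 2 + 1) + 1) + (m i * (S i + 1) + 1))
  have hZ : PBd Γ.N Z := by
    have h1 : ∀ n, PBd Γ.N fun _ => n := .const _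
    have h2 := (hW.mul ((hS.add (h1 2)).add (h1 1))).add (h1 1)
    exact (((h1 1).add ((hm.mul (h2.add (h1 1))).add (h1 1))).add (((h1 1).add h2).add
      ((hm.mul (hS.add (h1 1))).add (h1 1))))
  have hP : ∀ {b : ι → ℕ} (R : Polynomial ℕ), PBd Γ.N b → PBd Γ.N fun i => R.eval (b i) :=
    fun R h => PBd.subst (N' := fun n => n) (c := fun n => R.eval n) ⟨R, fun _ => le_rfl⟩ _ h
  -- Time of one round: pairing the state with a coin, then `q`, whose polynomial is evaluated at
  -- the weight `Z i + 4`. The leading `Z i` makes `B` a bound for the states too.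
  let B : ι → ℕ := fun i => Z i + (1 + Z i + (1 + Z i + (1 + Z i) + (1 + Z i)) + P.eval (Z i + 4))
  have hB : PBd Γ.N B := by
    have h1 : ∀ n, PBd Γ.N fun _ => n := .const _
    have h2 := (h1 1).add hZ
    exact hZ.add ((h2.add ((h2.add h2).add h2)).add (hP P (hZ.add (h1 4))))
  let T : ι → ℕ := fun i => (1 + Γ.N i + (1 + Γ.N i + (1 + Γ.N i) + (1 + Γ.N i + (1 + Γ.N i +
    t₀ i + (1 + B i + B i)) + (1 + Z i + (1 + Z i) + (1 + Z i)))) + Q.eval (Γ.N i + Z i + 1))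
  have hT : PBd Γ.N T := by
    have h1 : ∀ n, PBd Γ.N fun _ => n := .const _
    have hN := (h1 1).add (.self Γ.N)
    have h2 := (h1 1).add hZ
    exact (hN.add ((hN.add hN).add ((hN.add ((hN.add ht₀).add (((h1 1).add hB).add hB))).add
      ((h2.add h2).add h2)))).add (hP Q (((PBd.self Γ.N).add hZ).add (h1 1)))
  have hinv : ∀ i (s : SampleState (β i)) b, SampleInv (W i) (m i) s → ¬ SampleDone s →
      SampleInv (W i) (m i) (sampleStep s b) := fun i s b hs hd => hs.step hd b
  have hsize : ∀ i (s : SampleState (β i)), SampleInv (W i) (m i) s → (encState (e i) s).size ≤ Z i :=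
    fun i s hs => hs.size_le (he i)
  have hdone : ∀ i (s : SampleState (β i)), SampleDone s ↔ (encState (e i) s).head = .nil :=
    fun i s => (encL_eq_nil _).symm
  have hbody : ∀ i (s : SampleState (β i)) b, SampleInv (W i) (m i) s → ¬ SampleDone s →
      ∃ t ≤ B i, Run (Γ.O i) (.comp q (.pair .copy .coin)) (encState (e i) s) [b] t
        (encState (e i) (sampleStep s b)) := by
    intro i s b hs _
    refine ⟨_, ?_, .comp (w := [b]) (w' := []) (.pair (w := []) (w' := [b]) (.copy _) (.coin _ b))
      (hq (⟨i, s⟩, b))⟩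
    have h₁ := hsize i s hs
    have h₂ := (ht₁ (⟨i, s⟩, b)).trans (eval_le_eval_of_le P (Nat.add_le_add_right h₁ 4))
    simp only [B]
    omega
  have hstartInv : ∀ i, SampleInv (W i) (m i) (sampleStart (todo i)) :=
    fun i => sampleInv_start (hpad i)
  -- The input is kept beside the sample: `pre` writes the start state, the loop tosses the coins,
  -- two tails extract the sample from the final state, and `post` works on input and sample.
  refine ⟨.comp post (.pair .copy (.comp (.comp .tail .tail)
    (.comp (.loop (.comp q (.pair .copy .coin))) pre))), T, hT, fun i w => ⟨fun a ha => ?_,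
      fun t d hr => ?_⟩⟩
  · obtain ⟨haI, t, ht, hr⟩ := exists_run_walk (hinv i) (fun s hs => (hsize i s hs).trans
      (Nat.le_add_right _ _ : Z i ≤ B i)) (hdone i) (hbody i) (hstartInv i) ha
    have hrun := Run.comp (.pair (.copy (Γ.c i)) (.comp (.comp (hpre i) hr)
      (.comp (.tail _) (.tail _)))) (hpost ⟨i, a.2.2⟩)
    simp only [List.nil_append, List.append_nil] at hrun
    refine ⟨_, ?_, hrun⟩
    replace ht : t ≤ (1 + B i + B i) * (w.length + 1) := ht
    have h₁ := hsize i a haI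
    have h₂ : (encState (e i) a).tail.size ≤ Z i := by
      refine le_trans ?_ h₁
      simp [encState, Data.tail, Data.size]
    have h₃ : t₂ ⟨i, a.2.2⟩ ≤ Q.eval (Γ.N i + Z i + 1) := by
      refine (ht₂ _).trans (eval_le_eval_of_le Q ?_)
      simp only [Ctx.ext_N]
      have : (encL (e i) a.2.2).size ≤ Z i := by
        refine le_trans ?_ h₁
        simp only [encState, Data.size]
        omega
      omega
    have h₄ := Γ.size_le i
    have h₅ : T i * (w.length + 1) ≥ T i - (1 + B i + B i) + (1 + B i + B i) * (w.length + 1) := by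
      have : T i = (T i - (1 + B i + B i)) + (1 + B i + B i) := by simp only [T]; omega
      conv_lhs => rw [this, add_mul]
      gcongr
      exact Nat.le_mul_of_pos_right _ (by omega)
    refine le_trans ?_ h₅
    simp only [T]
    omega
  · cases hr with
    | comp h₁ h₂ =>
    cases h₁ with
    | pair h₃ h₄ =>
    cases h₃
    cases h₄ with
    | comp h₅ h₆ =>
    cases h₆ with
    | comp h₇ h₈ =>
    cases h₇
    cases h₈
    cases h₅ with
    | comp h₉ h₁₀ =>
    obtain ⟨rfl, -, rfl⟩ := h₉.unique (hpre i) (r := []) (by simp; rfl)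
    obtain ⟨a, ha⟩ := exists_haltsAt_of_run (hinv i) (hdone i)
      (fun s b hs hd => (hbody i s b hs hd).imp fun _ h => h.2) (hstartInv i) h₁₀
    obtain ⟨-, t, -, hr⟩ := exists_run_walk (hinv i) (fun s hs => (hsize i s hs).trans
      (Nat.le_add_right _ _ : Z i ≤ B i)) (hdone i) (hbody i) (hstartInv i) ha
    obtain ⟨-, rfl⟩ := h₁₀.unique' hr
    obtain ⟨rfl, -⟩ := h₂.unique (hpost ⟨i, a.2.2⟩) (r := []) (by simp; rfl)
    exact ⟨a, by simpa using ha⟩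

/-! ## Uniform tuples of group elements -/

/-- The `r`-th block of `n` members. -/
def chunk {β : Type} (n : ℕ) (z : List β) (r : ℕ) : List β := (z.drop (r * n)).take n

/-- A sample for `k` independent elements is the concatenation of `k` samples, and the block lengths
are fixed; so unique decoding of one block gives unique decoding of the whole. -/
theorem existsUnique_chunks {β U : Type} {F : List (List β)} {val : List β → U} {k : ℕ}
    (u : Fin k → U) (h : ∀ r, ∃! c, List.Forall₂ (· ∈ ·) c F ∧ val c = u r) :
    ∃! z, List.Forall₂ (· ∈ ·) z (List.replicate k F).flatten ∧
      ∀ r : Fin k, val (chunk F.length z r) = u r := by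
  induction k with
  | zero => exact ⟨[], by simp, fun z hz => by simpa using hz.1⟩
  | succ k ih =>
    obtain ⟨z, ⟨hz, hzu⟩, huz⟩ := ih (fun r => u r.succ) fun r => h r.succ
    obtain ⟨c, ⟨hc, hcu⟩, huc⟩ := h 0
    have h₀ : ∀ (c z : List β), c.length = F.length → chunk F.length (c ++ z) 0 = c := by
      intro c z hc
      simp [chunk, ← hc]
    have h₁ : ∀ (c z : List β) (r : ℕ), c.length = F.length →
        chunk F.length (c ++ z) (r + 1) = chunk F.length z r := by
      intro c z r hc
      rw [chunk, chunk, List.drop_append, List.drop_eq_nil_of_le (by rw [hc, add_mul]; omega)]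
      simp only [hc, List.nil_append]
      congr 2
      rw [add_mul]
      omega
    simp only [List.replicate_succ, List.flatten_cons]
    refine ⟨c ++ z, ⟨List.rel_append hc hz, fun r => ?_⟩, ?_⟩
    · cases r using Fin.cases with
      | zero => rw [Fin.val_zero, h₀ c z hc.length_eq, hcu]
      | succ r => rw [Fin.val_succ, h₁ c z r hc.length_eq, hzu]
    · rintro z' ⟨hz', hzu'⟩
      have hc' := List.forall₂_take_append z' F _ hz'
      have hd' := List.forall₂_drop_append z' F _ hz'
      have e := List.take_append_drop F.length z'
      have hl : (z'.take F.length).length = F.length := hc'.length_eq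
      rw [← e] at hzu' ⊢
      congr 1
      · refine huc _ ⟨hc', ?_⟩
        have := hzu' 0
        rwa [Fin.val_zero, h₀ _ _ hl] at this
      · refine huz _ ⟨hd', fun r => ?_⟩
        have := hzu' r.succ
        rwa [Fin.val_succ, h₁ _ _ r hl] at this

end HSP

end

noncomputable section

namespace HSP

open Equiv
open scoped ENNReal NNReal

/-! ## Random group elements -/

theorem Input.ev_of_notMem (x : Input) {g : Perm (Fin x.n)} (h : g ∉ x.G) : x.ev g = .nil := by
  refine Function.extend_apply' _ _ _ ?_
  rintro ⟨a, rfl⟩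
  exact h a.2

theorem Input.oracle_ofPerm (x : Input) (g : Perm (Fin x.n)) :
    x.oracle (.ofPerm g) = x.ev g := by
  have hG : Function.Injective fun g : x.G => Data.ofPerm (g : Perm (Fin x.n)) :=
    ofPerm_injective.comp Subtype.val_injective
  by_cases h : g ∈ x.G
  · exact (hG.extend_apply _ _ (⟨g, h⟩ : x.G)).trans
      (Subtype.val_injective.extend_apply _ _ (⟨g, h⟩ : x.G)).symm
  · refine (Function.extend_apply' _ _ _ ?_).trans (x.ev_of_notMem h).symm
    rintro ⟨a, ha⟩
    exact h (ofPerm_injective ha ▸ a.2)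

theorem Input.size_f_le (x : Input) (k : ℕ) (g : x.G) : (x.f g).size ≤ x.size k :=
  (le_ciSup (f := fun g : x.G => (x.f g).size) (Set.finite_range _).bddAbove g).trans
    (Nat.le_add_left _ _)

theorem Input.ev_of_mem (x : Input) {g : Perm (Fin x.n)} (h : g ∈ x.G) : x.ev g = x.f ⟨g, h⟩ :=
  Subtype.val_injective.extend_apply _ _ (⟨g, h⟩ : x.G)

theorem Input.size_ev_le (x : Input) (k : ℕ) (g : Perm (Fin x.n)) :
    (x.ev g).size ≤ x.size k + 1 := by
  by_cases h : g ∈ x.G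
  · rw [x.ev_of_mem h]
    exact (x.size_f_le k _).trans (Nat.le_succ _)
  · simp [x.ev_of_notMem h, Data.size]

/-- The inputs on the tape. -/
@[simps] def tapeCtx : Ctx (Input × ℕ) where
  O p := p.1.oracle
  N p := p.1.size p.2
  c p := p.1.tape p.2
  size_le _ := Nat.le_add_right _ _

namespace FP

variable {ι : Type} {Γ : Ctx ι} {β : ι → Type} {e : ∀ i, β i → Data} {n a : ι → ℕ}

theorem take {l : ∀ i, List (β i)} (hl : FP Γ fun i => encL (e i) (l i))
    (h : FP Γ fun i => .ofNat (a i)) : FP Γ fun i => encL (e i) ((l i).take (a i)) :=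
  (hl.encL_reverse.drop (hl.length.sub h)).encL_reverse.congr fun i => by
    rw [List.reverse_drop, List.reverse_reverse, List.length_reverse]
    congr 1
    rcases le_total (a i) (l i).length with h | h
    · rw [Nat.sub_sub_self h]
    · rw [Nat.sub_eq_zero_of_le h, Nat.sub_zero, List.take_length, List.take_of_length_le h]

theorem perm_prod {l : ∀ i, List (Perm (Fin (n i)))} (hn : FP Γ fun i => .ofNat (n i))
    (hl : FP Γ fun i => encL .ofPerm (l i)) : FP Γ fun i => .ofPerm (l i).prod := by
  simp only [List.prod_eq_foldr]
  refine hl.foldr (es := fun _ => Data.ofPerm) hn.perm_one hn.pBd_perm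
    (fun i l' _ => size_ofPerm_le _) ?_
  refine perm_mul ((hn.weaken _ _).weaken _ _) ?_ ?_
  · exact var _ _ _
  · exact (var _ _ _).weaken _ _

end FP

/-- Membership is tested by sifting through a strong generating set. -/
theorem FPd.mem_span {ι : Type} {Γ : Ctx ι} {n : ι → ℕ} {g : ∀ i, Perm (Fin (n i))}
    {gens : ∀ i, List (Perm (Fin (n i)))} (hn : FP Γ fun i => .ofNat (n i))
    (hG : FP Γ fun i => encL .ofPerm (gens i)) (hg : FP Γ fun i => .ofPerm (g i)) :
    FPd Γ fun i => g i ∈ span (gens i) :=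
  (FPd.perm_eq (FP.sift hn (FP.chain hn hG) hg) hn.perm_one).congr fun _ => sift_chain_eq_one_iff

namespace Input

theorem fp_n : FP tapeCtx fun p => .ofNat p.1.n := (FP.self tapeCtx).fst.fst

theorem fp_gens : FP tapeCtx fun p => encL .ofPerm p.1.gens := (FP.self tapeCtx).fst.snd

theorem fp_k : FP tapeCtx fun p => .ofNat p.2 := (FP.self tapeCtx).snd

variable (x : Input) (k : ℕ)

/-- Lists of coset representatives; an element of the group is written uniquely as a product
of members of these lists. -/
def factors : List (List (Perm (Fin x.n))) :=
  (List.finRange x.n).map (transversal (chain x.gens))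

def sampleLists : List (List (Option (Perm (Fin x.n)))) :=
  (List.replicate k x.factors).flatten.map (pad (powAbove x.n))

open Classical in
/-- The group elements described by a sample from the lists of representatives. -/
def elements (z : List (Perm (Fin x.n))) (r : Fin k) : x.G :=
  if h : (chunk x.n z r).prod ∈ x.G then ⟨_, h⟩ else 1

theorem mem_factors_flatten {l : List (Perm (Fin x.n))}
    (h : l ∈ (List.replicate k x.factors).flatten) :
    ∃ i, transversal (chain x.gens) i = l := by
  obtain ⟨L, hL, hl⟩ := List.mem_flatten.1 h
  rw [List.eq_of_mem_replicate hL] at hl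
  obtain ⟨i, -, rfl⟩ := List.mem_map.1 hl
  exact ⟨i, rfl⟩

theorem isPadded_sampleLists : ∀ L ∈ x.sampleLists k, IsPadded (powAbove x.n) L := by
  intro L hL
  obtain ⟨l, hl, rfl⟩ := List.mem_map.1 hL
  obtain ⟨i, rfl⟩ := x.mem_factors_flatten k hl
  exact isPadded_pad (nodup_transversal i) (transversal_ne_nil (isComplete_chain _) i)
    ((length_transversal_le i).trans (le_powAbove _)) (powAbove_pow _)

theorem length_sampleLists : (x.sampleLists k).length = k * x.n := by
  simp [sampleLists, factors]

/-- Each tuple of group elements has exactly one factorization over the repeated transversals, and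
all factorizations carry the same weight, the product of the inverse list lengths. -/
theorem exists_elements (u : Fin k → x.G) : ∃ z, weights (x.sampleLists k) z =
    ((List.replicate k x.factors).flatten.map fun l => (l.length : ℝ≥0)⁻¹).prod ∧
    ∀ z', weights (x.sampleLists k) z' ≠ 0 → (x.elements k z' = u ↔ z' = z) := by
  have hw := weights_pad (powAbove x.n) (todo := (List.replicate k x.factors).flatten)
    (fun l hl => by
      obtain ⟨i, rfl⟩ := x.mem_factors_flatten k hl
      exact nodup_transversal i)
  obtain ⟨z, ⟨hz, hzu⟩, huniq⟩ := existsUnique_chunks (F := x.factors) (val := List.prod)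
    (fun r => (u r : Perm (Fin x.n))) fun r => by
      have := (isComplete_chain x.gens).existsUnique_factorization (m := 0) (k := x.n) (by omega)
        (g := (u r : Perm (Fin x.n))) (by
          rw [level_zero, span_chain]
          exact (u r).2)
      rwa [List.drop_zero] at this
  have hlen : x.factors.length = x.n := by simp [factors]
  rw [hlen] at hzu huniq
  refine ⟨z, by rw [sampleLists, hw, if_pos hz], fun z' hz' => ?_⟩
  rw [sampleLists, hw] at hz'
  have hz'' : List.Forall₂ (· ∈ ·) z' (List.replicate k x.factors).flatten := by
    by_contra h
    exact hz' (if_neg h)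
  -- Samples of positive weight consist of members of the transversals, so the default `1` in
  -- `elements` is never used for them.
  have hmem : ∀ r : Fin k, (chunk x.n z' r).prod ∈ x.G := by
    refine fun r => Subgroup.list_prod_mem _ fun g hg => ?_
    have hg' : g ∈ z' := List.mem_of_mem_drop (List.mem_of_mem_take hg)
    obtain ⟨j, hj, rfl⟩ := List.getElem_of_mem hg'
    have hj' := hz''.get hj (hz''.length_eq ▸ hj)
    obtain ⟨i, hi⟩ := x.mem_factors_flatten k (List.getElem_mem (hz''.length_eq ▸ hj))
    simp only [List.get_eq_getElem] at hj'
    rw [← hi] at hj'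
    exact mem_chain (mem_transversal hj').1
  have hel : ∀ r, (x.elements k z' r : Perm (Fin x.n)) = (chunk x.n z' r).prod := fun r => by
    rw [elements, dif_pos (hmem r)]
  constructor
  · rintro rfl
    exact huniq z' ⟨hz'', fun r => (hel r).symm⟩
  · rintro rfl
    funext r
    exact Subtype.ext ((hel r).trans (hzu r))

instance {β : Type} : DecidablePred (SampleDone (β := β)) := Classical.decPred _

/-- The tuple of group elements drawn with the coins `w`. -/
def draw (w : List Bool) : Option (Fin k → x.G) :=
  (haltsAt sampleStep SampleDone (sampleStart (x.sampleLists k)) w).map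
    fun s => x.elements k s.2.2

theorem tsum_draw [Fintype (Fin k → x.G)] (F : (Fin k → x.G) → ℝ≥0∞) :
    ∑' w, (x.draw k w).elim 0 F * 2⁻¹ ^ w.length =
      ∑ u, F u * (Fintype.card (Fin k → x.G) : ℝ≥0∞)⁻¹ := by
  rw [← tsum_walkTerm_sample (x.isPadded_sampleLists k) (x.elements k) _ (x.exists_elements k) F]
  refine tsum_congr fun w => ?_
  rw [walkTerm, draw, mul_one]
  cases haltsAt sampleStep SampleDone (sampleStart (x.sampleLists k)) w <;> rfl

theorem tsum_draw_length_le :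
    ∑' w, (x.draw k w).elim 0 (fun _ => 1) * ((w.length : ℝ≥0∞) + 1) * 2⁻¹ ^ w.length ≤
      ((k * x.n * powAbove x.n ^ 2 + 1 : ℕ) : ℝ≥0∞) := by
  rw [← x.length_sampleLists k]
  refine le_trans (le_of_eq (tsum_congr fun w => ?_))
    (tsum_sample_length_le (x.isPadded_sampleLists k))
  rw [walkTerm, draw]
  cases haltsAt sampleStep SampleDone (sampleStart (x.sampleLists k)) w <;> rfl

theorem fp_sampleLists :
    FP tapeCtx fun p => encL (encL (encO .ofPerm)) (p.1.sampleLists p.2) := by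
  have h : FP tapeCtx fun p => encL (encL .ofPerm) p.1.factors := by
    refine fp_n.finRange.map (e' := fun _ => encL Data.ofPerm) ?_
    refine FP.transversal (fp_n.weaken _ _) (FP.chain (fp_n.weaken _ _) (fp_gens.weaken _ _)) ?_
    exact FP.var _ _ _
  refine (FP.flatten (e := fun p : Input × ℕ => encL Data.ofPerm)
    (fp_k.replicate (e := fun p : Input × ℕ => encL (encL Data.ofPerm)) h)).map
    (e' := fun _ => encL (encO Data.ofPerm)) ?_
  refine FP.pad (e := fun _ => Data.ofPerm) (fp_n.powAbove.weaken _ _) ?_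
  exact FP.var _ _ _

end Input

/-- The inputs with a tuple of group elements. -/
def drawCtx : Ctx (Σ p : Input × ℕ, Fin p.2 → p.1.G) :=
  tapeCtx.ext Sigma.fst fun p => encL .ofPerm (List.ofFn fun r => (p.2 r : Perm (Fin p.1.1.n)))

theorem Input.fp_elements : FP (tapeCtx.ext (fun p : Σ p : Input × ℕ, List (Perm (Fin p.1.n)) => p.1)
    fun p => encL .ofPerm p.2) fun p => encL .ofPerm
      (List.ofFn fun r => (p.1.1.elements p.1.2 p.2 r : Perm (Fin p.1.1.n))) := by
  have hn := fp_n.weaken (fun p : Σ p : Input × ℕ, List (Perm (Fin p.1.n)) => p.1)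
    fun p => encL .ofPerm p.2
  have hg := fp_gens.weaken (fun p : Σ p : Input × ℕ, List (Perm (Fin p.1.n)) => p.1)
    fun p => encL .ofPerm p.2
  have hk := fp_k.weaken (fun p : Σ p : Input × ℕ, List (Perm (Fin p.1.n)) => p.1)
    fun p => encL .ofPerm p.2
  have hz := FP.var tapeCtx (fun p : Σ p : Input × ℕ, List (Perm (Fin p.1.n)) => p.1)
    fun p => encL .ofPerm p.2
  have key := hk.finRange.map (e' := fun _ => Data.ofPerm)
    (y := fun p r => (p.1.1.elements p.1.2 p.2 r : Perm (Fin p.1.1.n))) ?_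
  · exact key.congr fun p => by rw [List.ofFn_eq_map]
  · classical
    let κ := FinIx fun p : Σ p : Input × ℕ, List (Perm (Fin p.1.n)) => p.1.2
    have hc := FP.perm_prod (hn.weaken (fun p : κ => p.i) fun p => encF p.b)
      (((hz.weaken (fun p : κ => p.i) fun p => encF p.b).drop
        ((FP.var _ (fun p : κ => p.i) fun p => encF p.b).mul (hn.weaken _ _))).take
          (hn.weaken _ _))
    refine (((FPd.mem_span (hn.weaken _ _) (hg.weaken _ _) hc).ite (e := fun _ => Data.ofPerm)
      hc (hn.weaken _ _).perm_one)).congr fun p => ?_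
    rw [elements]
    congr 1
    by_cases h : (chunk p.i.1.1.n p.i.2 p.b).prod ∈ p.i.1.1.G
    · rw [dif_pos h]
      exact if_pos h
    · rw [dif_neg h]
      exact if_neg h

/-- Draw a tuple of group elements, and continue with a computation in polynomial time. -/
theorem exists_prog_draw {y : (Σ p : Input × ℕ, Fin p.2 → p.1.G) → Data} (hy : FP drawCtx y) :
    ∃ (p : Prog) (T : Input × ℕ → ℕ), PBd tapeCtx.N T ∧ ∀ x k w,
      (∀ u, x.draw k w = some u →
        ∃ t ≤ T (x, k) * (w.length + 1), Run x.oracle p (x.tape k) w t (y ⟨(x, k), u⟩)) ∧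
      ∀ t d, Run x.oracle p (x.tape k) w t d → ∃ u, x.draw k w = some u := by
  have hW : PBd tapeCtx.N fun p => powAbove p.1.n := Input.fp_n.powAbove.pBd_ofNat
  have hy' : FP (tapeCtx.ext (fun p : Σ p : Input × ℕ, List (Perm (Fin p.1.n)) => p.1)
      fun p => encL .ofPerm p.2) fun p => y ⟨p.1, p.1.1.elements p.1.2 p.2⟩ := by
    have hc := ((FP.self tapeCtx).weaken
      (fun p : Σ p : Input × ℕ, List (Perm (Fin p.1.n)) => p.1) fun p => encL .ofPerm p.2).cons
        Input.fp_elements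
    refine hy.call (fun p : Σ p : Input × ℕ, List (Perm (Fin p.1.n)) =>
      (⟨p.1, p.1.1.elements p.1.2 p.2⟩ : Σ p : Input × ℕ, Fin p.2 → p.1.G)) (fun _ => rfl) ?_ hc
    refine ((PBd.self _).add (Input.fp_elements.size_pBd)).mono fun p => ?_
    simp only [drawCtx, Ctx.ext_N]
    omega
  obtain ⟨p, T, hT, h⟩ := exists_sampler (Γ := tapeCtx) (β := fun p => Perm (Fin p.1.n))
    (e := fun _ => Data.ofPerm) (todo := fun p => p.1.sampleLists p.2)
    (W := fun p => powAbove p.1.n) (S := fun p => p.1.n * (2 * p.1.n + 1) + 1)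
    (y := fun p => y ⟨p.1, p.1.1.elements p.1.2 p.2⟩) Input.fp_sampleLists
    (fun p => p.1.isPadded_sampleLists p.2) hW Input.fp_n.pBd_perm
    (fun p g => size_ofPerm_le g) hy'
  refine ⟨p, T, hT, fun x k w => ⟨fun u hu => ?_, fun t d hr => ?_⟩⟩
  · obtain ⟨a, ha, rfl⟩ := Option.map_eq_some_iff.1 hu
    exact (h (x, k) w).1 a ha
  · obtain ⟨a, ha⟩ := (h (x, k) w).2 t d hr
    exact ⟨_, by rw [Input.draw, ha]; rfl⟩

end HSP

end

/-! ### Wreath products, hidden subgroups and the correctness of the search -/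

noncomputable section

namespace HSP

open Equiv

/-! ## Setwise stabilizers of pairs -/

/-- A group generated by transpositions contains every permutation that preserves its orbits
(`mem_closure_isSwap`); here a point and its image are always joined by one of the transpositions.
-/
theorem mem_span_setStabGens {N : ℕ} {a b : Fin N} {g : Perm (Fin N)} :
    g ∈ span (setStabGens a b) ↔ ∀ c, (g c = a ∨ g c = b) ↔ (c = a ∨ c = b) := by
  have hmem : ∀ s, s ∈ setStabGens a b ↔ ∃ c d, ((c = a ∨ c = b) ↔ (d = a ∨ d = b)) ∧
      swap c d = s := by
    intro s
    have hp : ∀ p : Fin N × Fin N, p ∈ List.finRange N ×ˢ List.finRange N := fun p =>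
      List.pair_mem_product.2 ⟨List.mem_finRange _, List.mem_finRange _⟩
    simp only [setStabGens, List.mem_map, List.mem_filter, Prod.exists, hp, true_and, beq_iff_eq,
      decide_eq_decide]
  constructor
  · intro h
    refine Subgroup.closure_induction (fun s hs c => ?_) (by simp) (fun s t _ _ hs ht c => ?_)
      (fun s _ hs c => ?_) h
    · obtain ⟨d, e, hde, rfl⟩ := (hmem s).1 hs
      rw [swap_apply_def]
      split
      · rename_i h; subst h; exact hde.symm
      · split
        · rename_i h; subst h; exact hde
        · rfl
    · rw [Perm.mul_apply, hs, ht]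
    · have := hs (s⁻¹ c)
      rw [show s (s⁻¹ c) = c from s.apply_symm_apply c] at this
      exact this.symm
  · intro h
    -- The list also contains the identity as `swap c c`; it is removed because the criterion speaks
    -- of genuine transpositions.
    let S : Set (Perm (Fin N)) := {s | ∃ c d, c ≠ d ∧
      ((c = a ∨ c = b) ↔ (d = a ∨ d = b)) ∧ swap c d = s}
    have hS : ∀ s ∈ S, s.IsSwap := by
      rintro s ⟨c, d, hcd, -, rfl⟩
      exact ⟨c, d, hcd, rfl⟩
    refine Subgroup.closure_mono (h := S) (fun s hs => ?_)
      ((mem_closure_isSwap hS).2 ⟨Set.toFinite _, fun c => ?_⟩)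
    · obtain ⟨c, d, -, hcd, hs⟩ := hs
      exact (hmem s).2 ⟨c, d, hcd, hs⟩
    · by_cases hc : g c = c
      · rw [hc]
        exact MulAction.mem_orbit_self c
      · exact ⟨⟨swap c (g c), Subgroup.subset_closure
          ⟨c, g c, Ne.symm hc, (h c).symm, rfl⟩⟩, swap_apply_left _ _⟩

/-! ## Wreath products -/

section wreath

variable {n : ℕ}

theorem wr_injective (hn : 0 < n) : Function.Injective (wr (n := n)) := by
  rintro ⟨a, b, τ⟩ ⟨c, d, σ⟩ h
  have h₀ : ∀ i j, _ := fun i j => congrArg (fun g => finProdFinEquiv.symm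
    (g (finProdFinEquiv (i, j)))) h
  simp only [FP.wr_apply, symm_apply_apply, Prod.mk.injEq] at h₀
  have hab : a = c := Equiv.ext fun i => by simpa using (h₀ i 0).1
  have hcd : b = d := Equiv.ext fun i => by simpa using (h₀ i 1).1
  have := (h₀ ⟨0, hn⟩ 0).2
  simp only [add_zero] at this
  rw [hab, hcd, this]

variable {a b c d : Perm (Fin n)} {τ : Fin 2}

theorem wr_mul_zero : wr (a, b, τ) * wr (c, d, 0) = wr (a * c, b * d, τ) := by
  ext x
  obtain ⟨⟨i, j⟩, rfl⟩ := finProdFinEquiv.surjective x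
  simp only [Perm.mul_apply, FP.wr_apply, zero_add]
  fin_cases j <;> rfl

theorem wr_mul_one : wr (a, b, τ) * wr (c, d, 1) = wr (b * c, a * d, τ + 1) := by
  ext x
  obtain ⟨⟨i, j⟩, rfl⟩ := finProdFinEquiv.surjective x
  simp only [Perm.mul_apply, FP.wr_apply]
  fin_cases j <;> simp [add_assoc, add_comm (1 : Fin 2)]

theorem wr_one : wr ((1, 1, 0) : Perm (Fin n) × Perm (Fin n) × Fin 2) = 1 := by
  ext x
  obtain ⟨⟨i, j⟩, rfl⟩ := finProdFinEquiv.surjective x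
  simp [FP.wr_apply]

theorem wr_inv_zero : (wr (a, b, 0))⁻¹ = wr (a⁻¹, b⁻¹, 0) :=
  inv_eq_of_mul_eq_one_right (by rw [wr_mul_zero, mul_inv_cancel, mul_inv_cancel, wr_one])

theorem wr_inv_one : (wr (a, b, 1))⁻¹ = wr (b⁻¹, a⁻¹, 1) :=
  inv_eq_of_mul_eq_one_right (by rw [wr_mul_one, mul_inv_cancel, mul_inv_cancel]; exact wr_one)

/-- Elements of `Fin 2` are `0` or `1`. -/
theorem eq_zero_or_one (τ : Fin 2) : τ = 0 ∨ τ = 1 := by omega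

/-- The wreath product of `K` with `ℤ/2`. -/
def wreath (K : Subgroup (Perm (Fin n))) : Subgroup (Perm (Fin (n * 2))) where
  carrier := {g | ∃ t, t.1 ∈ K ∧ t.2.1 ∈ K ∧ wr t = g}
  one_mem' := ⟨(1, 1, 0), K.one_mem, K.one_mem, wr_one⟩
  mul_mem' := by
    rintro _ _ ⟨⟨a, b, τ⟩, ha, hb, rfl⟩ ⟨⟨c, d, σ⟩, hc, hd, rfl⟩
    rcases eq_zero_or_one σ with rfl | rfl
    · exact ⟨_, K.mul_mem ha hc, K.mul_mem hb hd, wr_mul_zero.symm⟩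
    · exact ⟨_, K.mul_mem hb hc, K.mul_mem ha hd, wr_mul_one.symm⟩
  inv_mem' := by
    rintro _ ⟨⟨a, b, τ⟩, ha, hb, rfl⟩
    rcases eq_zero_or_one τ with rfl | rfl
    · exact ⟨_, K.inv_mem ha, K.inv_mem hb, wr_inv_zero.symm⟩
    · exact ⟨_, K.inv_mem hb, K.inv_mem ha, wr_inv_one.symm⟩

theorem wr_mem_wreath (hn : 0 < n) {K : Subgroup (Perm (Fin n))}
    {t : Perm (Fin n) × Perm (Fin n) × Fin 2} : wr t ∈ wreath K ↔ t.1 ∈ K ∧ t.2.1 ∈ K := by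
  refine ⟨?_, fun h => ⟨t, h.1, h.2, rfl⟩⟩
  rintro ⟨s, h₁, h₂, hs⟩
  obtain rfl := wr_injective hn hs
  exact ⟨h₁, h₂⟩

theorem wreath_mono {K L : Subgroup (Perm (Fin n))} (h : K ≤ L) : wreath K ≤ wreath L := by
  rintro _ ⟨t, h₁, h₂, rfl⟩
  exact ⟨t, h h₁, h h₂, rfl⟩

/-- Conjugation by the swap `(1, 1, 1)` carries the first factor `G × 1` to the second, so
generators of the first factor and the swap suffice. -/
theorem span_wrGens (gens : List (Perm (Fin n))) : span (wrGens gens) = wreath (span gens) := by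
  apply le_antisymm
  · refine span_le.2 fun g hg => ?_
    simp only [wrGens, List.mem_append, List.mem_map, List.mem_singleton] at hg
    rcases hg with ⟨s, hs, rfl⟩ | rfl
    · exact ⟨_, subset_span hs, one_mem _, rfl⟩
    · exact ⟨_, one_mem _, one_mem _, rfl⟩
  · have hs : wr (1, 1, 1) ∈ span (wrGens gens) := subset_span (by simp [wrGens])
    have h₁ : ∀ a ∈ span gens, wr (a, 1, 0) ∈ span (wrGens gens) := by
      intro a ha
      refine Subgroup.closure_induction (fun s hs => subset_span ?_) ?_ (fun a b _ _ ha hb => ?_)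
        (fun a _ ha => ?_) ha
      · simpa [wrGens] using Or.inl ⟨s, hs, rfl⟩
      · rw [wr_one]
        exact one_mem _
      · simpa [wr_mul_zero] using mul_mem ha hb
      · simpa [wr_inv_zero] using inv_mem ha
    have h₂ : ∀ a ∈ span gens, wr (1, a, 0) ∈ span (wrGens gens) := by
      intro a ha
      have := mul_mem (mul_mem hs (h₁ a ha)) hs
      rw [wr_mul_zero, wr_mul_one] at this
      simpa using this
    have h₃ : ∀ a b, a ∈ span gens → b ∈ span gens → wr (a, b, 0) ∈ span (wrGens gens) := by
      intro a b ha hb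
      have := mul_mem (h₁ a ha) (h₂ b hb)
      rw [wr_mul_zero] at this
      simpa using this
    rintro _ ⟨⟨a, b, τ⟩, ha, hb, rfl⟩
    rcases eq_zero_or_one τ with rfl | rfl
    · exact h₃ a b ha hb
    · have := mul_mem (h₃ b a hb ha) hs
      rw [wr_mul_one] at this
      simpa using this

/-! ## Direct products -/

theorem block_injective {N : ℕ} : Function.Injective (block (N := N)) := by
  intro v w h
  funext c
  ext a
  have := congrArg (fun g => finProdFinEquiv.symm (g (finProdFinEquiv (c, a)))) h
  simp only [FP.block_apply, symm_apply_apply, Prod.mk.injEq, true_and] at this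
  rw [this]

/-- The fourfold direct product of the symmetric group. -/
def blockHom (N : ℕ) : (Fin 4 → Perm (Fin N)) →* Perm (Fin (4 * N)) where
  toFun := block
  map_one' := by
    ext x
    obtain ⟨⟨c, a⟩, rfl⟩ := finProdFinEquiv.surjective x
    simp [FP.block_apply]
  map_mul' v w := by
    ext x
    obtain ⟨⟨c, a⟩, rfl⟩ := finProdFinEquiv.surjective x
    simp [FP.block_apply]

theorem blockHom_apply {N : ℕ} (v : Fin 4 → Perm (Fin N)) : blockHom N v = block v := rfl

theorem block_mem_span {N : ℕ} {L₀ L₁ L₂ L₃ : List (Perm (Fin N))} {g : Perm (Fin (4 * N))} :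
    g ∈ span (L₀.map (fun s => block (Pi.mulSingle 0 s)) ++
      L₁.map (fun s => block (Pi.mulSingle 1 s)) ++ L₂.map (fun s => block (Pi.mulSingle 2 s)) ++
      L₃.map (fun s => block (Pi.mulSingle 3 s))) ↔
    ∃ v : Fin 4 → Perm (Fin N), (∀ c, v c ∈ span (![L₀, L₁, L₂, L₃] c)) ∧ block v = g := by
  set L := ![L₀, L₁, L₂, L₃] with hL
  have hmem : ∀ g, g ∈ (L₀.map (fun s => block (Pi.mulSingle 0 s)) ++
      L₁.map (fun s => block (Pi.mulSingle 1 s)) ++ L₂.map (fun s => block (Pi.mulSingle 2 s)) ++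
      L₃.map (fun s => block (Pi.mulSingle 3 s))) ↔
      ∃ c, ∃ s ∈ L c, block (Pi.mulSingle c s) = g := by
    intro g
    simp only [List.mem_append, List.mem_map, Fin.exists_fin_succ, hL]
    simp [or_assoc]
  constructor
  · intro h
    have : span _ ≤ (Subgroup.pi Set.univ fun c => span (L c)).map (blockHom N) :=
      span_le.2 fun g hg => by
        obtain ⟨c, s, hs, rfl⟩ := (hmem g).1 hg
        refine ⟨_, fun d _ => ?_, rfl⟩
        by_cases hd : d = c
        · subst hd
          rw [Pi.mulSingle_eq_same]
          exact subset_span hs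
        · rw [Pi.mulSingle_eq_of_ne hd]
          exact (span (L d)).one_mem
    obtain ⟨v, hv, rfl⟩ := this h
    exact ⟨v, fun c => hv c trivial, rfl⟩
  · rintro ⟨v, hv, rfl⟩
    have h₁ : ∀ c, block (Pi.mulSingle c (v c)) ∈ span (L₀.map (fun s => block (Pi.mulSingle 0 s)) ++
        L₁.map (fun s => block (Pi.mulSingle 1 s)) ++ L₂.map (fun s => block (Pi.mulSingle 2 s)) ++
        L₃.map (fun s => block (Pi.mulSingle 3 s))) := by
      intro c
      have : span (L c) ≤ (span _).comap ((blockHom N).comp (MonoidHom.mulSingle _ c)) :=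
        span_le.2 fun s hs => subset_span ((hmem _).2 ⟨c, s, hs, rfl⟩)
      exact this (hv c)
    have h₂ : v = Pi.mulSingle 0 (v 0) * Pi.mulSingle 1 (v 1) * Pi.mulSingle 2 (v 2) *
        Pi.mulSingle 3 (v 3) := by
      funext c
      fin_cases c <;> simp
    rw [h₂, ← blockHom_apply, map_mul, map_mul, map_mul]
    exact mul_mem (mul_mem (mul_mem (h₁ 0) (h₁ 1)) (h₁ 2)) (h₁ 3)

end wreath

/-! ## Functions that hide subgroups -/

/-- On `G`, the function `F` hides `D`. -/
structure HidesOn {N : ℕ} (G : Subgroup (Perm (Fin N))) (F : Perm (Fin N) → Data)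
    (D : Subgroup (Perm (Fin N))) : Prop where
  le : D ≤ G
  iff : ∀ a ∈ G, ∀ b ∈ G, F a = F b ↔ a⁻¹ * b ∈ D

theorem Input.Hides.hidesOn {x : Input} {H : Subgroup x.G} (h : x.Hides H) :
    HidesOn x.G x.ev (H.map x.G.subtype) where
  le := by
    rintro _ ⟨g, -, rfl⟩
    exact g.2
  iff a ha b hb := by
    rw [x.ev_of_mem ha, x.ev_of_mem hb]
    refine (h ⟨a, ha⟩ ⟨b, hb⟩).trans ⟨fun h => ⟨_, h, rfl⟩, ?_⟩
    rintro ⟨g, hg, he⟩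
    rwa [← show g = ⟨a, ha⟩⁻¹ * ⟨b, hb⟩ from Subtype.ext he]

theorem HidesOn.build {N : ℕ} {hN : 0 < N} {gens : List (Perm (Fin N))} {F : Perm (Fin N) → Data}
    {D : Subgroup (Perm (Fin N))} (h : HidesOn (span gens) F D) :
    HidesOn (Input.build hN gens F).G (Input.build hN gens F).ev D :=
  ⟨h.le, fun a ha b hb => by
    rw [Input.ev_of_mem _ ha, Input.ev_of_mem _ hb]
    exact h.iff a ha b hb⟩

section

variable {n N : ℕ} {G D : Subgroup (Perm (Fin N))} {F : Perm (Fin N) → Data}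

theorem HidesOn.congr {F' : Perm (Fin N) → Data} (h : HidesOn G F D) (h' : ∀ g ∈ G, F' g = F g) :
    HidesOn G F' D :=
  ⟨h.le, fun a ha b hb => by rw [h' a ha, h' b hb, h.iff a ha b hb]⟩

theorem HidesOn.restrict {A : Subgroup (Perm (Fin N))} (h : HidesOn G F D) (hA : A ≤ G) :
    HidesOn A F (D ⊓ A) :=
  ⟨inf_le_right, fun a ha b hb => (h.iff a (hA ha) b (hA hb)).trans
    ⟨fun h => ⟨h, A.mul_mem (A.inv_mem ha) hb⟩, fun h => h.1⟩⟩

/-- `F (a * c⁻¹) = F (b * c⁻¹)` means `c * (a⁻¹ * b) * c⁻¹ ∈ D`: a right translate hides a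
conjugate. -/
theorem HidesOn.shift {c : Perm (Fin N)} (h : HidesOn G F D) (hc : c ∈ G) :
    HidesOn G (fun g => F (g * c⁻¹)) (D.comap (MulAut.conj c).toMonoidHom) where
  le g hg := by
    have hg' : c * g * c⁻¹ ∈ G := h.le hg
    have := G.mul_mem (G.mul_mem (G.inv_mem hc) hg') hc
    simpa [mul_assoc] using this
  iff a ha b hb := by
    refine (h.iff _ (G.mul_mem ha (G.inv_mem hc)) _ (G.mul_mem hb (G.inv_mem hc))).trans ?_
    simp [Subgroup.mem_comap, mul_assoc]

end

section

variable {n : ℕ} {G D : Subgroup (Perm (Fin n))} {F : Perm (Fin n) → Data}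

theorem wrFun_wr (hn : 0 < n) (F₁ F₂ : Perm (Fin n) → Data)
    (t : Perm (Fin n) × Perm (Fin n) × Fin 2) : wrFun F₁ F₂ (wr t) =
      if t.2.2 = 0 then .cons (F₁ t.1) (F₂ t.2.1) else .cons (F₂ t.2.1) (F₁ t.1) :=
  (wr_injective hn).extend_apply _ _ _

/-- The two values are interchanged when the swap is present, and so are the coordinates in the
product; thus in all four cases of swaps equal values compare exactly the coordinates that meet in
`a⁻¹ * b`. -/
theorem HidesOn.wreath (hn : 0 < n) (h : HidesOn G F D) :
    HidesOn (wreath G) (wrFun F F) (wreath D) where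
  le := wreath_mono h.le
  iff := by
    rintro _ ⟨⟨a, b, τ⟩, ha, hb, rfl⟩ _ ⟨⟨c, d, σ⟩, hc, hd, rfl⟩
    simp only [wrFun_wr hn]
    rcases eq_zero_or_one τ with rfl | rfl <;> rcases eq_zero_or_one σ with rfl | rfl <;>
      simp [wr_inv_zero, wr_inv_one, wr_mul_zero, wr_mul_one, wr_mem_wreath hn, h.iff _ ha _ hc,
        h.iff _ hb _ hd, h.iff _ ha _ hd, h.iff _ hb _ hc, and_comm]

/-- Shifting the second function by `u` is right translation of the whole function by `(1, u, 0)`;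
this reduces shifted inputs to `HidesOn.wreath` and `HidesOn.shift`. -/
theorem wrFun_shift (hn : 0 < n) (F : Perm (Fin n) → Data) (u : Perm (Fin n))
    (t : Perm (Fin n) × Perm (Fin n) × Fin 2) :
    wrFun F (fun g => F (g * u⁻¹)) (wr t) = wrFun F F (wr t * (wr (1, u, 0))⁻¹) := by
  obtain ⟨a, b, τ⟩ := t
  rw [wr_inv_zero, wr_mul_zero, wrFun_wr hn, wrFun_wr hn]
  simp

/-- The subgroup hidden by `f * f'`, with `f'` the shift of `f` by `u`, if `f` hides `D`. -/
def shiftSub (D : Subgroup (Perm (Fin n))) (u : Perm (Fin n)) : Subgroup (Perm (Fin (n * 2))) :=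
  (HSP.wreath D).comap (MulAut.conj (wr (1, u, 0))).toMonoidHom

theorem HidesOn.shiftSub (hn : 0 < n) (h : HidesOn G F D) {u : Perm (Fin n)} (hu : u ∈ G) :
    HidesOn (HSP.wreath G) (wrFun F fun g => F (g * u⁻¹)) (shiftSub D u) := by
  refine ((h.wreath hn).shift (c := wr (1, u, 0)) ⟨_, one_mem _, hu, rfl⟩).congr ?_
  rintro _ ⟨t, -, -, rfl⟩
  exact wrFun_shift hn F u t

theorem wr_mem_shiftSub (hn : 0 < n) {u a b : Perm (Fin n)} {τ : Fin 2} :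
    wr (a, b, τ) ∈ shiftSub D u ↔ if τ = 0 then a ∈ D ∧ u * b * u⁻¹ ∈ D else
      u * a ∈ D ∧ b * u⁻¹ ∈ D := by
  change wr (1, u, 0) * wr (a, b, τ) * (wr (1, u, 0))⁻¹ ∈ HSP.wreath D ↔ _
  rw [wr_inv_zero]
  rcases eq_zero_or_one τ with rfl | rfl
  · simp [wr_mul_zero, wr_mem_wreath hn]
  · simp [wr_mul_zero, wr_mul_one, wr_mem_wreath hn]

end

end HSP

end

noncomputable section

namespace HSP

open Equiv

/-! ## The queries of the search -/

theorem HidesOn.hides {x : Input} {D : Subgroup (Perm (Fin x.n))} (h : HidesOn x.G x.ev D) :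
    x.Hides (D.subgroupOf x.G) := fun a b => by
  have := h.iff _ a.2 _ b.2
  rw [x.ev_of_mem a.2, x.ev_of_mem b.2] at this
  exact this

theorem DecisionProgram.IsCorrect.eq_nontrivial_iff {P : DecisionProgram} (hP : P.IsCorrect)
    {x : Input} {D : Subgroup (Perm (Fin x.n))} (h : HidesOn x.G x.ev D) :
    P x = .nontrivial ↔ ∃ g ∈ D, g ≠ 1 := by
  have h₁ : P x = .trivial ↔ D = ⊥ := (hP x _ h.hides).trans (by
    rw [Subgroup.subgroupOf_eq_bot, disjoint_iff, inf_eq_left.2 h.le])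
  have h₂ : D ≠ ⊥ ↔ ∃ g ∈ D, g ≠ 1 := by
    rw [Ne, Subgroup.eq_bot_iff_forall]
    push Not
    rfl
  rw [← h₂, Ne, ← h₁]
  cases P x <;> simp

section query

variable {x : Input} {R : StabRoutine} {P : DecisionProgram} {D : Subgroup (Perm (Fin x.n))}

theorem mul_inv_eq_mul_inv_iff' {G : Type*} [Group G] {a b c d : G} :
    a * b⁻¹ = c * d⁻¹ ↔ a⁻¹ * c = b⁻¹ * d := by
  constructor <;> intro h
  · have : a⁻¹ * c = a⁻¹ * (c * d⁻¹) * d := by group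
    rw [this, ← h]
    group
  · have : a * b⁻¹ = a * (b⁻¹ * d) * d⁻¹ := by group
    rw [this, ← h]
    group

/-- Intersections are turned into a single hidden subgroup: `v₀ v_c⁻¹ = w₀ w_c⁻¹` says `v₀⁻¹ w₀ =
v_c⁻¹ w_c`. So two arguments have equal values iff all components of their quotient agree and the
first lies in the subgroup hidden by `f * f`, which gives the diagonal of the intersection. -/
theorem hidesOn_searchQuery (hR : R.IsCorrect) (h : HidesOn x.G x.ev D) (i j j' k l : Fin x.n) :
    HidesOn (searchQuery R x i j j' k l).G (searchQuery R x i j j' k l).ev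
      ((wreath D ⊓ wreath (x.G ⊓ fixingSubgroup (Perm (Fin x.n)) {a : Fin x.n | a < i}) ⊓
        span (setStabGens (point i 0) (point j 1)) ⊓
        span (setStabGens (point i 1) (point j' 0)) ⊓
        span (setStabGens (point k 0) (point l 1))).map
          ((blockHom (x.n * 2)).comp (Pi.constMonoidHom (Fin 4) (Perm (Fin (x.n * 2)))))) := by
  have h₀ := (h.wreath x.n_pos).restrict (A := wreath (x.G ⊓
    fixingSubgroup (Perm (Fin x.n)) {a : Fin x.n | a < i})) (wreath_mono inf_le_left)
  have hA : span (wrGens (R x.n x.gens i)) = wreath (x.G ⊓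
    fixingSubgroup (Perm (Fin x.n)) {a : Fin x.n | a < i}) := by
    rw [span_wrGens, hR]
    rfl
  refine HidesOn.build ⟨?_, ?_⟩
  · rintro _ ⟨g, ⟨⟨⟨⟨h₁, h₂⟩, h₃⟩, h₄⟩, h₅⟩, rfl⟩
    refine block_mem_span.2 ⟨fun _ => g, fun c => ?_, rfl⟩
    rw [← hA] at h₂
    fin_cases c <;> assumption
  · intro a ha b hb
    obtain ⟨v, hv, rfl⟩ := block_mem_span.1 ha
    obtain ⟨w, hw, rfl⟩ := block_mem_span.1 hb
    rw [block_injective.extend_apply, block_injective.extend_apply]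
    have hv0 := hv 0
    have hw0 := hw 0
    simp only [Matrix.cons_val_zero, hA] at hv0 hw0
    have hm := fun c => mul_mem (inv_mem (hv c)) (hw c)
    simp only [Data.ofList, Data.cons.injEq, and_true, h₀.iff _ hv0 _ hw0, ofPerm_injective.eq_iff,
      mul_inv_eq_mul_inv_iff']
    rw [← blockHom_apply, ← blockHom_apply, ← map_inv, ← map_mul]
    constructor
    · rintro ⟨e₀, e₁, e₂, e₃⟩
      have hc : ∀ c, (v c)⁻¹ * w c = (v 0)⁻¹ * w 0 := by
        intro c
        fin_cases c
        · rfl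
        · exact e₁.symm
        · exact e₂.symm
        · exact e₃.symm
      refine ⟨(v 0)⁻¹ * w 0, ⟨⟨⟨e₀, hc 1 ▸ hm 1⟩, hc 2 ▸ hm 2⟩, hc 3 ▸ hm 3⟩,
        congrArg (blockHom _) (funext fun c => (hc c).symm)⟩
    · rintro ⟨g, ⟨⟨⟨h₁, -⟩, -⟩, -⟩, hg⟩
      have hg' := fun c => congrFun (block_injective hg) c
      have hg'' : ∀ c, g = (v c)⁻¹ * w c := hg'
      exact ⟨hg'' 0 ▸ h₁, (hg'' 0).symm.trans (hg'' 1), (hg'' 0).symm.trans (hg'' 2),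
        (hg'' 0).symm.trans (hg'' 3)⟩

theorem wr_preserves_iff {n : ℕ} {a b : Perm (Fin n)} {τ : Fin 2} {i j : Fin n} :
    wr (a, b, τ) ∈ span (setStabGens (point i 0) (point j 1)) ↔
      if τ = 0 then a i = i ∧ b j = j else a i = j ∧ b j = i := by
  rw [mem_span_setStabGens]
  have hp : ∀ c c' : Fin n, ∀ d d' : Fin 2, point c d = point c' d' ↔ c = c' ∧ d = d' := by
    intro c c' d d'
    rw [point, point, finProdFinEquiv.injective.eq_iff, Prod.mk.injEq]
  have hw : ∀ c d, wr (a, b, τ) (point c d) = point (if d = 0 then a c else b c) (τ + d) :=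
    fun c d => FP.wr_apply _ c d
  constructor
  · intro h
    have h₀ := (h (point i 0)).2 (Or.inl rfl)
    have h₁ := (h (point j 1)).2 (Or.inr rfl)
    rw [hw, hp, hp] at h₀ h₁
    rcases eq_zero_or_one τ with rfl | rfl <;> simp_all
  · intro h c
    obtain ⟨⟨c, d⟩, rfl⟩ := finProdFinEquiv.surjective c
    change (wr (a, b, τ) (point c d) = _ ∨ wr (a, b, τ) (point c d) = _) ↔
      (point c d = _ ∨ point c d = _)
    rw [hw, hp, hp, hp, hp]
    have inj : ∀ {g : Perm (Fin n)} {c c' : Fin n}, g c' = c → ∀ e, g e = c ↔ e = c' := by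
      rintro g _ c' rfl e
      exact g.injective.eq_iff
    rcases eq_zero_or_one τ with rfl | rfl <;> rcases eq_zero_or_one d with rfl | rfl <;>
      simp_all
    exacts [inj h.1 c, inj h.2 c, inj h.1 c, inj h.2 c]

theorem span_setStabGens_comm {N : ℕ} (a b : Fin N) :
    span (setStabGens a b) = span (setStabGens b a) := by
  ext g
  rw [mem_span_setStabGens, mem_span_setStabGens]
  simp only [or_comm]

theorem mem_fixingSubgroup_lt {n : ℕ} {i : Fin n} {g : Perm (Fin n)} :
    g ∈ fixingSubgroup (Perm (Fin n)) {a : Fin n | a < i} ↔ FixesBelow i g := by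
  rw [mem_fixingSubgroup_iff]
  rfl

/-- The assumption `hD` says that the element of `D` is determined within its level by the image of
`i`. It removes all elements without swap from the intersection; an element `(a, b, 1)` yields `g =
a`, and conversely `g` yields `(g, g⁻¹, 1)`. -/
theorem searchQuery_eq_nontrivial_iff (hP : P.IsCorrect) (hR : R.IsCorrect)
    (h : HidesOn x.G x.ev D) {i j j' k l : Fin x.n}
    (hD : ∀ d ∈ D, FixesBelow (i + 1) d → d = 1) : P (searchQuery R x i j j' k l) = .nontrivial ↔
      ∃ g ∈ D, FixesBelow i g ∧ g i = j ∧ g j' = i ∧ g k = l := by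
  rw [hP.eq_nontrivial_iff (hidesOn_searchQuery hR h i j j' k l),
    span_setStabGens_comm (point i 1)]
  constructor
  · rintro ⟨_, ⟨g, ⟨⟨⟨⟨h₁, h₂⟩, h₃⟩, h₄⟩, h₅⟩, rfl⟩, hne⟩
    obtain ⟨⟨a, b, τ⟩, ha, hb, rfl⟩ := h₁
    obtain ⟨⟨-, ha'⟩, ⟨-, hb'⟩⟩ := (wr_mem_wreath x.n_pos).1 h₂
    replace h₃ := wr_preserves_iff.1 h₃
    replace h₄ := wr_preserves_iff.1 h₄
    replace h₅ := wr_preserves_iff.1 h₅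
    replace ha' := mem_fixingSubgroup_lt.1 ha'
    replace hb' := mem_fixingSubgroup_lt.1 hb'
    rcases eq_zero_or_one τ with rfl | rfl
    · refine absurd ?_ hne
      -- Without swap, the first setwise stabilizer makes `a` fix `i` and the second makes `b` fix
      -- `i`; this is the purpose of having both `j` and `j'`.
      have e₁ : a = 1 := hD a ha (fixesBelow_succ.2 ⟨ha', h₃.1⟩)
      have e₂ : b = 1 := hD b hb (fixesBelow_succ.2 ⟨hb', h₄.2⟩)
      rw [e₁, e₂, wr_one]
      exact map_one ((blockHom (x.n * 2)).comp (Pi.constMonoidHom _ _))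
    · refine ⟨a, ha, ha', h₃.1, h₄.1, h₅.1⟩
  · rintro ⟨g, hg, hgi, hj, hj', hkl⟩
    have hg' : g ∈ x.G ⊓ fixingSubgroup (Perm (Fin x.n)) {a : Fin x.n | a < i} :=
      ⟨h.le hg, mem_fixingSubgroup_lt.2 hgi⟩
    refine ⟨_, ⟨wr (g, g⁻¹, 1), ⟨⟨⟨⟨⟨_, hg, inv_mem hg, rfl⟩, ⟨_, hg', inv_mem hg', rfl⟩⟩, ?_⟩, ?_⟩,
      ?_⟩, rfl⟩, ?_⟩
    · refine wr_preserves_iff.2 ⟨hj, Perm.inv_eq_iff_eq.2 hj.symm⟩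
    · refine wr_preserves_iff.2 ⟨hj', Perm.inv_eq_iff_eq.2 hj'.symm⟩
    · refine wr_preserves_iff.2 ⟨hkl, Perm.inv_eq_iff_eq.2 hkl.symm⟩
    · intro h1
      have := congrFun (block_injective (h1.trans (map_one (blockHom _)).symm)) 0
      have := wr_injective x.n_pos (this.trans wr_one.symm)
      simp at this

end query

/-! ## The search -/

theorem find?_rel {β : Type} {r : β → β → Prop} {p : β → Bool} {l : List β} (hl : l.Pairwise r)
    {a b : β} (ha : l.find? p = some a) (hb : b ∈ l) (hpb : p b) : b = a ∨ r a b := by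
  induction l with
  | nil => simp at ha
  | cons c l ih =>
    rw [List.pairwise_cons] at hl
    rw [List.find?_cons] at ha
    split at ha
    · obtain rfl := Option.some.inj ha
      exact (List.mem_cons.1 hb).imp_right fun h => hl.1 b h
    · rename_i hc
      rcases List.mem_cons.1 hb with rfl | hb
      · rw [hpb] at hc
        cases hc
      · exact ih hl.2 ha hb

theorem pairwise_triples (n : ℕ) : (triples n).Pairwise fun c d => d.1 ≤ c.1 := by
  rw [triples, show ∀ l l' : List _, l ×ˢ l' = l.flatMap fun a => l'.map (Prod.mk a) from
    fun _ _ => rfl, List.pairwise_flatMap]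
  refine ⟨fun a _ => ?_, ?_⟩
  · rw [List.pairwise_map]
    exact List.pairwise_of_forall fun _ _ => le_rfl
  · rw [List.pairwise_reverse]
    refine (List.pairwise_le_finRange n).imp fun h => ?_
    simp only [List.mem_map, forall_exists_index, and_imp]
    rintro _ _ - rfl _ _ - rfl
    exact h

theorem mem_triples {n : ℕ} (c : Fin n × Fin n × Fin n) : c ∈ triples n :=
  List.pair_mem_product.2 ⟨List.mem_reverse.2 (List.mem_finRange _),
    List.pair_mem_product.2 ⟨List.mem_finRange _, List.mem_finRange _⟩⟩

theorem FixesBelow.lt_of_ne {n : ℕ} {i j : Fin n} {g : Perm (Fin n)} (h : FixesBelow i g)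
    (hij : i ≤ j) : i ≤ g j := by
  by_contra hlt
  have h₁ := h (g j) (by simpa using hlt)
  have h₂ := g.injective h₁
  omega

theorem find?_finRange {n : ℕ} {p : Fin n → Bool} {a : Fin n} (h : ∀ b, p b = true ↔ b = a) :
    (List.finRange n).find? p = some a := by
  rcases ho : (List.finRange n).find? p with _ | b
  · exact absurd ((h a).2 rfl) (List.find?_eq_none.1 ho a (List.mem_finRange a))
  · rw [(h b).1 (List.find?_some ho)]

section search

variable {x : Input} {R : StabRoutine} {P : DecisionProgram} {D : Subgroup (Perm (Fin x.n))}

theorem search_eq_some {g : Perm (Fin x.n)} (h : search R P x = some g) :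
    ∃ c, searchTriple R P x = some c ∧ IsReadOff R P x c.1 c.2.1 c.2.2 g := by
  rw [search] at h
  split at h
  · simp at h
  · rename_i c hc
    refine ⟨c, hc, ?_⟩
    split at h
    · rename_i hex
      obtain rfl := Option.some.inj h
      exact hex.choose_spec
    · simp at h

theorem IsReadOff.unique {i j j' : Fin x.n} {g h : Perm (Fin x.n)} (hg : IsReadOff R P x i j j' g)
    (hh : IsReadOff R P x i j j' h) : g = h := by
  ext k
  rcases lt_or_ge k i with hk | hk
  · rw [hg.2.2.1 k hk, hh.2.2.1 k hk]
  · rw [Option.some.inj ((hg.2.2.2 k hk).symm.trans (hh.2.2.2 k hk))]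

theorem search_eq_some_iff {g : Perm (Fin x.n)} : search R P x = some g ↔
    ∃ c, searchTriple R P x = some c ∧ IsReadOff R P x c.1 c.2.1 c.2.2 g := by
  refine ⟨search_eq_some, ?_⟩
  rintro ⟨c, hc, hg⟩
  have hex : ∃ g, IsReadOff R P x c.1 c.2.1 c.2.2 g := ⟨g, hg⟩
  rw [search, hc]
  simp only [dif_pos hex]
  rw [hex.choose_spec.unique hg]

/-- With a correct program, the search finds a nontrivial element of the hidden subgroup. -/
theorem exists_search_eq (hP : P.IsCorrect) (hR : R.IsCorrect) (h : HidesOn x.G x.ev D)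
    (hne : ∃ d ∈ D, d ≠ 1) : ∃ g ∈ D, g ≠ 1 ∧ search R P x = some g := by
  classical
  -- The largest `i` moved by an element of `D` that fixes everything before it. From this level on,
  -- `D` has no nontrivial element fixing all points up to and including the current one, so that
  -- queries with index at least `i` are understood.
  have hmax : ∃ i : Fin x.n, (∃ d ∈ D, FixesBelow i d ∧ d i ≠ i) ∧
      ∀ i' : Fin x.n, (∃ d ∈ D, FixesBelow i' d ∧ d i' ≠ i') → i' ≤ i := by
    obtain ⟨d, hd, hd1⟩ := hne
    obtain ⟨i₀, h₀⟩ := exists_first_moved hd1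
    obtain ⟨i, hi, hm⟩ := Finset.exists_max_image
      (Finset.univ.filter fun i : Fin x.n => ∃ d ∈ D, FixesBelow i d ∧ d i ≠ i) id
      ⟨i₀, by simpa using ⟨d, hd, h₀⟩⟩
    exact ⟨i, by simpa using hi, fun i' hi' => hm i' (by simpa using hi')⟩
  obtain ⟨i, ⟨d, hd, hdi, hdi'⟩, hi⟩ := hmax
  have htriv : ∀ i' : Fin x.n, i ≤ i' → ∀ d ∈ D, FixesBelow (i' + 1) d → d = 1 := by
    intro i' hii' d hd hfix
    by_contra hne
    obtain ⟨m, hm, hm'⟩ := exists_first_moved hne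
    have h₁ := hi m ⟨d, hd, hm, hm'⟩
    exact hm' (hfix m (by have := Fin.le_def.1 h₁; have := Fin.le_def.1 hii'; omega))
  have hq := fun {i' : Fin x.n} (hii' : i ≤ i') {j j' k l : Fin x.n} =>
    searchQuery_eq_nontrivial_iff (j := j) (j' := j') (k := k) (l := l) hP hR h (htriv i' hii')
  have hlt : ∀ {j}, d j = i ∨ d i = j → i < j := by
    rintro j (hj | rfl)
    · refine lt_of_le_of_ne (not_lt.1 fun hlt => ?_) ?_
      · exact hlt.ne ((hdi j hlt).symm.trans hj)
      · rintro rfl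
        exact hdi' hj
    · exact lt_of_le_of_ne (hdi.lt_of_ne le_rfl) (Ne.symm hdi')
  obtain ⟨c, hc⟩ : ∃ c, searchTriple R P x = some c := by
    rw [← Option.ne_none_iff_exists']
    intro hnone
    refine List.find?_eq_none.1 hnone (i, d i, d⁻¹ i) (mem_triples _) (decide_eq_true ?_)
    have hinv : d (d⁻¹ i) = i := d.apply_symm_apply i
    exact ⟨hlt (Or.inr rfl), hlt (Or.inl hinv), i, d i, le_rfl, (hlt (Or.inr rfl)).le,
      (hq le_rfl).2 ⟨d, hd, hdi, rfl, hinv, rfl⟩⟩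
  have hc' := hc
  unfold searchTriple at hc'
  have hc'' := List.find?_some hc'
  obtain ⟨h₁, h₂, k, l, -, -, h₃⟩ := of_decide_eq_true hc''
  -- The triple `(i, d i, d⁻¹ i)` is accepted and the triples are ordered by decreasing first entry,
  -- so the index found is at least `i`. Its positive answer provides an element moving that index,
  -- so by maximality it is at most `i`.
  have hci : c.1 = i := by
    have hle : i ≤ c.1 := by
      have hinv : d (d⁻¹ i) = i := d.apply_symm_apply i
      rcases find?_rel (pairwise_triples x.n) hc' (mem_triples (i, d i, d⁻¹ i)) (decide_eq_true
        ⟨hlt (Or.inr rfl), hlt (Or.inl hinv), i, d i, le_rfl, (hlt (Or.inr rfl)).le,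
          (hq le_rfl).2 ⟨d, hd, hdi, rfl, hinv, rfl⟩⟩) with hc' | hc'
      · rw [← hc']
      · exact hc'
    obtain ⟨g, hg, hgi, hgj, -⟩ := (hq hle).1 h₃
    refine le_antisymm (hi _ ⟨g, hg, hgi, ?_⟩) hle
    rw [hgj]
    exact h₁.ne'
  obtain ⟨i', j, j'⟩ := c
  obtain rfl : i' = i := hci
  obtain ⟨g, hg, hgi, hgj, hgj', -⟩ := (hq le_rfl).1 h₃
  have hg1 : g ≠ 1 := by
    rintro rfl
    exact h₁.ne hgj
  refine ⟨g, hg, hg1, search_eq_some_iff.2 ⟨_, hc, h.le hg, hg1, fun k hk => hgi k hk,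
    fun k hk => find?_finRange fun l => ?_⟩⟩
  rw [decide_eq_true_iff]
  constructor
  · rintro ⟨-, hl⟩
    obtain ⟨g', hg', hgi', hgj₁, -, hkl⟩ := (hq le_rfl).1 hl
    -- Elements of `D` from two positive answers agree at `i'`, so their quotient fixes all points
    -- up to `i'` and is trivial: all answers describe the same `g`.
    have := htriv i' le_rfl _ (mul_mem (inv_mem hg') hg)
      (hgi'.succ_inv_mul hgi (hgj₁.trans hgj.symm))
    rw [inv_mul_eq_one] at this
    rw [← this, hkl]
  · rintro rfl
    exact ⟨hgi.lt_of_ne hk, (hq le_rfl).2 ⟨g, hg, hgi, hgj, hgj', rfl⟩⟩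

end search

end HSP

end

/-! ### Completeness and soundness of the checkers -/

noncomputable section

namespace HSP

open Equiv
open scoped ENNReal

/-! ## Probabilities -/

/-- An injective `σ` sends the passing elements to failing ones, so at most half of all elements
pass; independent rounds multiply. -/
theorem card_filter_forall_mul_le {U : Type} [Fintype U] [DecidableEq U] {k : ℕ} (pass : U → Prop)
    [DecidablePred pass] (σ : U → U) (hσ : Function.Injective σ) (h : ∀ u, pass u → ¬ pass (σ u)) :
    ∑ u : Fin k → U, (if ∀ r, pass (u r) then (1 : ℝ≥0∞) else 0) *
      (Fintype.card (Fin k → U) : ℝ≥0∞)⁻¹ ≤ 2⁻¹ ^ k := by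
  set A := Finset.univ.filter pass
  have hA : A.card + A.card ≤ Fintype.card U := by
    calc A.card + A.card = (A ∪ A.image σ).card := by
          rw [Finset.card_union_of_disjoint, Finset.card_image_of_injective _ hσ]
          rw [Finset.disjoint_left]
          intro u hu hu'
          obtain ⟨v, hv, rfl⟩ := Finset.mem_image.1 hu'
          exact h v (Finset.mem_filter.1 hv).2 (Finset.mem_filter.1 hu).2
      _ ≤ Fintype.card U := Finset.card_le_univ _
  rw [← Finset.sum_mul, Finset.sum_boole]
  have hcard : (Finset.univ.filter fun u : Fin k → U => ∀ r, pass (u r)).card = A.card ^ k := by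
    have : (Finset.univ.filter fun u : Fin k → U => ∀ r, pass (u r)) =
        Fintype.piFinset fun _ => A := by
      ext u
      simp [A]
    rw [this, Fintype.card_piFinset_const]
  rw [hcard, Fintype.card_fun, Fintype.card_fin]
  push_cast
  rw [ENNReal.inv_pow, ← mul_pow]
  gcongr
  rw [← div_eq_mul_inv]
  refine ENNReal.div_le_of_le_mul ?_
  rw [← ENNReal.mul_le_mul_iff_right (a := 2) (by simp) (by simp), ← mul_assoc,
    ENNReal.mul_inv_cancel (by simp) (by simp), one_mul, two_mul]
  exact_mod_cast hA

theorem map_uniform_apply {U V : Type} [Fintype U] [Nonempty U] [DecidableEq V] (f : U → V)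
    (v : V) : (PMF.uniformOfFintype U).map f v =
      ∑ u, (if f u = v then 1 else 0) * (Fintype.card U : ℝ≥0∞)⁻¹ := by
  rw [PMF.map_apply, tsum_fintype]
  refine Finset.sum_congr rfl fun u _ => ?_
  rw [PMF.uniformOfFintype_apply]
  by_cases h : f u = v
  · simp [h]
  · simp [h, Ne.symm h]

section

variable {x : Input} {D : Subgroup (Perm (Fin x.n))}

theorem shiftInput_hidesOn (h : HidesOn x.G x.ev D) (u : x.G) :
    HidesOn (shiftInput x u).G (shiftInput x u).ev (shiftSub D (u : Perm (Fin x.n))) := by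
  have := h.shiftSub x.n_pos u.2
  rw [show wreath x.G = span (wrGens x.gens) from (span_wrGens _).symm] at this
  exact this.build

theorem one_mem_shiftSub (u : Perm (Fin x.n)) : wr (u⁻¹, u, 1) ∈ shiftSub D u := by
  rw [wr_mem_shiftSub x.n_pos]
  simp

theorem wr_ne_one {n : ℕ} (hn : 0 < n) (a b : Perm (Fin n)) : wr (a, b, 1) ≠ 1 := by
  rw [← wr_one]
  intro h
  have := wr_injective hn h
  simp at this

/-- The arguments `g * u⁻¹ * d⁻¹` and `g * u⁻¹` lie in the same left coset of `D`. Outside the group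
both sides are `nil`, so the functions agree everywhere. -/
theorem shift_eq_shift (h : HidesOn x.G x.ev D) {d : Perm (Fin x.n)} (hd : d ∈ D)
    (u : Perm (Fin x.n)) (hu : u ∈ x.G) :
    (fun g => x.ev (g * (d * u)⁻¹)) = fun g => x.ev (g * u⁻¹) := by
  funext g
  by_cases hg : g ∈ x.G
  · rw [h.iff _ (x.G.mul_mem hg (x.G.inv_mem (x.G.mul_mem (h.le hd) hu)))
      _ (x.G.mul_mem hg (x.G.inv_mem hu))]
    simpa [mul_assoc] using hd
  · rw [x.ev_of_notMem, x.ev_of_notMem]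
    · rwa [Subgroup.mul_mem_cancel_right _ (x.G.inv_mem hu)]
    · rwa [Subgroup.mul_mem_cancel_right _ (x.G.inv_mem (x.G.mul_mem (h.le hd) hu))]

/-- Two elements of the same coset of `D` lead to the same shifted input. -/
theorem shiftInput_congr (h : HidesOn x.G x.ev D) {d : Perm (Fin x.n)} (hd : d ∈ D) (u : x.G)
    {α : ℕ → Type} (Φ : ∀ y : Input, α y.n) :
    (Φ (shiftInput x (⟨d, h.le hd⟩ * u)) : α (x.n * 2)) = Φ (shiftInput x u) := by
  have key : ∀ {hn gens F F'}, F = F' →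
      (Φ (Input.build (n := x.n * 2) hn gens F) : α (x.n * 2)) = Φ (Input.build hn gens F') := by
    rintro _ _ _ _ rfl
    rfl
  exact key (congrArg (wrFun x.ev) (shift_eq_shift h hd u u.2))

end

/-! ## The checker for the decision version -/

section decision

variable {x : Input} {R : StabRoutine} {P : DecisionProgram} {D : Subgroup (Perm (Fin x.n))}

theorem checkDecision_eq_correct (hP : P.IsCorrect) (hR : R.IsCorrect) (h : HidesOn x.G x.ev D)
    {k : ℕ} (u : Fin k → x.G) : checkDecision R P x u = .correct := by
  have hiff := hP.eq_nontrivial_iff h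
  rw [checkDecision]
  cases hx : P x with
  | nontrivial =>
    obtain ⟨g, hg, -, hs⟩ := exists_search_eq hP hR h (hiff.1 hx)
    simp only [hs]
    rw [if_pos]
    rw [h.iff _ (h.le hg) _ (one_mem _), mul_one]
    exact inv_mem hg
  | trivial =>
    simp only
    rw [if_pos]
    intro r
    have hD : ∀ d ∈ D, d = 1 := by
      intro d hd
      by_contra hne
      have := hiff.2 ⟨d, hd, hne⟩
      rw [hx] at this
      cases this
    obtain ⟨g, hg, hne, hs⟩ := exists_search_eq hP hR (shiftInput_hidesOn h (u r))
      ⟨_, one_mem_shiftSub _, wr_ne_one x.n_pos _ _⟩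
    rw [hs]
    congr 1
    obtain ⟨⟨a, b, τ⟩, -, -, hg'⟩ := (shiftInput_hidesOn h (u r)).le hg |> fun h' => by
      have h'' : g ∈ span (wrGens x.gens) := h'
      rw [span_wrGens] at h''
      exact h''
    have hg' : wr (a, b, τ) = g := hg'
    subst hg'
    have hm := (wr_mem_shiftSub x.n_pos).1 hg
    -- With `D` trivial the subgroup hidden in the shifted input has two elements: no swap forces
    -- the identity, and a swap forces `(u⁻¹, u, 1)`.
    rcases eq_zero_or_one τ with rfl | rfl
    · refine absurd ?_ hne
      have h₁ := hD _ hm.1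
      have h₂ := hD _ hm.2
      rw [mul_inv_eq_one, mul_eq_left] at h₂
      rw [h₁, h₂]
      exact wr_one
    · have h₁ := hD _ hm.1
      have h₂ := hD _ hm.2
      rw [mul_inv_eq_one] at h₂
      rw [mul_eq_one_iff_eq_inv', ] at h₁
      rw [h₁, h₂]

theorem decisionChecker_eq_pure (hP : P.IsCorrect) (hR : R.IsCorrect) {H : Subgroup x.G}
    (h : x.Hides H) (k : ℕ) : decisionChecker R P x k = PMF.pure .correct := by
  rw [decisionChecker, show checkDecision R P x = Function.const (Fin k → x.G) .correct from
    funext fun u => checkDecision_eq_correct hP hR h.hidesOn u, PMF.map_const]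

/-- A wrong answer "nontrivial" never passes, since `search` returns only nontrivial elements of the
group and `f` separates them from the identity. For a wrong answer "trivial", multiplication by some
`d ≠ 1` in the hidden subgroup keeps the shifted input but changes the element that must be found.
-/
theorem decisionChecker_correct_le {H : Subgroup x.G} (h : x.Hides H)
    (hP : ¬ RightAnswer H (P x)) (k : ℕ) : decisionChecker R P x k .correct ≤ 2⁻¹ ^ k := by
  classical
  have hD := h.hidesOn
  have hbot : H = ⊥ ↔ ∀ d ∈ H.map x.G.subtype, d = 1 := by
    rw [← Subgroup.eq_bot_iff_forall, Subgroup.map_eq_bot_iff_of_injective _ x.G.subtype_injective]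
  rw [decisionChecker, map_uniform_apply]
  rw [RightAnswer, hbot] at hP
  cases hx : P x with
  | nontrivial =>
    simp only [hx, reduceCtorEq, false_iff, not_not] at hP
    rw [Finset.sum_eq_zero]
    · exact zero_le
    · intro u _
      rw [if_neg, zero_mul]
      rw [checkDecision, hx]
      simp only
      rcases hs : search R P x with _ | g
      · simp
      · obtain ⟨c, -, hgG, hg1, -⟩ := search_eq_some hs
        simp only
        rw [if_neg]
        · simp
        · intro he
          rw [hD.iff _ hgG _ (one_mem _), mul_one] at he
          exact hg1 (inv_eq_one.1 (hP _ he))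
  | trivial =>
    simp only [hx, true_iff, not_forall] at hP
    obtain ⟨d, hd, hd1⟩ := hP
    refine le_trans (le_of_eq (Finset.sum_congr rfl fun u _ => ?_)) (card_filter_forall_mul_le
      (U := x.G) (fun u => search R P (shiftInput x u) = some (wr ((u : Perm (Fin x.n))⁻¹, u, 1)))
      (fun u => ⟨d, hD.le hd⟩ * u) (mul_right_injective _) fun u hu hu' => ?_)
    · rw [checkDecision, hx]
      simp only
      congr 1
      split <;> simp_all
    · have he := (shiftInput_congr hD hd u (α := fun n => Option (Perm (Fin n)))
        (search R P)).symm.trans hu'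
      have := wr_injective x.n_pos (Option.some.inj (hu.symm.trans he))
      simp only [Prod.mk.injEq, Subgroup.coe_mul, right_eq_mul] at this
      exact hd1 this.2.1

end decision

/-! ## The checker for generators -/

section generators

variable {x : Input} {P : GeneratorProgram} {D : Subgroup (Perm (Fin x.n))}

theorem GeneratorProgram.IsCorrect.span_eq (hP : P.IsCorrect) (h : HidesOn x.G x.ev D) :
    span (P x) = D := by
  rw [hP x _ h.hides, Subgroup.map_subgroupOf_eq_of_le h.le]

/-- `shiftGens` is adjoint to `shiftSub`: a group `E` contains the derived generators exactly if the
given elements are compatible with `E` and the representative `u`. Both inclusions in a round of the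
generator checker follow from it. -/
theorem span_shiftGens_le {n : ℕ} (hn : 0 < n) {u : Perm (Fin n)} {E : Subgroup (Perm (Fin n))}
    {l : List (Perm (Fin n) × Perm (Fin n) × Fin 2)} :
    span (shiftGens u l) ≤ E ↔ span (l.map wr) ≤ shiftSub E u := by
  rw [span_le, span_le]
  simp only [shiftGens, List.mem_flatMap, List.forall_mem_map, forall_exists_index, and_imp,
    Prod.forall, wr_mem_shiftSub hn]
  refine ⟨fun h a b τ ht => ?_, fun h g a b τ ht => ?_⟩
  · have := fun g => h g a b τ ht
    rcases eq_zero_or_one τ with rfl | rfl <;> simpa using this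
  · have := h a b τ ht
    rcases eq_zero_or_one τ with rfl | rfl
    · simp only [if_true, List.mem_cons, List.not_mem_nil, or_false] at this ⊢
      rintro (rfl | rfl)
      exacts [this.1, this.2]
    · simp only [one_ne_zero, if_false, List.mem_cons, List.not_mem_nil, or_false] at this ⊢
      rintro (rfl | rfl)
      exacts [this.1, this.2]

/-- Only the coset `D u` matters, because `(1, v * u⁻¹, 0)` lies in `wreath D`. Hence the
representative `u'` read off from the answer serves as well as the secret `u`. -/
theorem shiftSub_congr {n : ℕ} {D : Subgroup (Perm (Fin n))} {u v : Perm (Fin n)}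
    (h : v * u⁻¹ ∈ D) : shiftSub D u = shiftSub D v := by
  ext g
  have he : wr (1, v * u⁻¹, 0) ∈ wreath D := ⟨_, one_mem _, h, rfl⟩
  change wr (1, u, 0) * g * (wr (1, u, 0))⁻¹ ∈ wreath D ↔
    wr (1, v, 0) * g * (wr (1, v, 0))⁻¹ ∈ wreath D
  have hv : wr (1, v, 0) = wr (1, v * u⁻¹, 0) * wr (1, u, 0) := by
    rw [wr_mul_zero, inv_mul_cancel_right, one_mul]
  rw [hv, ← Subgroup.mul_mem_cancel_left _ he,
    ← Subgroup.mul_mem_cancel_right _ ((wreath D).inv_mem he)]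
  simp only [mul_inv_rev, mul_assoc]

theorem roundPasses (hP : P.IsCorrect) (h : HidesOn x.G x.ev D) (u : x.G) : RoundPasses P x u := by
  have hn := x.n_pos
  have hs : span (P (shiftInput x u)) = shiftSub D (u : Perm (Fin x.n)) :=
    hP.span_eq (shiftInput_hidesOn h u)
  have hwr : ∀ g ∈ P (shiftInput x u), ∃ t, wr t = g := by
    intro g hg
    have h₁ : g ∈ span (wrGens x.gens) := (shiftInput_hidesOn h u).le (hs ▸ subset_span hg)
    rw [span_wrGens] at h₁
    obtain ⟨t, -, -, ht⟩ := h₁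
    exact ⟨t, ht⟩
  obtain ⟨l, hl⟩ : ∃ l : List (Perm (Fin x.n) × Perm (Fin x.n) × Fin 2),
      l.map wr = P (shiftInput x u) := by
    have : P (shiftInput x u) ∈ Set.range (List.map (wr (n := x.n))) := by
      rw [Set.range_list_map]
      exact hwr
    exact this
  rw [← hl] at hs
  -- Elements without swap form a subgroup, but the hidden subgroup contains `(u⁻¹, u, 1)`; so some
  -- generator has a swap.
  have hex : ∃ t, l.find? (fun s => decide (s.2.2 = 1)) = some t := by
    rw [← Option.ne_none_iff_exists']
    intro hnone
    have h0 : ∀ t ∈ l, t.2.2 = 0 := fun t ht =>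
      (eq_zero_or_one _).resolve_right fun h1 => List.find?_eq_none.1 hnone t ht (by simpa using h1)
    have hle : span (l.map wr) ≤ (MonoidHom.mk' (fun t : Perm (Fin x.n) × Perm (Fin x.n) =>
        wr (t.1, t.2, 0)) fun a b => wr_mul_zero.symm).range := by
      refine span_le.2 ?_
      simp only [List.forall_mem_map]
      rintro ⟨a, b, τ⟩ ht
      obtain rfl : τ = 0 := h0 _ ht
      exact ⟨(a, b), rfl⟩
    obtain ⟨t, ht⟩ := hle (hs.symm ▸ one_mem_shiftSub (D := D) (u : Perm (Fin x.n)))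
    have := wr_injective hn ht
    simp at this
  obtain ⟨t, ht⟩ := hex
  refine ⟨l, t, hl.symm, ht, ?_, ?_⟩
  all_goals
    have htl := List.mem_of_find?_eq_some ht
    obtain ⟨a, b, τ⟩ := t
    obtain rfl : τ = 1 := by simpa using List.find?_some ht
    have htu : wr (a, b, 1) ∈ shiftSub D (u : Perm (Fin x.n)) :=
      hs ▸ subset_span (List.mem_map_of_mem htl)
    rw [wr_mem_shiftSub hn] at htu
    have hbu : b * (u : Perm (Fin x.n))⁻¹ ∈ D := htu.2
    have hub : (u : Perm (Fin x.n)) * b⁻¹ ∈ D := by simpa using inv_mem hbu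
    rw [hP.span_eq h]
  · have hsub : shiftSub D (u : Perm (Fin x.n)) = shiftSub D b := shiftSub_congr hbu
    apply le_antisymm
    · exact (span_shiftGens_le hn).2 (hs.trans hsub).le
    · intro d hd
      -- Each `d ∈ D` occurs as the first coordinate of a hidden element without swap, so the
      -- derived generators produce it.
      have h₁ : wr (d, 1, 0) ∈ shiftSub D (u : Perm (Fin x.n)) := by
        rw [wr_mem_shiftSub hn]
        simpa using hd
      rw [← hs] at h₁
      have h₂ := (span_shiftGens_le hn (u := b)).1 le_rfl h₁
      rw [wr_mem_shiftSub hn] at h₂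
      exact h₂.1
  · exact hub

theorem generatorChecker_eq_pure (hP : P.IsCorrect) {H : Subgroup x.G} (h : x.Hides H) (k : ℕ) :
    generatorChecker P x k = PMF.pure .correct := by
  rw [generatorChecker, show checkGenerators P x = Function.const (Fin k → x.G) .correct from
    funext fun u => ?_, PMF.map_const]
  have hD := h.hidesOn
  rw [checkGenerators, if_pos]
  · rfl
  · refine ⟨fun s hs => ?_, fun r => roundPasses hP hD _⟩
    have := subset_span hs
    rw [hP.span_eq hD] at this
    refine ⟨hD.le this, ?_⟩
    rw [hD.iff _ (hD.le this) _ (one_mem _), mul_one]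
    exact inv_mem this

/-- The test on `f` already forces the list to generate a subgroup of the hidden one. If it is
proper, take `d` in the difference: `u` and `d * u` produce the same list and the same `u'`, and
passing both would put `d` into the generated subgroup. -/
theorem generatorChecker_correct_le {H : Subgroup x.G} (h : x.Hides H)
    (hP : ¬ RightGenerators H (P x)) (k : ℕ) : generatorChecker P x k .correct ≤ 2⁻¹ ^ k := by
  classical
  have hD := h.hidesOn
  rw [generatorChecker, map_uniform_apply]
  by_cases hS : ∀ s ∈ P x, s ∈ x.G ∧ x.ev s = x.ev 1
  · have hle : span (P x) ≤ H.map x.G.subtype := span_le.2 fun s hs => by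
      have := (hS s hs).2
      rw [hD.iff _ (hS s hs).1 _ (one_mem _), mul_one] at this
      exact inv_mem_iff.1 this
    obtain ⟨d, hd, hd'⟩ := SetLike.exists_of_lt (lt_of_le_of_ne hle hP)
    refine le_trans (le_of_eq (Finset.sum_congr rfl fun u _ => ?_)) (card_filter_forall_mul_le
      (U := x.G) (fun u => RoundPasses P x u)
      (fun u => ⟨d, hD.le hd⟩ * u) (mul_right_injective _) fun u hu hu' => ?_)
    · rw [checkGenerators]
      congr 1
      by_cases hp : ∀ r, RoundPasses P x (u r)
      · simpa [hp] using hS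
      · simp [hp]
    · obtain ⟨l, t, h₁, h₂, -, h₃⟩ := hu
      obtain ⟨l', t', h₁', h₂', -, h₃'⟩ := hu'
      have he := (shiftInput_congr hD hd u (α := fun n => List (Perm (Fin n)))
        P).symm.trans h₁'
      obtain rfl := List.map_injective_iff.2 (wr_injective x.n_pos) (h₁.symm.trans he)
      obtain rfl := Option.some.inj (h₂.symm.trans h₂')
      refine hd' ?_
      have := mul_mem h₃' (inv_mem h₃)
      simpa using this
  · rw [Finset.sum_eq_zero]
    · exact zero_le
    · intro u _
      rw [if_neg, zero_mul]
      rw [checkGenerators, if_neg fun h => hS h.1]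
      simp

end generators

end HSP

end

/-! ### From checkers to nonadaptive oracle machines -/

noncomputable section

namespace HSP

open Equiv

/-! ## Evaluating the functions of the queries -/

/-- The functions of the inputs `q i` are computed on their groups in polynomial time. -/
def Evaluable {ι : Type} (Γ : Ctx ι) (q : ι → Input) : Prop :=
  FP (Γ.ext (fun p : Σ i, (q i).G => p.1) fun p => .ofPerm (p.2 : Perm (Fin (q p.1).n)))
    fun p => (q p.1).f p.2

namespace Evaluable

variable {ι κ : Type} {Γ : Ctx ι} {q : ι → Input} {n : ι → ℕ}

theorem eval (h : Evaluable Γ q) {g : ∀ i, Perm (Fin (q i).n)} (hG : ∀ i, g i ∈ (q i).G)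
    (hg : FP Γ fun i => .ofPerm (g i)) : FP Γ fun i => (q i).ev (g i) := by
  have hc := (FP.self Γ).cons hg
  refine (h.call (fun i => (⟨i, ⟨g i, hG i⟩⟩ : Σ i, (q i).G)) (fun _ => rfl) ?_ hc).congr
    fun i => ((q i).ev_of_mem (hG i)).symm
  exact ((PBd.self _).add hg.size_pBd).add (.const _ 1)

theorem weaken (h : Evaluable Γ q) (π : κ → ι) (e : κ → Data) :
    Evaluable (Γ.ext π e) fun j => q (π j) := by
  have hc := (FP.self ((Γ.ext π e).ext (fun p : Σ j, (q (π j)).G => p.1)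
    fun p => .ofPerm (p.2 : Perm (Fin (q (π p.1)).n)))).fst.fst.cons (FP.var _ _ _)
  refine h.call (fun p : Σ j, (q (π j)).G => (⟨π p.1, p.2⟩ : Σ i, (q i).G)) (fun _ => rfl) ?_ hc
  exact (PBd.self _).mono fun p => by simp only [Ctx.ext_N]; omega

theorem reindex (h : Evaluable Γ q) (π : κ → ι) : Evaluable (Γ.reindex π) fun j => q (π j) :=
  h.call (fun p : Σ j, (q (π j)).G => (⟨π p.1, p.2⟩ : Σ i, (q i).G)) (fun _ => rfl)
    ((PBd.self _).mono fun _ => le_rfl) (FP.self _)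

theorem of_oracle {k : ι → ℕ} (hO : ∀ i, Γ.O i = (q i).oracle)
    (hN : PBd Γ.N fun i => (q i).size (k i)) : Evaluable Γ q := by
  have hv := FP.var Γ (fun p : Σ i, (q i).G => p.1)
    fun p => .ofPerm (p.2 : Perm (Fin (q p.1).n))
  have he : ∀ p : Σ i, (q i).G, Γ.O p.1 (.ofPerm (p.2 : Perm (Fin (q p.1).n))) =
      (q p.1).f p.2 := fun p => by
    rw [hO, Input.oracle_ofPerm, Input.ev_of_mem _ p.2.2]
    rfl
  refine (hv.oracle ?_).congr he
  refine (hN.subst (fun p : Σ i, (q i).G => p.1) ((PBd.self _).mono fun p => ?_)).mono fun p => ?_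
  · simp only [Ctx.ext_N]
    omega
  · exact (congrArg Data.size (he p)).le.trans ((q p.1).size_f_le (k p.1) p.2)

theorem cases {p : ι → Prop} (hp : FPd Γ p)
    (h₁ : Evaluable (Γ.reindex (Subtype.val : {i // p i} → ι)) fun j => q j)
    (h₂ : Evaluable (Γ.reindex (Subtype.val : {i // ¬ p i} → ι)) fun j => q j) :
    Evaluable Γ q := by
  refine (hp.weaken (fun p : Σ i, (q i).G => p.1)
    fun p => .ofPerm (p.2 : Perm (Fin (q p.1).n))).by_cases ?_ ?_
  · exact h₁.call (fun r : {r : Σ i, (q i).G // p r.1} =>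
      (⟨⟨r.1.1, r.2⟩, r.1.2⟩ : Σ i : {i // p i}, (q i).G)) (fun _ => rfl)
      ((PBd.self _).mono fun _ => le_rfl) (FP.self _)
  · exact h₂.call (fun r : {r : Σ i, (q i).G // ¬ p r.1} =>
      (⟨⟨r.1.1, r.2⟩, r.1.2⟩ : Σ i : {i // ¬ p i}, (q i).G)) (fun _ => rfl)
      ((PBd.self _).mono fun _ => le_rfl) (FP.self _)

theorem congr {q' : ι → Input} (h : Evaluable Γ q) (h' : ∀ i, q i = q' i) : Evaluable Γ q' := by
  rwa [show q' = q from funext fun i => (h' i).symm]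

theorem _root_.HSP.FP.wrFun {F₁ F₂ : ∀ i, Perm (Fin (n i)) → Data}
    {t : ∀ i, Perm (Fin (n i)) × Perm (Fin (n i)) × Fin 2} (hpos : ∀ i, 0 < n i)
    (hn : FP Γ fun i => .ofNat (n i)) (h : FP Γ fun i => .ofPerm (wr (t i)))
    (h₁ : FP Γ fun i => F₁ i (t i).1) (h₂ : FP Γ fun i => F₂ i (t i).2.1) :
    FP Γ fun i => wrFun (F₁ i) (F₂ i) (wr (t i)) :=
  ((FPd.fin_eq (hn.perm_wr_third hpos h) (FP.fin Γ 0)).ite (e := fun _ d => d) (h₁.cons h₂)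
    (h₂.cons h₁)).congr fun i => (wrFun_wr (hpos i) _ _ _).symm

theorem shiftInput {u : ∀ i, (q i).G} (h : Evaluable Γ q) (hn : FP Γ fun i => .ofNat (q i).n)
    (hu : FP Γ fun i => .ofPerm (u i : Perm (Fin (q i).n))) :
    Evaluable Γ fun i => shiftInput (q i) (u i) := by
  have hmem : ∀ p : Σ i, (HSP.shiftInput (q i) (u i)).G, ∃ t, t.1 ∈ (q p.1).G ∧
      t.2.1 ∈ (q p.1).G ∧ wr t = p.2.1 := fun p => (span_wrGens (q p.1).gens).le p.2.2
  choose t h₁ h₂ ht using hmem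
  have hv : FP (Γ.ext (fun p : Σ i, (HSP.shiftInput (q i) (u i)).G => p.1)
      fun p => .ofPerm (p.2 : Perm (Fin (HSP.shiftInput (q p.1) (u p.1)).n)))
      fun p => .ofPerm (wr (t p)) := (FP.var _ _ _).congr fun p => by rw [ht p]; rfl
  have hn' := hn.weaken (fun p : Σ i, (HSP.shiftInput (q i) (u i)).G => p.1)
    fun p => .ofPerm (p.2 : Perm (Fin (HSP.shiftInput (q p.1) (u p.1)).n))
  have hu' := hu.weaken (fun p : Σ i, (HSP.shiftInput (q i) (u i)).G => p.1)
    fun p => .ofPerm (p.2 : Perm (Fin (HSP.shiftInput (q p.1) (u p.1)).n))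
  have h' := h.weaken (fun p : Σ i, (HSP.shiftInput (q i) (u i)).G => p.1)
    fun p => .ofPerm (p.2 : Perm (Fin (HSP.shiftInput (q p.1) (u p.1)).n))
  refine FP.congr (hn'.wrFun (fun p => (q p.1).n_pos) hv (F₁ := fun p => (q p.1).ev)
    (F₂ := fun p g => (q p.1).ev (g * (u p.1 : Perm (Fin (q p.1).n))⁻¹)) ?_ ?_) fun p => ?_
  · exact h'.eval h₁ (hn'.perm_wr_fst hv)
  · exact h'.eval (fun p => (q p.1).G.mul_mem (h₂ p) ((q p.1).G.inv_mem (u p.1).2))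
      (hn'.perm_mul (hn'.perm_wr_snd hv) (hn'.perm_inv hu'))
  · exact congrArg (wrFun _ _) (ht p)

/-- The four components are read off from the permutation. Correctness of `R` guarantees that the
coordinates of the first component lie in the group, where the black box gives the values of the
function. -/
theorem searchQuery (R : StabRoutine) (hR : R.IsCorrect) (h : Evaluable Γ q)
    (hn : FP Γ fun a => .ofNat (q a).n) (i j j' k l : ∀ a, Fin (q a).n) :
    Evaluable Γ fun a => searchQuery R (q a) (i a) (j a) (j' a) (k a) (l a) := by
  let Q := fun a => HSP.searchQuery R (q a) (i a) (j a) (j' a) (k a) (l a)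
  have hmem : ∀ p : Σ a, (Q a).G, ∃ v : Fin 4 → Perm (Fin ((q p.1).n * 2)),
      (∃ t, t.1 ∈ (q p.1).G ∧ t.2.1 ∈ (q p.1).G ∧ wr t = v 0) ∧
      block v = p.2.1 := fun p => by
    obtain ⟨v, hv, he⟩ := block_mem_span.1 p.2.2
    refine ⟨v, ?_, he⟩
    have := hv 0
    simp only [Matrix.cons_val_zero, span_wrGens] at this
    obtain ⟨t, h₁, h₂, h₃⟩ := this
    rw [hR] at h₁ h₂
    exact ⟨t, h₁.1, h₂.1, h₃⟩
  choose v hv hb using hmem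
  choose t h₁ h₂ ht using hv
  let Δ := Γ.ext (fun p : Σ a, (Q a).G => p.1) fun p => .ofPerm (p.2 : Perm (Fin (Q p.1).n))
  have hn₁ : FP Δ fun p => .ofNat (q p.1).n := hn.weaken _ _
  have hn₂ : FP Δ fun p => .ofNat ((q p.1).n * 2) := hn₁.mul (FP.nat _ 2)
  have hB : FP Δ fun p => .ofPerm (block (v p)) := (FP.var _ _ _).congr fun p => by rw [hb p]; rfl
  have hc : ∀ c, FP Δ fun p => .ofPerm (v p c) := fun c => hn₂.perm_block_apply c hB
  have h₀ : FP Δ fun p => .ofPerm (wr (t p)) := (hc 0).congr fun p => by rw [ht p]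
  have h' : Evaluable Δ fun p => q p.1 := h.weaken _ _
  have hw : FP Δ fun p => wrFun (q p.1).ev (q p.1).ev (v p 0) :=
    (hn₁.wrFun (fun p => (q p.1).n_pos) h₀ (h'.eval h₁ (hn₁.perm_wr_fst h₀))
      (h'.eval h₂ (hn₁.perm_wr_snd h₀))).congr fun p => by rw [ht p]
  have hm : ∀ c, FP Δ fun p => .ofPerm (v p 0 * (v p c)⁻¹) := fun c =>
    hn₂.perm_mul (hc 0) (hn₂.perm_inv (hc c))
  refine FP.congr (hw.cons ((hm 1).cons ((hm 2).cons ((hm 3).cons (FP.nil _))))) fun p => ?_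
  refine Eq.trans ?_ (congrArg (Function.extend block (fun v => Data.ofList
    [HSP.wrFun (q p.1).ev (q p.1).ev (v 0), .ofPerm (v 0 * (v 1)⁻¹), .ofPerm (v 0 * (v 2)⁻¹),
      .ofPerm (v 0 * (v 3)⁻¹)]) fun _ => .nil) (hb p))
  rw [block_injective.extend_apply]
  rfl

end Evaluable

/-! ## The questions asked by the checkers -/

/-- The input itself, or one of its shifts. -/
def Input.base (x : Input) : Option x.G → Input
  | none => x
  | some u => shiftInput x u

/-- A query about `x`: the input itself or a shifted input, or a query of the search on it. -/
structure Question (x : Input) : Type where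
  shift : Option x.G
  indices : Option (Fin (x.base shift).n × Fin (x.base shift).n × Fin (x.base shift).n ×
    Fin (x.base shift).n × Fin (x.base shift).n)

def encIndices {n : ℕ} (c : Fin n × Fin n × Fin n × Fin n × Fin n) : Data :=
  .cons (encF c.1) (.cons (encF c.2.1) (.cons (encF c.2.2.1) (.cons (encF c.2.2.2.1)
    (encF c.2.2.2.2))))

theorem encIndices_injective {n : ℕ} : Function.Injective (encIndices (n := n)) := by
  rintro ⟨a, b, c, d, e⟩ ⟨a', b', c', d', e'⟩ h
  simpa only [encIndices, Data.cons.injEq, encF_injective.eq_iff, Prod.mk.injEq] using h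

namespace Question

variable {x : Input} (s : Question x)

def input : Input :=
  s.indices.elim (x.base s.shift) fun c =>
    searchQuery chainRoutine (x.base s.shift) c.1 c.2.1 c.2.2.1 c.2.2.2.1 c.2.2.2.2

/-- The part of the code that identifies the question for the given input. The query program needs
only this part, and the deciding program finds the answer to a question by comparing keys. -/
def key : Data :=
  .cons (.ofNat x.n) (.cons (encO (fun u : x.G => .ofPerm (u : Perm (Fin x.n))) s.shift)
    (encO encIndices s.indices))

theorem key_injective : Function.Injective (key (x := x)) := by
  rintro ⟨b, c⟩ ⟨b', c'⟩ h
  simp only [key, Data.cons.injEq, true_and] at h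
  obtain rfl := encO_injective (ofPerm_injective.comp Subtype.val_injective) h.1
  rw [encO_injective encIndices_injective h.2]

def code : Data := .cons (Input.code s.input.n s.input.gens) s.key

end Question

theorem fp_base {ι : Type} {Γ : Ctx ι} {x : ι → Input} {b : ∀ i, Option (x i).G}
    (hn : FP Γ fun i => .ofNat (x i).n)
    (hb : FP Γ fun i => encO (fun u : (x i).G => .ofPerm (u : Perm (Fin (x i).n))) (b i)) :
    FP Γ fun i => .ofNat ((x i).base (b i)).n := by
  refine (FPd.eq_nil hb).by_cases ?_ ?_
  · refine (hn.reindex _).congr fun j => ?_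
    have : b j.1 = none := by
      cases h : b j.1 with
      | none => rfl
      | some u => exact absurd j.2 (by simp [h, encO_some])
    rw [this]
    rfl
  · refine ((hn.mul (FP.nat _ 2)).reindex _).congr fun j => ?_
    cases h : b j.1 with
    | none => exact absurd (by rw [h]; rfl) j.2
    | some u => rfl

theorem Evaluable.base {ι : Type} {Γ : Ctx ι} {x : ι → Input} {b : ∀ i, Option (x i).G}
    (h : Evaluable Γ x) (hn : FP Γ fun i => .ofNat (x i).n)
    (hb : FP Γ fun i => encO (fun u : (x i).G => .ofPerm (u : Perm (Fin (x i).n))) (b i)) :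
    Evaluable Γ fun i => (x i).base (b i) := by
  refine Evaluable.cases (FPd.eq_nil hb) ?_ ?_
  · refine (h.reindex _).congr fun j => ?_
    have : b j.1 = none := by
      cases h : b j.1 with
      | none => rfl
      | some u => exact absurd j.2 (by simp [h, encO_some])
    rw [this]
    rfl
  · have : ∀ j : {i // ¬ encO (fun u : (x i).G => Data.ofPerm (u : Perm (Fin (x i).n))) (b i) =
        .nil}, ∃ u, b j.1 = some u := by
      rintro ⟨i, hi⟩
      cases h : b i with
      | none => exact absurd (by rw [h]; rfl) hi
      | some u => exact ⟨u, rfl⟩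
    choose u hu using this
    refine ((h.reindex _).shiftInput (u := u) (hn.reindex _)
      ((hb.reindex _).of_some (b := u) hu)).congr fun j => ?_
    rw [hu]
    rfl

/-- Descriptions of questions. -/
def questionCtx : Ctx (Σ p : Input × ℕ, Question p.1) where
  O p := p.1.1.oracle
  N p := p.1.1.size p.1.2 + p.2.code.size
  c p := p.2.code
  size_le _ := Nat.le_add_left _ _

/-- One program serves all questions: it reads from the key whether the input is shifted and whether
a search query is built on top, and evaluates the corresponding function. -/
theorem evaluable_question : Evaluable questionCtx fun p => p.2.input := by
  have hs := FP.self questionCtx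
  have hx : Evaluable questionCtx fun p => p.1.1 := .of_oracle (k := fun p => p.1.2)
    (fun _ => rfl) ((PBd.self _).mono fun p => Nat.le_add_right _ _)
  have hn : FP questionCtx fun p => .ofNat p.1.1.n := hs.snd.fst
  have hb : FP questionCtx fun p => encO (fun u : p.1.1.G => .ofPerm (u : Perm (Fin p.1.1.n)))
    p.2.shift := hs.snd.snd.fst
  have hi : FP questionCtx fun p => encO encIndices p.2.indices := hs.snd.snd.snd
  have hB : Evaluable questionCtx fun p => p.1.1.base p.2.shift := hx.base hn hb
  refine Evaluable.cases (FPd.eq_nil hi) ?_ ?_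
  · refine (hB.reindex _).congr fun j => ?_
    have : j.1.2.indices = none := by
      cases h : j.1.2.indices with
      | none => rfl
      | some c => exact absurd j.2 (by simp [h, encO_some])
    rw [Question.input, this]
    rfl
  · have : ∀ j : {p : Σ p : Input × ℕ, Question p.1 // ¬ encO encIndices p.2.indices = .nil},
        ∃ c, j.1.2.indices = some c := by
      rintro ⟨i, hi⟩
      cases h : i.2.indices with
      | none => exact absurd (by rw [h]; rfl) hi
      | some u => exact ⟨u, rfl⟩
    choose c hc using this
    refine ((hB.reindex _).searchQuery chainRoutine chainRoutine_isCorrect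
      ((fp_base hn hb).reindex _) (fun j => (c j).1) (fun j => (c j).2.1) (fun j => (c j).2.2.1)
      (fun j => (c j).2.2.2.1) (fun j => (c j).2.2.2.2)).congr fun j => ?_
    rw [Question.input, hc]
    rfl

end HSP

end

noncomputable section

namespace HSP

open Equiv
open scoped ENNReal

/-! ## Machines from computations in polynomial time -/

/-- The header determines degree and generators, and runs without coins determine all values. So a
written list of queries describes just one list of inputs, for which `P` is then asked. -/
theorem Machine.Describes.unique {M : Machine} {x : Input} {d : Data} {q q' : Input}
    (h : M.Describes x d q) (h' : M.Describes x d q') : q = q' := by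
  obtain ⟨n, hn, gens, f⟩ := q
  obtain ⟨n', hn', gens', f'⟩ := q'
  have hc := h.1.symm.trans h'.1
  simp only [Input.code, Data.cons.injEq] at hc
  obtain rfl := Data.ofNat_injective hc.1
  obtain rfl := encL_injective ofPerm_injective hc.2
  congr 1
  funext g
  obtain ⟨t, ht⟩ := h.2 g
  obtain ⟨t', ht'⟩ := h'.2 g
  exact (ht.unique' ht').2

theorem Data.ofList_injective : Function.Injective Data.ofList := fun l l' h =>
  encL_injective (e := id) Function.injective_id (by simpa [encL] using h)

theorem forall₂_unique {α β : Type} {r : α → β → Prop} (hr : ∀ a b b', r a b → r a b' → b = b')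
    {l : List α} {m m' : List β} (h : List.Forall₂ r l m) (h' : List.Forall₂ r l m') : m = m' := by
  induction h generalizing m' with
  | nil => cases h'; rfl
  | cons h _ ih =>
    cases h' with
    | cons h₁ h₂ => rw [hr _ _ _ h h₁, ih h₂]

abbrev DrawIx : Type := Σ p : Input × ℕ, Fin p.2 → p.1.G

/-- A permutation is never longer than a polynomial in its degree, so adding the drawn tuple to the
context costs nothing beyond a polynomial in the input. -/
theorem pBd_drawCtx : PBd (fun i : DrawIx => i.1.1.size i.1.2) drawCtx.N := by
  have h : PBd tapeCtx.N fun p => p.2 * (p.1.n * (2 * p.1.n + 1) + 1 + 1) + 1 :=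
    (Input.fp_k.pBd_ofNat.mul (Input.fp_n.pBd_perm.add (.const _ 1))).add (.const _ 1)
  have h' : PBd (fun i : DrawIx => i.1.1.size i.1.2) _ := h.subst Sigma.fst (PBd.self _)
  refine (((PBd.self _).add h').add (.const _ 1)).mono fun i => ?_
  have := size_encL_le (e := Data.ofPerm) (l := List.ofFn fun r => (i.2 r : Perm (Fin i.1.1.n)))
    (B := i.1.1.n * (2 * i.1.1.n + 1) + 1) fun b _ => size_ofPerm_le b
  rw [List.length_ofFn] at this
  exact Nat.add_le_add_right (Nat.add_le_add_left this _) _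

section machine

variable {Program : Type} (answer : Program → Input → Data)
  (qs : ∀ i : DrawIx, List (Question i.1.1))

/-- What a machine that asks the questions `qs` knows when it has received the answers. -/
def decideCtx : Ctx (DrawIx × Program) :=
  (drawCtx.ext id fun i => encL Question.code (qs i)).ext Prod.fst
    fun j => encL (fun s => answer j.2 s.input) (qs j.1)

variable {answer qs}

/-- It suffices to write the questions and to compute the verdict from the answers,
deterministically and in polynomial time, once the tuple is drawn. Law and expected time of the
machine are those of `Input.draw`. The program `P` is part of the index of the family, so one
deciding program works for all `P`. -/
theorem exists_machine {V : Program → DrawIx → Verdict}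
    (hqs : FP drawCtx fun i => encL Question.code (qs i))
    (hV : FP (decideCtx answer qs) fun j => (V j.2 j.1).code) : ∃ M : Machine,
      (∀ P x k v [Fintype (Fin k → x.G)] [DecidableEq Verdict], M.prob (answer P) x k v =
        ∑ u : Fin k → x.G, (if V P ⟨(x, k), u⟩ = v then 1 else 0) *
          (Fintype.card (Fin k → x.G) : ℝ≥0∞)⁻¹) ∧
      M.PolyTime answer ∧
      ∀ x k w t out l, M.Asks x k w t out l →
        ∃ u, x.draw k w = some u ∧ l = (qs ⟨(x, k), u⟩).map Question.input := by
  obtain ⟨pq, tq, hq, hrq⟩ := evaluable_question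
  obtain ⟨pa, ta, ha, hra⟩ := exists_prog_draw ((FP.self drawCtx).cons hqs)
  obtain ⟨pd, td, hd, hrd⟩ := hV
  let M : Machine := ⟨pa, pq, pd⟩
  have hdesc : ∀ x (s : Question x), M.Describes x s.code s.input := fun x s =>
    ⟨rfl, fun g => ⟨_, hrq ⟨⟨(x, 0), s⟩, g⟩⟩⟩
  have hask : ∀ x k w t out, Run x.oracle M.ask (x.tape k) w t out → ∃ u,
      x.draw k w = some u ∧ t ≤ ta (x, k) * (w.length + 1) ∧
      out = .cons (drawCtx.c ⟨(x, k), u⟩) (encL Question.code (qs ⟨(x, k), u⟩)) := by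
    intro x k w t out hr
    obtain ⟨h₁, h₂⟩ := hra x k w
    obtain ⟨u, hu⟩ := h₂ t out hr
    obtain ⟨t', ht', hr'⟩ := h₁ u hu
    obtain ⟨rfl, rfl⟩ := hr.unique' hr'
    exact ⟨u, hu, ht', rfl⟩
  have hasks : ∀ x k w t out l, M.Asks x k w t out l → ∃ u,
      x.draw k w = some u ∧ t ≤ ta (x, k) * (w.length + 1) ∧
      out = .cons (drawCtx.c ⟨(x, k), u⟩) (encL Question.code (qs ⟨(x, k), u⟩)) ∧
      l = (qs ⟨(x, k), u⟩).map Question.input := by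
    rintro x k w t out l ⟨hr, ds, hds, hl⟩
    obtain ⟨u, hu, ht, rfl⟩ := hask x k w t out hr
    obtain rfl : (qs ⟨(x, k), u⟩).map Question.code = ds := Data.ofList_injective hds
    refine ⟨u, hu, ht, rfl, forall₂_unique (r := M.Describes x) (fun _ _ _ h h' => Machine.Describes.unique h h') hl ?_⟩
    rw [List.forall₂_map_left_iff, List.forall₂_map_right_iff]
    exact List.forall₂_same.2 fun s _ => hdesc x s
  have hasks' : ∀ x k w u, x.draw k w = some u → ∃ t, M.Asks x k w t
      (.cons (drawCtx.c ⟨(x, k), u⟩) (encL Question.code (qs ⟨(x, k), u⟩)))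
      ((qs ⟨(x, k), u⟩).map Question.input) := by
    intro x k w u hu
    obtain ⟨t, -, hr⟩ := (hra x k w).1 u hu
    refine ⟨t, hr, _, rfl, ?_⟩
    rw [List.forall₂_map_left_iff, List.forall₂_map_right_iff]
    exact List.forall₂_same.2 fun s _ => hdesc x s
  have hdec : ∀ P x k u, Run x.oracle M.decide (.cons (.cons (drawCtx.c ⟨(x, k), u⟩)
      (encL Question.code (qs ⟨(x, k), u⟩)))
      (.ofList (((qs ⟨(x, k), u⟩).map Question.input).map (answer P)))) []
      (td (⟨(x, k), u⟩, P)) (V P ⟨(x, k), u⟩).code := by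
    intro P x k u
    rw [List.map_map]
    exact hrd (⟨(x, k), u⟩, P)
  have hcode : Function.Injective Verdict.code := by
    rintro (_ | _) (_ | _) h <;> first | rfl | cases h
  have hhalts : ∀ P x k w t v, M.Halts (answer P) x k w t v → ∃ u t₁, x.draw k w = some u ∧
      t₁ ≤ ta (x, k) * (w.length + 1) ∧ t = t₁ + td (⟨(x, k), u⟩, P) ∧ V P ⟨(x, k), u⟩ = v ∧
      ∃ out l, M.Asks x k w t₁ out l := by
    rintro P x k w _ v ⟨t₁, t₂, out, l, hA, hD, rfl⟩
    obtain ⟨u, hu, ht, rfl, rfl⟩ := hasks x k w t₁ out l hA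
    obtain ⟨rfl, h⟩ := hD.unique' (hdec P x k u)
    exact ⟨u, t₁, hu, ht, rfl, (hcode h).symm, _, _, hA⟩
  refine ⟨M, fun P x k v _ _ => ?_, ?_, fun x k w t out l h => ?_⟩
  · rw [← x.tsum_draw k fun u => if V P ⟨(x, k), u⟩ = v then 1 else 0]
    refine tsum_congr fun w => ?_
    cases hu : x.draw k w with
    | none =>
      rw [if_neg, Option.elim_none, zero_mul]
      rintro ⟨t, h⟩
      obtain ⟨u, -, hu', -⟩ := hhalts P x k w t v h
      rw [hu] at hu'
      cases hu'
    | some u =>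
      rw [Option.elim_some]
      by_cases hv : V P ⟨(x, k), u⟩ = v
      · rw [if_pos hv, one_mul, if_pos]
        obtain ⟨t, h⟩ := hasks' x k w u hu
        exact ⟨_, t, _, _, _, h, hv ▸ hdec P x k u, rfl⟩
      · rw [if_neg hv, zero_mul, if_neg]
        rintro ⟨t, h⟩
        obtain ⟨u', -, hu', -, -, hv', -⟩ := hhalts P x k w t v h
        obtain rfl : u = u' := Option.some.inj (hu.symm.trans hu')
        exact hv hv'
  · have hs := (hqs.size_pBd).subst id pBd_drawCtx
    -- The final polynomial collects `p₁` for drawing and asking per coin, `p₂` for deciding in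
    -- terms of input plus answer length, `p₃` for the expected number of coins plus one, and `p₄`
    -- for evaluating a query.
    obtain ⟨p₁, hp₁⟩ := ha
    obtain ⟨p₂, hp₂⟩ : PBd (fun r : {r : (DrawIx × Program) × ℕ //
        ∀ s ∈ qs r.1.1, (answer r.1.2 s.input).size ≤ r.2} =>
          r.1.1.1.1.1.size r.1.1.1.1.2 + r.1.2) fun r => td r.1.1 := by
      refine hd.subst (fun r : {r : (DrawIx × Program) × ℕ //
        ∀ s ∈ qs r.1.1, (answer r.1.2 s.input).size ≤ r.2} => r.1.1) ?_
      have hN : PBd (fun r : {r : (DrawIx × Program) × ℕ //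
          ∀ s ∈ qs r.1.1, (answer r.1.2 s.input).size ≤ r.2} =>
          r.1.1.1.1.1.size r.1.1.1.1.2 + r.1.2) fun r => r.1.1.1.1.1.size r.1.1.1.1.2 :=
        (PBd.self _).mono fun r => Nat.le_add_right _ _
      have h₁ := pBd_drawCtx.subst (fun r : {r : (DrawIx × Program) × ℕ //
          ∀ s ∈ qs r.1.1, (answer r.1.2 s.input).size ≤ r.2} => r.1.1.1) hN
      have h₂ := hs.subst (fun r : {r : (DrawIx × Program) × ℕ //
          ∀ s ∈ qs r.1.1, (answer r.1.2 s.input).size ≤ r.2} => r.1.1.1) hN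
      refine (((h₁.add h₂).add (.const _ 1)).add (((h₂.mul ((PBd.self _).add
        (.const _ 1))).add (.const _ 1)).add (.const _ 1))).mono fun r => ?_
      have h := size_encL_le (e := fun s : Question r.1.1.1.1.1 => answer r.1.1.2 s.input) r.2
      have h' := (length_lt_size_encL Question.code (qs r.1.1.1)).le
      have h'' := Nat.mul_le_mul h' (Nat.add_le_add_right (Nat.le_add_left r.1.2
        (r.1.1.1.1.1.size r.1.1.1.1.2)) 1)
      exact Nat.add_le_add_left (Nat.add_le_add_right (h.trans (Nat.add_le_add_right h'' 1)) 1) _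
    obtain ⟨p₃, hp₃⟩ : PBd tapeCtx.N fun p => p.2 * p.1.n * powAbove p.1.n ^ 2 + 1 := by
      have hW := Input.fp_n.powAbove.pBd_ofNat
      exact (((Input.fp_k.pBd_ofNat.mul Input.fp_n.pBd_ofNat).mul (hW.mul hW)).add
        (.const _ 1)).mono fun p => by rw [sq]
    obtain ⟨p₄, hp₄⟩ : PBd (fun r : Σ r : Σ i, {s // s ∈ qs i}, r.2.1.input.G =>
        r.1.1.1.1.size r.1.1.1.2) fun r => tq ⟨⟨r.1.1.1, r.1.2.1⟩, r.2⟩ := by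
      refine hq.subst (fun r : Σ r : Σ i, {s // s ∈ qs i}, r.2.1.input.G =>
        (⟨⟨r.1.1.1, r.1.2.1⟩, r.2⟩ : Σ p : Σ p : Input × ℕ, Question p.1, p.2.input.G)) ?_
      have h := hs.subst (fun r : Σ r : Σ i, {s // s ∈ qs i}, r.2.1.input.G => r.1.1)
        (PBd.self _)
      refine ((((PBd.self _).add h).add ((h.mul (((PBd.const _ 2).mul h).add (.const _ 1))).add
        (.const _ 1))).add (.const _ 1)).mono fun r => ?_
      have h₁ := size_le_size_encL (e := Question.code) r.1.2.2
      have h₂ : r.1.2.1.input.n ≤ r.1.2.1.code.size := by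
        simp only [Question.code, Input.code, Data.size, Data.size_ofNat]
        omega
      have h₃ := h₂.trans h₁
      have h₄ := (size_ofPerm_le (r.2 : Perm (Fin r.1.2.1.input.n))).trans (Nat.add_le_add_right
        (Nat.mul_le_mul h₃ (Nat.add_le_add_right (Nat.mul_le_mul_left 2 h₃) 1)) 1)
      exact Nat.add_le_add_right (Nat.add_le_add (Nat.add_le_add_left h₁ _) h₄) 1
    refine ⟨(p₁ + p₂) * p₃ + p₄, fun x k _ => ⟨fun P a ha => ?_, ?_⟩⟩
    · have hle : ∀ b ≤ (p₁ + p₂).eval (x.size k + a), ∀ c ≤ p₃.eval (x.size k),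
          (b : ℝ≥0∞) * c ≤ (((p₁ + p₂) * p₃ + p₄).eval (x.size k + a) : ℕ) := by
        intro b hb c hc
        rw [← Nat.cast_mul, Nat.cast_le, Polynomial.eval_add, Polynomial.eval_mul]
        exact (Nat.mul_le_mul hb (hc.trans (eval_le_eval_of_le _ (Nat.le_add_right _ _)))).trans
          (Nat.le_add_right _ _)
      refine le_trans ?_ (hle _ le_rfl _ (hp₃ (x, k)))
      refine le_trans ?_ (mul_le_mul_right (x.tsum_draw_length_le k) _)
      rw [← ENNReal.tsum_mul_left]
      -- A run with coins `w` takes at most `p₁ + p₂` times `w.length + 1`. The coins determine the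
      -- time, so the sum over runs injects into the sum over coin sequences.
      refine le_trans (ENNReal.tsum_le_tsum fun r => ?_) (ENNReal.tsum_comp_le_tsum_of_injective
        (f := fun r : {r : List Bool × ℕ // ∃ v, M.Halts (answer P) x k r.1 r.2 v} => r.1.1)
        ?_ _)
      · obtain ⟨⟨w, t⟩, v, hv⟩ := r
        obtain ⟨u, t₁, hu, ht₁, rfl, -, out, l, hA⟩ := hhalts P x k w t v hv
        simp only [hu, Option.elim_some, one_mul]
        rw [mul_comm, ← mul_assoc]
        refine mul_le_mul_left ?_ _
        have h₁ := ht₁.trans (Nat.mul_le_mul_right _ ((hp₁ (x, k)).trans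
          (eval_le_eval_of_le _ (Nat.le_add_right (x.size k) a))))
        obtain ⟨u', hu', -, -, rfl⟩ := hasks x k w t₁ out l hA
        obtain rfl : u = u' := Option.some.inj (hu.symm.trans hu')
        have h₂ := hp₂ ⟨((⟨(x, k), u⟩, P), a), fun s hs => ?_⟩
        · have : t₁ + td (⟨(x, k), u⟩, P) ≤
              (p₁ + p₂).eval (x.size k + a) * (w.length + 1) := by
            rw [Polynomial.eval_add, Nat.add_mul]
            exact Nat.add_le_add h₁ (h₂.trans (Nat.le_mul_of_pos_right _ (Nat.succ_pos _)))
          exact_mod_cast this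
        · exact ha _ _ _ _ hA _ (List.mem_map_of_mem hs)
      · rintro ⟨⟨w, t⟩, v, hv⟩ ⟨⟨w', t'⟩, v', hv'⟩ (rfl : w = w')
        obtain ⟨u, t₁, hu, -, rfl, -, out, l, hA⟩ := hhalts P x k w t v hv
        obtain ⟨u', t₁', hu', -, rfl, -, out', l', hA'⟩ := hhalts P x k w t' v' hv'
        obtain rfl : u = u' := Option.some.inj (hu.symm.trans hu')
        obtain ⟨rfl, -⟩ := hA.1.unique' hA'.1
        rfl
    · intro w t out ds hr hds d hd q hq g
      obtain ⟨u, -, -, rfl⟩ := hask x k w t out hr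
      obtain rfl : (qs ⟨(x, k), u⟩).map Question.code = ds := Data.ofList_injective hds
      obtain ⟨s, hs, rfl⟩ := List.mem_map.1 hd
      obtain rfl := hq.unique (hdesc x s)
      refine ⟨_, (hp₄ ⟨⟨⟨(x, k), u⟩, ⟨s, hs⟩⟩, g⟩).trans ?_, hrq ⟨⟨(x, k), s⟩, g⟩⟩
      simp only [Polynomial.eval_add]
      exact Nat.le_add_left _ _
  · obtain ⟨u, hu, -, -, h⟩ := hasks x k w t out l h
    exact ⟨u, hu, h⟩

end machine

end HSP

end

noncomputable section

namespace HSP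

open Equiv

/-! ## The search, in polynomial time -/

section

variable {ι κ : Type} {Γ : Ctx ι} {β : ι → Type} {e e' : ∀ i, β i → Data} {n : ι → ℕ}

theorem FPd.call {Δ : Ctx κ} {p : κ → Prop} (h : FPd Δ p) (π : ι → κ)
    (hO : ∀ i, Δ.O (π i) = Γ.O i) (hN : PBd Γ.N fun i => Δ.N (π i))
    (hc : FP Γ fun i => Δ.c (π i)) : FPd Γ fun i => p (π i) :=
  FP.call (y := fun j => .ofBool (@decide (p j) (Classical.propDecidable _))) (by
    refine FP.congr h fun j => ?_
    congr) π hO hN hc |>.congr fun i => by congr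

theorem FP.encL_zip {l : ∀ i, List (β i)} (hl : FP Γ fun i => encL (e i) (l i))
    (hl' : FP Γ fun i => encL (e' i) (l i)) :
    FP Γ fun i => encL (fun b => .cons (e i b) (e' i b)) (l i) := by
  have hv := FP.var Γ (fun p : FinIx fun i => (l i).length => p.i) fun p => encF p.b
  refine (hl.length.finRange.map (e' := fun i b => .cons (e i b) (e' i b))
    (y := fun i r => (l i)[r]) ?_).congr fun i => ?_
  · exact ((hl.weaken _ _).getElem hv fun p => p.b.2).cons
      ((hl'.weaken _ _).getElem hv fun p => p.b.2)
  · congr 1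
    exact List.ext_getElem (by simp) (by simp)

/-- Look up the answer to a question. -/
theorem FP.lookup {x : ι → Input} {l : ∀ a, List (Question (x a))}
    {A : ∀ a, Question (x a) → Data} {s : ∀ a, Question (x a)}
    (hl : FP Γ fun a => encL (fun s => .cons s.code (A a s)) (l a)) (hs : FP Γ fun a => (s a).key)
    (hm : ∀ a, s a ∈ l a) : FP Γ fun a => A a (s a) := by
  classical
  have hv := FP.var Γ (fun p : MemIx l => p.i) fun p => .cons p.b.code (A p.i p.b)
  have h := hl.find? (r := fun a s' => decide (s'.key = (s a).key))
    ((FPd.eq_data hv.fst.snd (hs.weaken _ _)).congr fun p => by simp)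
  refine (h.of_some (b := s) fun a => ?_).snd
  cases hf : (l a).find? fun s' => decide (s'.key = (s a).key) with
  | none => simpa using List.find?_eq_none.1 hf _ (hm a)
  | some s' =>
    rw [Question.key_injective (of_decide_eq_true (List.find?_some hf :) : s'.key = (s a).key)]

open Classical in
/-- The permutation with the given values. -/
def permOf {n : ℕ} (φ : Fin n → Option (Fin n)) : Option (Perm (Fin n)) :=
  if h : ∃ g : Perm (Fin n), ∀ k, φ k = some (g k) then some h.choose else none

theorem permOf_eq_some {n : ℕ} {φ : Fin n → Option (Fin n)} {g : Perm (Fin n)} :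
    permOf φ = some g ↔ ∀ k, φ k = some (g k) := by
  rw [permOf]
  split
  · rename_i h
    have hg := h.choose_spec
    constructor
    · intro h'
      rwa [← Option.some.inj h']
    · intro h'
      refine congrArg _ (Equiv.ext fun k => Option.some.inj ((hg k).symm.trans (h' k)))
  · rename_i h
    simp only [reduceCtorEq, false_iff]
    exact fun h' => h ⟨g, h'⟩

theorem exists_perm_iff {n : ℕ} {φ : Fin n → Option (Fin n)} :
    (∃ g : Perm (Fin n), ∀ k, φ k = some (g k)) ↔
      (∀ k, φ k ≠ none) ∧ ∀ k k', φ k = φ k' → k = k' := by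
  constructor
  · rintro ⟨g, hg⟩
    refine ⟨fun k => by simp [hg], fun k k' h => ?_⟩
    rw [hg, hg] at h
    exact g.injective (Option.some.inj h)
  · rintro ⟨h, h'⟩
    choose f hf using fun k => Option.ne_none_iff_exists'.1 (h k)
    refine ⟨Equiv.ofBijective f (Finite.injective_iff_bijective.1 fun k k' hk =>
      h' k k' (by rw [hf, hf, hk])), hf⟩

/-- Existence is decided without enumerating permutations: the values must be defined and pairwise
distinct, and an injective self-map of a finite set is bijective. -/
theorem FP.permOf {φ : ∀ i, Fin (n i) → Option (Fin (n i))} (hn : FP Γ fun i => .ofNat (n i))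
    (hφ : FP (Γ.ext (fun p : FinIx n => p.i) fun p => encF p.b)
      fun p => encO encF (φ p.i p.b)) : FP Γ fun i => encO .ofPerm (permOf (φ i)) := by
  have hd : FPd Γ fun i => ∃ g : Perm (Fin (n i)), ∀ k, φ i k = some (g k) := by
    refine (FPd.and (FPd.forall_fin hn (r := fun i k => ¬ encO encF (φ i k) = .nil)
      (FPd.eq_nil hφ).not) (FPd.forall_fin hn (r := fun i k => ∀ k', φ i k = φ i k' → k = k')
        (FPd.forall_fin (n := fun p : FinIx n => n p.i) (hn.weaken _ _) (r := fun p k' => φ p.i p.b = φ p.i k' → p.b = k')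
          (FPd.imp ?_ ?_)))).congr fun i => ?_
    · refine FPd.eq (fun _ => encO_injective encF_injective) (hφ.weaken _ _) ?_
      refine hφ.call (fun p : FinIx fun p : FinIx n => n p.i =>
        (⟨p.i.i, p.b, p.mem⟩ : FinIx n)) (fun _ => rfl) ?_
        (((FP.self Γ).weaken _ _).weaken _ _ |>.cons (FP.var _ _ _))
      exact (PBd.self _).mono fun p => by simp only [Ctx.ext_N]; omega
    · exact FPd.fin_eq ((FP.var _ _ _).weaken _ _) (FP.var _ _ _)
    · rw [exists_perm_iff]
      refine and_congr_left fun _ => forall_congr' fun k => not_congr ?_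
      rw [encO, encL_eq_nil, Option.toList_eq_nil_iff]
  refine hd.by_cases ?_ ((FP.nil _).congr fun j => ?_)
  · choose g hg using fun j : {i // ∃ g : Perm (Fin (n i)), ∀ k, φ i k = some (g k)} => j.2
    refine (FP.encO_some (e := fun _ => Data.ofPerm) (FP.perm (g := g) (hn.reindex _)
      (FP.of_some (e := fun _ => encF) (o := fun p : FinIx fun j : {i // ∃ g : Perm (Fin (n i)),
        ∀ k, φ i k = some (g k)} => n j.1 => φ p.i.1 p.b) ?_ fun p => hg _ _))).congr
      fun j => by rw [permOf_eq_some.2 (hg j)]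
    refine hφ.call (fun p : FinIx fun j : {i // ∃ g : Perm (Fin (n i)),
        ∀ k, φ i k = some (g k)} => n j.1 => (⟨p.i.1, p.b, p.mem⟩ : FinIx n)) (fun _ => rfl)
      ((PBd.self _).mono fun _ => le_rfl) (FP.self _)
  · rw [HSP.permOf, dif_neg j.2]
    rfl

end

section search

variable {R : StabRoutine} {P : DecisionProgram} {x : Input}

open Classical in
/-- The map that is read off from the answers for `c`. -/
def readMap (R : StabRoutine) (P : DecisionProgram) (x : Input)
    (c : Fin x.n × Fin x.n × Fin x.n) (k : Fin x.n) : Option (Fin x.n) :=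
  if k < c.1 then some k else (List.finRange x.n).find? fun l =>
    decide (c.1 ≤ l ∧ P (searchQuery R x c.1 c.2.1 c.2.2 k l) = .nontrivial)

theorem isReadOff_iff {c : Fin x.n × Fin x.n × Fin x.n} {g : Perm (Fin x.n)} :
    IsReadOff R P x c.1 c.2.1 c.2.2 g ↔ permOf (readMap R P x c) = some g ∧ g ∈ x.G ∧ g ≠ 1 := by
  rw [permOf_eq_some, IsReadOff]
  have : (∀ k, readMap R P x c k = some (g k)) ↔ (∀ k, k < c.1 → g k = k) ∧
      ∀ k, c.1 ≤ k → ((List.finRange x.n).find? fun l => by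
        classical exact decide (c.1 ≤ l ∧ P (searchQuery R x c.1 c.2.1 c.2.2 k l) =
          .nontrivial)) = some (g k) := by
    rw [← forall_and]
    refine forall_congr' fun k => ?_
    rcases lt_or_ge k c.1 with h | h
    · simp [readMap, h, eq_comm, not_le.2 h]
    · simp [readMap, h, not_lt.2 h]
  rw [this]
  tauto

open Classical in
-- The choice in `search` is harmless because `IsReadOff` determines the permutation. So the search
-- is a composition of `find?`, `permOf` and a filter, which are available in polynomial time.
theorem toList_search : (search R P x).toList = (searchTriple R P x).toList.flatMap fun c =>
    (permOf (readMap R P x c)).toList.filter fun g => decide (g ∈ x.G ∧ g ≠ 1) := by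
  cases hc : searchTriple R P x with
  | none => rw [search, hc]; rfl
  | some c =>
    rw [Option.toList_some, List.flatMap_singleton]
    cases hs : search R P x with
    | none =>
      symm
      rw [Option.toList_none, List.filter_eq_nil_iff]
      intro g hg h
      rw [search_eq_some_iff.2 ⟨c, hc, isReadOff_iff.2 ⟨Option.mem_toList.1 hg,
        of_decide_eq_true h⟩⟩] at hs
      cases hs
    | some g =>
      obtain ⟨c', hc', hg⟩ := search_eq_some_iff.1 hs
      obtain rfl := Option.some.inj (hc.symm.trans hc')
      obtain ⟨h₁, h₂⟩ := isReadOff_iff.1 hg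
      simp [h₁, h₂.1, h₂.2]

end search

section

variable {ι : Type} {Γ : Ctx ι} {q : ι → Input} {R : StabRoutine} {P : ι → DecisionProgram}

def encTriple {n : ℕ} (c : Fin n × Fin n × Fin n) : Data :=
  .cons (encF c.1) (.cons (encF c.2.1) (encF c.2.2))

abbrev Indices (n : ℕ) : Type := Fin n × Fin n × Fin n × Fin n × Fin n

/-- Whether `P` answers "nontrivial" to the query of the search with the given indices. -/
abbrev IsNontrivial (R : StabRoutine) (P : DecisionProgram) (x : Input) (c : Indices x.n) : Prop :=
  P (searchQuery R x c.1 c.2.1 c.2.2.1 c.2.2.2.1 c.2.2.2.2) = .nontrivial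

theorem FP.triples (hn : FP Γ fun a => .ofNat (q a).n) :
    FP Γ fun a => encL encTriple (triples (q a).n) :=
  (FP.encL_reverse hn.finRange).product (hn.finRange.product hn.finRange)

/-- Here `P` occurs only through its answers to the search queries, assumed decidable by `hP`; for
the machine this is supplied by looking up the received answers. -/
theorem FP.search (hn : FP Γ fun a => .ofNat (q a).n)
    (hg : FP Γ fun a => encL .ofPerm (q a).gens)
    (hP : FPd (Γ.ext (fun p : Σ a, Indices (q a).n => p.1) fun p => encIndices p.2)
      fun p => IsNontrivial R (P p.1) (q p.1) p.2) :
    FP Γ fun a => encO .ofPerm (search R (P a) (q a)) := by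
  classical
  have ht : FP Γ fun a => encO encTriple (searchTriple R (P a) (q a)) := by
    let κ := MemIx fun a => HSP.triples (q a).n
    let κ₁ := FinIx fun p : κ => (q p.i).n
    let κ₂ := FinIx fun p : κ₁ => (q p.i.i).n
    let Δ := Γ.ext (fun p : κ => p.i) fun p => encTriple p.b
    let Δ₁ := Δ.ext (fun p : κ₁ => p.i) fun p => encF p.b
    let Δ₂ := Δ₁.ext (fun p : κ₂ => p.i) fun p => encF p.b
    have hv : FP Δ fun p => encTriple p.b := FP.var _ _ _
    have hv₂ : FP Δ₂ fun p => encTriple p.i.i.b := (hv.weaken _ _).weaken _ _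
    have hk : FP Δ₂ fun p => encF p.i.b := (FP.var Δ _ _).weaken _ _
    have hl : FP Δ₂ fun p => encF p.b := FP.var _ _ _
    have hs : FP Δ₂ fun p => Γ.c p.i.i.i := (((FP.self Γ).weaken _ _).weaken _ _).weaken _ _
    have hN : FPd Δ₂ fun p => IsNontrivial R (P p.i.i.i) (q p.i.i.i)
        (p.i.i.b.1, p.i.i.b.2.1, p.i.i.b.2.2, p.i.b, p.b) := by
      have hc := hs.cons (hv₂.fst.cons (hv₂.snd.fst.cons (hv₂.snd.snd.cons (hk.cons hl))))
      refine hP.call (fun p : κ₂ => (⟨p.i.i.i, (p.i.i.b.1, p.i.i.b.2.1, p.i.i.b.2.2, p.i.b, p.b)⟩ :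
        Σ a, Indices (q a).n)) (fun _ => rfl) ?_ hc
      refine ((PBd.self _).add hc.size_pBd).mono fun p => ?_
      simp only [Ctx.ext_N, Data.size, encIndices, Δ₂, Δ₁, Δ]
      omega
    refine (FP.triples hn).find? (FPd.congr (p := fun p : κ =>
      p.b.1 < p.b.2.1 ∧ p.b.1 < p.b.2.2 ∧ ∃ k l, p.b.1 ≤ k ∧ p.b.1 ≤ l ∧
        IsNontrivial R (P p.i) (q p.i) (p.b.1, p.b.2.1, p.b.2.2, k, l)) ?_ fun p => ?_)
    · refine (FPd.fin_lt hv.fst hv.snd.fst).and ((FPd.fin_lt hv.fst hv.snd.snd).and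
        (FPd.exists_fin (n := fun p : κ => (q p.i).n) (hn.weaken _ _)
          (FPd.exists_fin (n := fun p : κ₁ => (q p.i.i).n) ((hn.weaken _ _).weaken _ _)
            ((FPd.fin_le hv₂.fst hk).and ((FPd.fin_le hv₂.fst hl).and hN)))))
    · simp only [decide_eq_true_eq]
  let κ := MemIx fun a => (searchTriple R (P a) (q a)).toList
  let Δ := Γ.ext (fun p : κ => p.i) fun p => encTriple p.b
  have hv : FP Δ fun p => encTriple p.b := FP.var _ _ _
  have hn' : FP Δ fun p => .ofNat (q p.i).n := hn.weaken _ _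
  have hφ : FP Δ fun p => encO .ofPerm (HSP.permOf (readMap R (P p.i) (q p.i) p.b)) := by
    let κ₁ := FinIx fun p : κ => (q p.i).n
    let κ₂ := FinIx fun p : κ₁ => (q p.i.i).n
    let Δ₁ := Δ.ext (fun p : κ₁ => p.i) fun p => encF p.b
    let Δ₂ := Δ₁.ext (fun p : κ₂ => p.i) fun p => encF p.b
    have hv₁ : FP Δ₁ fun p => encTriple p.i.b := hv.weaken _ _
    have hv₂ : FP Δ₂ fun p => encTriple p.i.i.b := hv₁.weaken _ _
    have hk₁ : FP Δ₁ fun p => encF p.b := FP.var _ _ _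
    have hk : FP Δ₂ fun p => encF p.i.b := hk₁.weaken _ _
    have hl : FP Δ₂ fun p => encF p.b := FP.var _ _ _
    have hs : FP Δ₂ fun p => Γ.c p.i.i.i := (((FP.self Γ).weaken _ _).weaken _ _).weaken _ _
    have hN : FPd Δ₂ fun p => IsNontrivial R (P p.i.i.i) (q p.i.i.i)
        (p.i.i.b.1, p.i.i.b.2.1, p.i.i.b.2.2, p.i.b, p.b) := by
      have hc := hs.cons (hv₂.fst.cons (hv₂.snd.fst.cons (hv₂.snd.snd.cons (hk.cons hl))))
      refine hP.call (fun p : κ₂ => (⟨p.i.i.i, (p.i.i.b.1, p.i.i.b.2.1, p.i.i.b.2.2, p.i.b, p.b)⟩ :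
        Σ a, Indices (q a).n)) (fun _ => rfl) ?_ hc
      refine ((PBd.self _).add hc.size_pBd).mono fun p => ?_
      simp only [Ctx.ext_N, Data.size, encIndices, Δ₂, Δ₁, Δ]
      omega
    refine FP.permOf (n := fun p : κ => (q p.i).n) hn' ?_
    refine (FPd.fin_lt hk₁ hv₁.fst).ite (e := fun _ => encO encF) (FP.encO_some hk₁) ?_
    refine FP.find? (FP.finRange (hn'.weaken _ _)) (FPd.congr (p := fun p : κ₂ =>
      p.i.i.b.1 ≤ p.b ∧ IsNontrivial R (P p.i.i.i) (q p.i.i.i)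
        (p.i.i.b.1, p.i.i.b.2.1, p.i.i.b.2.2, p.i.b, p.b)) ((FPd.fin_le hv₂.fst hl).and hN)
        fun p => ?_)
    simp only [decide_eq_true_eq]
  refine FP.congr (ht.flatMap (e' := fun _ => Data.ofPerm) (y := fun a c =>
    (HSP.permOf (readMap R (P a) (q a) c)).toList.filter fun g => decide (g ∈ (q a).G ∧ g ≠ 1))
      (FP.filter (e := fun _ => Data.ofPerm) hφ ?_)) fun a => ?_
  · let κ₁ := MemIx fun p : κ => (HSP.permOf (readMap R (P p.i) (q p.i) p.b)).toList
    have hw : FP (Δ.ext (fun p : κ₁ => p.i) fun p => .ofPerm p.b) fun p => .ofPerm p.b :=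
      FP.var _ _ _
    refine FPd.congr (p := fun p : κ₁ => p.b ∈ span (q p.i.i).gens ∧ ¬ p.b = 1)
      ((FPd.mem_span (hn'.weaken _ _) ((hg.weaken _ _).weaken _ _) hw).and
        (FPd.perm_eq hw (hn'.weaken _ _).perm_one).not) fun p => ?_
    simp only [decide_eq_true_eq]
    rfl
  · rw [encO, toList_search]

end

end HSP

end

noncomputable section

namespace HSP

open Equiv

/-! ## Writing down the queries -/

namespace FP

variable {ι : Type} {Γ : Ctx ι} {n : ι → ℕ}

theorem wrGens {l : ∀ i, List (Perm (Fin (n i)))} (hn : FP Γ fun i => .ofNat (n i))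
    (hl : FP Γ fun i => encL .ofPerm (l i)) : FP Γ fun i => encL .ofPerm (wrGens (l i)) := by
  refine encL_append (e := fun _ => Data.ofPerm) (hl.map (e' := fun _ => Data.ofPerm) ?_)
    ((perm_wr hn hn.perm_one hn.perm_one (FP.fin Γ 1)).cons (nil Γ))
  exact perm_wr (t := fun p : MemIx l => (p.b, 1, 0)) (hn.weaken _ _) (var _ _ _)
    (hn.weaken _ _).perm_one (FP.fin _ 0)

theorem setStabGens {a b : ∀ i, Fin (n i)} (hn : FP Γ fun i => .ofNat (n i))
    (ha : FP Γ fun i => encF (a i)) (hb : FP Γ fun i => encF (b i)) :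
    FP Γ fun i => encL .ofPerm (setStabGens (a i) (b i)) := by
  have hl := hn.finRange.product hn.finRange
  have hv := var Γ (fun p : MemIx fun i => List.finRange (n i) ×ˢ List.finRange (n i) => p.i)
    fun p => .cons (encF p.b.1) (encF p.b.2)
  have hf := hl.filter (r := fun i c =>
    decide (c.1 = a i ∨ c.1 = b i) == decide (c.2 = a i ∨ c.2 = b i))
    (FPd.congr ((FPd.iff ((FPd.fin_eq hv.fst (ha.weaken _ _)).or (FPd.fin_eq hv.fst (hb.weaken _ _)))
      ((FPd.fin_eq hv.snd (ha.weaken _ _)).or (FPd.fin_eq hv.snd (hb.weaken _ _))))) fun p => by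
        rw [beq_iff_eq, decide_eq_decide])
  refine hf.map (e' := fun _ => Data.ofPerm) (y := fun i c => swap c.1 c.2) ?_
  have hw := var Γ (fun p : MemIx fun i => (List.finRange (n i) ×ˢ List.finRange (n i)).filter
    fun c => decide (c.1 = a i ∨ c.1 = b i) == decide (c.2 = a i ∨ c.2 = b i) => p.i)
    fun p => .cons (encF p.b.1) (encF p.b.2)
  exact perm_swap (hn.weaken _ _) hw.fst hw.snd

theorem blockSingle {l : ∀ i, List (Perm (Fin (n i)))} (c : Fin 4)
    (hn : FP Γ fun i => .ofNat (n i)) (hl : FP Γ fun i => encL .ofPerm (l i)) :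
    FP Γ fun i => encL .ofPerm ((l i).map fun s => block (Pi.mulSingle c s)) := by
  refine hl.map (e' := fun _ => Data.ofPerm) (y := fun _ s => block (Pi.mulSingle c s)) ?_
  refine perm_block (n := fun p : MemIx l => n p.i) (v := fun p => Pi.mulSingle c p.b)
    (hn.weaken _ _) ?_
  refine FP.congr ((FPd.fin_eq (x := fun p : MemIx l × Fin 4 => p.2) (x' := fun _ => c)
    (var _ _ _) (FP.fin _ c)).ite (e := fun _ => Data.ofPerm) (a := fun p => p.1.b)
    (b := fun p => 1) ((var _ _ _).weaken _ _) (perm_one ((hn.weaken _ _).weaken _ _)))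
    fun p => ?_
  rw [Pi.mulSingle_apply]

theorem searchQuery_code {q : ι → Input} {c : ∀ a, Indices (q a).n}
    (hn : FP Γ fun a => .ofNat (q a).n) (hg : FP Γ fun a => encL .ofPerm (q a).gens)
    (hc : FP Γ fun a => encIndices (c a)) : FP Γ fun a => Input.code
      (searchQuery chainRoutine (q a) (c a).1 (c a).2.1 (c a).2.2.1 (c a).2.2.2.1 (c a).2.2.2.2).n
      (searchQuery chainRoutine (q a) (c a).1 (c a).2.1 (c a).2.2.1 (c a).2.2.2.1
        (c a).2.2.2.2).gens := by
  have h2 : FP Γ fun a => .ofNat ((q a).n * 2) := hn.mul (nat _ 2)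
  have hp : ∀ {y : ∀ a, Fin (q a).n} (j : Fin 2), FP Γ (fun a => encF (y a)) →
      FP Γ fun a => encF (point (y a) j) := fun j hy => finProd (nat _ 2) hy (FP.fin _ j)
  have h : FP Γ fun a => encL .ofPerm (HSP.wrGens (chainRoutine (q a).n (q a).gens (c a).1)) :=
    wrGens hn (level hn (chain hn hg) hc.fst)
  exact ((nat _ 4).mul h2).cons (encL_append (e := fun _ => Data.ofPerm) (encL_append
    (e := fun _ => Data.ofPerm) (encL_append (e := fun _ => Data.ofPerm)
    (blockSingle 0 h2 h) (blockSingle 1 h2 (setStabGens h2 (hp 0 hc.fst) (hp 1 hc.snd.fst))))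
    (blockSingle 2 h2 (setStabGens h2 (hp 1 hc.fst) (hp 0 hc.snd.snd.fst))))
    (blockSingle 3 h2 (setStabGens h2 (hp 0 hc.snd.snd.snd.fst) (hp 1 hc.snd.snd.snd.snd))))

end FP

theorem fp_base_gens {ι : Type} {Γ : Ctx ι} {x : ι → Input} {b : ∀ i, Option (x i).G}
    (hn : FP Γ fun i => .ofNat (x i).n) (hg : FP Γ fun i => encL .ofPerm (x i).gens)
    (hb : FP Γ fun i => encO (fun u : (x i).G => .ofPerm (u : Perm (Fin (x i).n))) (b i)) :
    FP Γ fun i => encL .ofPerm ((x i).base (b i)).gens := by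
  refine (FPd.eq_nil hb).by_cases ?_ ?_
  · refine (hg.reindex _).congr fun j => ?_
    have : b j.1 = none := by
      cases h : b j.1 with
      | none => rfl
      | some u => exact absurd j.2 (by simp [h, encO_some])
    rw [this]
    rfl
  · refine ((hn.wrGens hg).reindex _).congr fun j => ?_
    cases h : b j.1 with
    | none => exact absurd (by rw [h]; rfl) j.2
    | some u => rfl

section

variable {ι : Type} {Γ : Ctx ι} {x : ι → Input} {b : ∀ i, Option (x i).G}

def allIndices (n : ℕ) : List (Indices n) :=
  List.finRange n ×ˢ (List.finRange n ×ˢ (List.finRange n ×ˢ (List.finRange n ×ˢ List.finRange n)))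

theorem mem_allIndices {n : ℕ} (c : Indices n) : c ∈ allIndices n := by
  have h := List.mem_finRange (n := n)
  exact List.pair_mem_product.2 ⟨h _, List.pair_mem_product.2 ⟨h _, List.pair_mem_product.2
    ⟨h _, List.pair_mem_product.2 ⟨h _, h _⟩⟩⟩⟩

/-- The questions of the search. -/
def searchQuestions (x : Input) (b : Option x.G) : List (Question x) :=
  (allIndices (x.base b).n).map fun c => ⟨b, some c⟩

theorem FP.direct_code (hn : FP Γ fun i => .ofNat (x i).n)
    (hg : FP Γ fun i => encL .ofPerm (x i).gens)
    (hb : FP Γ fun i => encO (fun u : (x i).G => .ofPerm (u : Perm (Fin (x i).n))) (b i)) :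
    FP Γ fun i => Question.code (x := x i) ⟨b i, none⟩ :=
  ((fp_base hn hb).cons (fp_base_gens hn hg hb)).cons (hn.cons (hb.cons (FP.nil _)))

theorem FP.searchQuestions (hn : FP Γ fun i => .ofNat (x i).n)
    (hg : FP Γ fun i => encL .ofPerm (x i).gens)
    (hb : FP Γ fun i => encO (fun u : (x i).G => .ofPerm (u : Perm (Fin (x i).n))) (b i)) :
    FP Γ fun i => encL Question.code (searchQuestions (x i) (b i)) := by
  have hB := fp_base hn hb
  have hl : FP Γ fun i => encL encIndices (allIndices ((x i).base (b i)).n) :=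
    hB.finRange.product (hB.finRange.product (hB.finRange.product
      (hB.finRange.product hB.finRange)))
  refine hl.map (e' := fun _ => Question.code) (y := fun i c => ⟨b i, some c⟩) ?_
  let κ := MemIx fun i => allIndices ((x i).base (b i)).n
  have hv := FP.var Γ (fun p : κ => p.i) fun p => encIndices p.b
  exact (FP.searchQuery_code (q := fun p : κ => (x p.i).base (b p.i)) (hB.weaken _ _)
    ((fp_base_gens hn hg hb).weaken _ _) hv).cons ((hn.weaken _ _).cons ((hb.weaken _ _).cons
      (FP.encO_some (e := fun p : κ => encIndices) hv)))

end

/-- The questions of the checker for the decision version. -/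
def decisionQuestions (i : DrawIx) : List (Question i.1.1) :=
  ⟨none, none⟩ :: (none :: (List.ofFn i.2).map some).flatMap (searchQuestions i.1.1)

/-- The questions of the checker for generators. -/
def generatorQuestions (i : DrawIx) : List (Question i.1.1) :=
  ⟨none, none⟩ :: (List.ofFn i.2).map fun u => ⟨some u, none⟩

theorem fp_draw_n : FP drawCtx fun i => .ofNat i.1.1.n := Input.fp_n.weaken _ _

theorem fp_draw_gens : FP drawCtx fun i => encL .ofPerm i.1.1.gens := Input.fp_gens.weaken _ _

theorem fp_draw : FP drawCtx fun i =>
    encL (fun u : i.1.1.G => .ofPerm (u : Perm (Fin i.1.1.n))) (List.ofFn i.2) := by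
  refine (FP.var tapeCtx Sigma.fst fun p : DrawIx =>
    encL .ofPerm (List.ofFn fun r => (p.2 r : Perm (Fin p.1.1.n)))).congr fun i => ?_
  rw [← encL_map Data.ofPerm (fun u : i.1.1.G => (u : Perm (Fin i.1.1.n))), List.map_ofFn]
  rfl

/-- The branch taken depends on the answer for the input itself. To stay nonadaptive, the questions
of the search on the input and on all its shifts are written down in any case. -/
theorem fp_decisionQuestions : FP drawCtx fun i => encL Question.code (decisionQuestions i) := by
  have hb : FP drawCtx fun i => encL (encO fun u : i.1.1.G => .ofPerm (u : Perm (Fin i.1.1.n)))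
      (none :: (List.ofFn i.2).map some) := by
    have hs : FP drawCtx fun i => encL (encO fun u : i.1.1.G => .ofPerm (u : Perm (Fin i.1.1.n)))
        ((List.ofFn i.2).map some) := fp_draw.map
      (e' := fun i => encO fun u : i.1.1.G => .ofPerm (u : Perm (Fin i.1.1.n)))
      (FP.encO_some (e := fun p : MemIx fun i : DrawIx => List.ofFn i.2 =>
        fun u : p.i.1.1.G => .ofPerm (u : Perm (Fin p.i.1.1.n))) (FP.var _ _ _))
    exact (FP.nil _).cons hs
  refine (fp_draw_n.direct_code fp_draw_gens (FP.nil _)).cons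
    (hb.flatMap (e' := fun _ => Question.code) ?_)
  exact (fp_draw_n.weaken _ _).searchQuestions (fp_draw_gens.weaken _ _) (FP.var _ _ _)

theorem fp_generatorQuestions :
    FP drawCtx fun i => encL Question.code (generatorQuestions i) := by
  refine (fp_draw_n.direct_code fp_draw_gens (FP.nil _)).cons
    (fp_draw.map (e' := fun _ => Question.code) ?_)
  exact (fp_draw_n.weaken _ _).direct_code (fp_draw_gens.weaken _ _)
    (FP.encO_some (e := fun p : MemIx fun i : DrawIx => List.ofFn i.2 =>
      fun u : p.i.1.1.G => .ofPerm (u : Perm (Fin p.i.1.1.n))) (FP.var _ _ _))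

end HSP

end

noncomputable section

namespace HSP

open Equiv
open scoped ENNReal

/-! ## The machine for the decision version -/

theorem FP.ev {ι : Type} {Γ : Ctx ι} {x : ι → Input} {k : ι → ℕ} {g : ∀ i, Perm (Fin (x i).n)}
    (hO : ∀ i, Γ.O i = (x i).oracle) (hN : PBd Γ.N fun i => (x i).size (k i))
    (hg : FP Γ fun i => .ofPerm (g i)) : FP Γ fun i => (x i).ev (g i) := by
  have he : ∀ i, Γ.O i (.ofPerm (g i)) = (x i).ev (g i) := fun i => by
    rw [hO, Input.oracle_ofPerm]
  refine (hg.oracle ((hN.add (.const _ 1)).mono fun i => ?_)).congr he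
  exact (congrArg Data.size (he i)).le.trans ((x i).size_ev_le _ _)

theorem FPd.verdict {ι : Type} {Γ : Ctx ι} {v : ι → Verdict} (h : FPd Γ fun i => v i = .correct) :
    FP Γ fun i => (v i).code :=
  FP.congr h fun i => by
    cases h : v i <;> simp [h, Verdict.code]

theorem PBd.weaken {ι κ : Type} {Γ : Ctx ι} {b : ι → ℕ} (h : PBd Γ.N b) (π : κ → ι)
    (e : κ → Data) : PBd (Γ.ext π e).N fun j => b (π j) :=
  h.subst π ((PBd.self _).mono fun j => by simp only [Ctx.ext_N]; omega)

section decideCtx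

variable {Program : Type} {answer : Program → Input → Data}
  {qs : ∀ i : DrawIx, List (Question i.1.1)}

theorem fp_decide_weaken {y : DrawIx → Data} (h : FP drawCtx y) :
    FP (decideCtx answer qs) fun j => y j.1 :=
  (h.weaken id _).weaken Prod.fst _

theorem fp_decide_questions : FP (decideCtx answer qs) fun j =>
    encL (fun s => .cons s.code (answer j.2 s.input)) (qs j.1) :=
  FP.encL_zip (Γ := decideCtx answer qs) (e := fun _ => Question.code)
    (e' := fun j s => answer j.2 s.input) (l := fun j => qs j.1)
    ((FP.var drawCtx id _).weaken Prod.fst _) (FP.var _ _ _)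

theorem pBd_decide_size : PBd (decideCtx answer qs).N fun j => j.1.1.1.size j.1.1.2 := by
  refine (PBd.self _).mono fun j => ?_
  simp only [decideCtx, drawCtx, Ctx.ext_N, tapeCtx_N, id]
  omega

end decideCtx

theorem checkDecision_eq_correct_iff {R : StabRoutine} {P : DecisionProgram} {x : Input} {k : ℕ}
    {u : Fin k → x.G} : checkDecision R P x u = .correct ↔
      (P x = .nontrivial ∧ ∃ h ∈ (search R P x).toList, x.ev h = x.ev 1) ∨
      (¬ P x = .nontrivial ∧ ∀ v ∈ List.ofFn u, search R P (shiftInput x v) =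
        some (wr ((v : Perm (Fin x.n))⁻¹, (v : Perm (Fin x.n)), 1))) := by
  rw [checkDecision]
  cases hP : P x with
  | nontrivial =>
    cases hs : search R P x with
    | none => simp
    | some h => simp
  | trivial => simp

theorem Answer.code_eq_nil {a : Answer} : a.code = .nil ↔ ¬ a = .nontrivial := by
  cases a <;> simp [Answer.code, Data.ofBool]

abbrev decisionAnswer (P : DecisionProgram) (q : Input) : Data := (P q).code

/-- All index tuples have been asked for each base `none` or `some u` with `u` drawn, so every
answer that the search consults is in the table. -/
theorem fp_search_base {κ : Type} {Γ : Ctx κ} {π : κ → DrawIx × DecisionProgram}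
    {b : ∀ j, Option (π j).1.1.1.G} (hn : FP Γ fun j => .ofNat (π j).1.1.1.n)
    (hg : FP Γ fun j => encL .ofPerm (π j).1.1.1.gens)
    (hz : FP Γ fun j => encL (fun s => .cons s.code (decisionAnswer (π j).2 s.input))
      (decisionQuestions (π j).1))
    (hb : FP Γ fun j => encO (fun u : (π j).1.1.1.G => .ofPerm (u : Perm (Fin (π j).1.1.1.n))) (b j))
    (hm : ∀ j, b j ∈ none :: (List.ofFn (π j).1.2).map some) :
    FP Γ fun j => encO .ofPerm (search chainRoutine (π j).2 ((π j).1.1.1.base (b j))) := by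
  refine FP.search (q := fun j => (π j).1.1.1.base (b j)) (P := fun j => (π j).2)
    (fp_base hn hb) (fp_base_gens hn hg hb) ?_
  let κ₁ := Σ j, Indices ((π j).1.1.1.base (b j)).n
  have hi := FP.encO_some (e := fun p : κ₁ => encIndices)
    (FP.var Γ (fun p : κ₁ => p.1) fun p => encIndices p.2)
  have h := FP.lookup (s := fun p : κ₁ => ⟨b p.1, some p.2⟩)
    (A := fun p s => decisionAnswer (π p.1).2 s.input)
    (hz.weaken (fun p : κ₁ => p.1) fun p => encIndices p.2)
    ((hn.weaken _ _).cons ((hb.weaken _ _).cons hi)) fun p => List.mem_cons_of_mem _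
      (List.mem_flatMap.2 ⟨b p.1, hm p.1, List.mem_map_of_mem (mem_allIndices p.2)⟩)
  refine (FPd.eq_nil h).not.congr fun p => ?_
  rw [Answer.code_eq_nil, not_not]
  rfl

theorem fp_checkDecision : FP (decideCtx decisionAnswer decisionQuestions) fun j =>
    (checkDecision chainRoutine j.2 j.1.1.1 j.1.2).code := by
  let Δ := decideCtx decisionAnswer decisionQuestions
  have hn : FP Δ fun j => .ofNat j.1.1.1.n := fp_decide_weaken fp_draw_n
  have hg : FP Δ fun j => encL .ofPerm j.1.1.1.gens := fp_decide_weaken fp_draw_gens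
  have hu : FP Δ fun j => encL (fun u : j.1.1.1.G => .ofPerm (u : Perm (Fin j.1.1.1.n)))
    (List.ofFn j.1.2) := fp_decide_weaken fp_draw
  have hz : FP Δ fun j => encL (fun s => .cons s.code (decisionAnswer j.2 s.input))
    (decisionQuestions j.1) := fp_decide_questions
  have hd : FPd Δ fun j => j.2 j.1.1.1 = .nontrivial := by
    refine (FPd.eq_nil (FP.lookup (s := fun j => ⟨none, none⟩)
      (A := fun j s => decisionAnswer j.2 s.input) hz (hn.cons ((FP.nil _).cons (FP.nil _)))
      fun j => List.mem_cons_self)).not.congr fun j => ?_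
    rw [Answer.code_eq_nil, not_not]
    rfl
  have hs : FP Δ fun j => encO .ofPerm (search chainRoutine j.2 j.1.1.1) :=
    fp_search_base (π := id) (b := fun j => none) hn hg hz (FP.nil _) fun j => List.mem_cons_self
  refine FPd.verdict (FPd.congr (((hd.and ?_).or (hd.not.and ?_))) fun j =>
    checkDecision_eq_correct_iff.symm)
  · refine FPd.exists_mem (e := fun _ => Data.ofPerm) hs ?_
    let κ := MemIx fun j : DrawIx × DecisionProgram =>
      (search chainRoutine j.2 j.1.1.1).toList
    have hN := pBd_decide_size.weaken (Γ := Δ) (fun p : κ => p.i) fun p => .ofPerm p.b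
    exact FPd.eq_data
      (FP.ev (x := fun p : κ => p.i.1.1.1) (k := fun p => p.i.1.1.2) (g := fun p => p.b)
        (fun _ => rfl) hN (FP.var _ _ _))
      (FP.ev (x := fun p : κ => p.i.1.1.1) (k := fun p => p.i.1.1.2) (g := fun p => 1)
        (fun _ => rfl) hN (hn.weaken _ _).perm_one)
  · refine FPd.forall_mem hu ?_
    let κ := MemIx fun j : DrawIx × DecisionProgram => List.ofFn j.1.2
    have hv := FP.var Δ (fun p : κ => p.i) fun p => .ofPerm (p.b : Perm (Fin p.i.1.1.1.n))
    have hn' := hn.weaken (fun p : κ => p.i) fun p => .ofPerm (p.b : Perm (Fin p.i.1.1.1.n))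
    refine FPd.eq (e := fun _ => encO Data.ofPerm) (fun p => encO_injective ofPerm_injective)
      (fp_search_base (π := fun p : κ => p.i) (b := fun p => some p.b) hn' (hg.weaken _ _)
        (hz.weaken _ _) (FP.encO_some (e := fun p : κ => fun u : p.i.1.1.1.G =>
          .ofPerm (u : Perm (Fin p.i.1.1.1.n))) hv) fun p => List.mem_cons_of_mem _
            (List.mem_map_of_mem p.mem)) ?_
    exact FP.encO_some (e := fun _ => Data.ofPerm)
      (FP.perm_wr hn' (hn'.perm_inv hv) hv (FP.fin _ 1))

theorem exists_decisionMachine : ∃ M : Machine,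
    M.Implements (fun (P : DecisionProgram) q => (P q).code) (decisionChecker chainRoutine) ∧
    M.PolyTime (fun (P : DecisionProgram) q => (P q).code) := by
  classical
  obtain ⟨M, hM, hT, -⟩ := exists_machine (V := fun P i => checkDecision chainRoutine P i.1.1 i.2)
    fp_decisionQuestions fp_checkDecision
  refine ⟨M, fun P x k _ v => (hM P x k v).trans ?_, hT⟩
  rw [decisionChecker, map_uniform_apply]

end HSP

end

noncomputable section

namespace HSP

open Equiv
open scoped ENNReal

/-! ## The machine for generators -/

/-- An element of `Sₙ ≀ ℤ/2` is recognized by its action on the two copies: the copy of the image of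
`(i, j)` is `τ + j` for one fixed `τ`. The two injective maps on first coordinates are then
bijections and recover the permutations. -/
theorem exists_wr_eq_iff {n : ℕ} {g : Perm (Fin (n * 2))} : (∃ t, wr t = g) ↔
    ∃ τ : Fin 2, ∀ (i : Fin n) (j : Fin 2),
      (finProdFinEquiv.symm (g (finProdFinEquiv (i, j)))).2 = τ ↔ j = 0 := by
  have h2 : ∀ a τ j : Fin 2, (a = τ ↔ j = 0) ↔ a = τ + j := by decide
  constructor
  · rintro ⟨t, rfl⟩
    refine ⟨t.2.2, fun i j => ?_⟩
    rw [FP.wr_apply, symm_apply_apply, h2]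
  · rintro ⟨τ, h⟩
    simp only [h2] at h
    have hg : ∀ i j, g (finProdFinEquiv (i, j)) = finProdFinEquiv
        ((finProdFinEquiv.symm (g (finProdFinEquiv (i, j)))).1, τ + j) := fun i j => by
      rw [← h i j, Prod.mk.eta, apply_symm_apply]
    have hinj : ∀ j, Function.Injective fun i : Fin n =>
        (finProdFinEquiv.symm (g (finProdFinEquiv (i, j)))).1 := fun j i i' hi => by
      have : g (finProdFinEquiv (i, j)) = g (finProdFinEquiv (i', j)) := by
        rw [hg i, hg i']
        exact congrArg (fun a => finProdFinEquiv (a, τ + j)) hi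
      simpa using this
    refine ⟨(ofBijective _ (Finite.injective_iff_bijective.1 (hinj 0)),
      ofBijective _ (Finite.injective_iff_bijective.1 (hinj 1)), τ), Equiv.ext fun x => ?_⟩
    obtain ⟨⟨i, j⟩, rfl⟩ := finProdFinEquiv.surjective x
    rw [FP.wr_apply, hg]
    rcases eq_zero_or_one j with rfl | rfl <;> rfl

def encTwisted {n : ℕ} (t : Perm (Fin n) × Perm (Fin n) × Fin 2) : Data :=
  .cons (.ofPerm t.1) (.cons (.ofPerm t.2.1) (encF t.2.2))

section

variable {ι : Type} {Γ : Ctx ι} {n : ι → ℕ}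

theorem FPd.exists_wr {g : ∀ i, Perm (Fin (n i * 2))} (hn : FP Γ fun i => .ofNat (n i))
    (hg : FP Γ fun i => .ofPerm (g i)) : FPd Γ fun i => ∃ t, wr t = g i := by
  refine FPd.congr (FPd.exists_fin (n := fun _ => 2) (FP.nat _ 2) (r := fun i τ =>
    ∀ (a : Fin (n i)) (j : Fin 2),
      (finProdFinEquiv.symm (g i (finProdFinEquiv (a, j)))).2 = τ ↔ j = 0) ?_)
      fun i => exists_wr_eq_iff.symm
  let κ := FinIx fun _ : ι => 2
  let κ₁ := FinIx fun p : κ => n p.i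
  let κ₂ := FinIx fun _ : κ₁ => 2
  refine FPd.forall_fin (n := fun p : κ => n p.i) (hn.weaken _ _)
    (FPd.forall_fin (n := fun _ : κ₁ => 2) (FP.nat _ 2) ?_)
  have hτ := ((FP.var Γ (fun p : κ => p.i) fun p => encF p.b).weaken (fun p : κ₁ => p.i)
    fun p => encF p.b).weaken (fun p : κ₂ => p.i) fun p => encF p.b
  have hj := FP.var ((Γ.ext (fun p : κ => p.i) fun p => encF p.b).ext (fun p : κ₁ => p.i)
    fun p => encF p.b) (fun p : κ₂ => p.i) fun p => encF p.b
  have ha := (FP.var (Γ.ext (fun p : κ => p.i) fun p => encF p.b) (fun p : κ₁ => p.i)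
    fun p => encF p.b).weaken (fun p : κ₂ => p.i) fun p => encF p.b
  have hg' := ((hg.weaken (fun p : κ => p.i) fun p => encF p.b).weaken (fun p : κ₁ => p.i)
    fun p => encF p.b).weaken (fun p : κ₂ => p.i) fun p => encF p.b
  have hn' := ((hn.weaken (fun p : κ => p.i) fun p => encF p.b).weaken (fun p : κ₁ => p.i)
    fun p => encF p.b).weaken (fun p : κ₂ => p.i) fun p => encF p.b
  exact (FPd.fin_eq (FP.finProd_symm hn' (FP.nat _ 2)
    (hg'.apply (FP.finProd (FP.nat _ 2) ha hj))).snd hτ).iff (FPd.fin_eq hj (FP.fin _ 0))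

theorem FPd.span_le {l l' : ∀ i, List (Perm (Fin (n i)))} (hn : FP Γ fun i => .ofNat (n i))
    (hl : FP Γ fun i => encL .ofPerm (l i)) (hl' : FP Γ fun i => encL .ofPerm (l' i)) :
    FPd Γ fun i => span (l i) ≤ span (l' i) := by
  refine (FPd.forall_mem (r := fun i g => g ∈ span (l' i)) hl ?_).congr fun i =>
    HSP.span_le.symm
  exact FPd.mem_span (n := fun p : MemIx l => n p.i) (hn.weaken _ _) (hl'.weaken _ _)
    (FP.var _ _ _)

theorem FPd.span_eq {l l' : ∀ i, List (Perm (Fin (n i)))} (hn : FP Γ fun i => .ofNat (n i))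
    (hl : FP Γ fun i => encL .ofPerm (l i)) (hl' : FP Γ fun i => encL .ofPerm (l' i)) :
    FPd Γ fun i => span (l i) = span (l' i) :=
  ((FPd.span_le hn hl hl').and (FPd.span_le hn hl' hl)).congr fun _ => le_antisymm_iff.symm

theorem FP.encL_twisted {l : ∀ i, List (Perm (Fin (n i)) × Perm (Fin (n i)) × Fin 2)}
    (hpos : ∀ i, 0 < n i) (hn : FP Γ fun i => .ofNat (n i))
    (h : FP Γ fun i => encL .ofPerm ((l i).map wr)) : FP Γ fun i => encL encTwisted (l i) := by
  have h' : FP Γ fun i => encL (fun t => .ofPerm (wr t)) (l i) := h.congr fun i => encL_map _ _ _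
  refine (h'.map (e' := fun _ => encTwisted) (y := fun _ t => t) ?_).congr fun i => by
    rw [List.map_id']
  have hv := FP.var Γ (fun p : MemIx l => p.i) fun p => .ofPerm (wr p.b)
  have hn' := hn.weaken (fun p : MemIx l => p.i) fun p => .ofPerm (wr p.b)
  exact (hn'.perm_wr_fst hv).cons ((hn'.perm_wr_snd hv).cons
    (hn'.perm_wr_third (fun p => hpos p.i) hv))

theorem FP.shiftGens {u : ∀ i, Perm (Fin (n i))}
    {l : ∀ i, List (Perm (Fin (n i)) × Perm (Fin (n i)) × Fin 2)}
    (hn : FP Γ fun i => .ofNat (n i)) (hu : FP Γ fun i => .ofPerm (u i))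
    (hl : FP Γ fun i => encL encTwisted (l i)) :
    FP Γ fun i => encL .ofPerm (shiftGens (u i) (l i)) := by
  refine hl.flatMap (e' := fun _ => Data.ofPerm) ?_
  have hv := FP.var Γ (fun p : MemIx l => p.i) fun p => encTwisted p.b
  have hn' := hn.weaken (fun p : MemIx l => p.i) fun p => encTwisted p.b
  have hu' := hu.weaken (fun p : MemIx l => p.i) fun p => encTwisted p.b
  exact (FPd.fin_eq hv.snd.snd (FP.fin _ 0)).ite (e := fun _ => encL Data.ofPerm)
    (hv.fst.cons ((hn'.perm_mul (hn'.perm_mul hu' hv.snd.fst) (hn'.perm_inv hu')).cons (FP.nil _)))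
    ((hn'.perm_mul hu' hv.fst).cons ((hn'.perm_mul hv.snd.fst (hn'.perm_inv hu')).cons (FP.nil _)))

/-- The list required by `RoundPasses` exists iff every permutation in the answer has the form `wr
t`, and it is unique because `wr` is injective. So the existential quantifier reduces to a test
followed by a computation. -/
theorem FPd.roundPasses {x : ι → Input} {P : ι → GeneratorProgram} {u : ∀ i, (x i).G}
    (hn : FP Γ fun i => .ofNat (x i).n)
    (hu : FP Γ fun i => .ofPerm (u i : Perm (Fin (x i).n)))
    (hS : FP Γ fun i => encL .ofPerm (P i (x i)))
    (hL : FP Γ fun i => encL .ofPerm (P i (shiftInput (x i) (u i)))) :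
    FPd Γ fun i => RoundPasses (P i) (x i) (u i) := by
  have hd : FPd Γ fun i => ∀ g ∈ P i (shiftInput (x i) (u i)), ∃ t : Perm (Fin (x i).n) ×
      Perm (Fin (x i).n) × Fin 2, wr t = g :=
    FPd.forall_mem (r := fun i g => ∃ t : Perm (Fin (x i).n) × Perm (Fin (x i).n) × Fin 2,
      wr t = g) hL (FPd.exists_wr (n := fun p : MemIx fun i => P i (shiftInput (x i) (u i)) =>
        (x p.i).n) (hn.weaken _ _) (FP.var _ _ _))
  refine hd.cases ?_ (FPd.of_false _ fun j => ?_)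
  · have : ∀ j : {i // ∀ g ∈ P i (shiftInput (x i) (u i)), ∃ t : Perm (Fin (x i).n) ×
        Perm (Fin (x i).n) × Fin 2, wr t = g}, ∃ l : List (Perm (Fin (x j.1).n) ×
        Perm (Fin (x j.1).n) × Fin 2), l.map wr = P j.1 (shiftInput (x j.1) (u j.1)) := fun j =>
      (Set.range_list_map wr).ge j.2
    choose l hl using this
    let I := {i // ∀ g ∈ P i (shiftInput (x i) (u i)), ∃ t : Perm (Fin (x i).n) ×
      Perm (Fin (x i).n) × Fin 2, wr t = g}
    let Γ' := Γ.reindex (Subtype.val : I → ι)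
    have hn' : FP Γ' fun j => .ofNat (x j.1).n := hn.reindex _
    have hS' : FP Γ' fun j => encL .ofPerm (P j.1 (x j.1)) := hS.reindex _
    have hl' : FP Γ' fun j => encL encTwisted (l j) :=
      FP.encL_twisted (n := fun j : I => (x j.1).n) (fun j => (x j.1).n_pos) hn'
        ((hL.reindex _).congr fun j => by rw [hl]; rfl)
    have hf : FP Γ' fun j => encO encTwisted ((l j).find? fun s => decide (s.2.2 = 1)) := by
      refine hl'.find? (FPd.congr (p := fun p : MemIx l => p.b.2.2 = 1) ?_ fun p => by
        rw [decide_eq_true_iff])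
      exact FPd.fin_eq (FP.var Γ' (fun p : MemIx l => p.i) fun p => encTwisted p.b).snd.snd
        (FP.fin _ 1)
    refine FPd.congr (FPd.exists_mem (r := fun j t => span (HSP.shiftGens t.2.1 (l j)) =
      span (P j.1 (x j.1)) ∧ (u j.1 : Perm (Fin (x j.1).n)) * t.2.1⁻¹ ∈ span (P j.1 (x j.1)))
      hf ?_) fun j => ?_
    · let κ := MemIx fun j : I => ((l j).find? fun s => decide (s.2.2 = 1)).toList
      have hv := FP.var Γ' (fun p : κ => p.i) fun p => encTwisted p.b
      have hn₁ := hn'.weaken (fun p : κ => p.i) fun p => encTwisted p.b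
      have hS₁ := hS'.weaken (fun p : κ => p.i) fun p => encTwisted p.b
      exact (FPd.span_eq hn₁ (hn₁.shiftGens hv.snd.fst (hl'.weaken _ _)) hS₁).and
        (FPd.mem_span hn₁ hS₁ (hn₁.perm_mul ((hu.reindex _).weaken _ _)
          (hn₁.perm_inv hv.snd.fst)))
    · constructor
      · rintro ⟨t, ht, h₁, h₂⟩
        exact ⟨l j, t, (hl j).symm, Option.mem_toList.1 ht, h₁, h₂⟩
      · rintro ⟨l', t, h, ht, h₁, h₂⟩
        obtain rfl := List.map_injective_iff.2 (wr_injective (x j.1).n_pos) ((hl j).trans h)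
        exact ⟨t, Option.mem_toList.2 ht, h₁, h₂⟩
  · rintro ⟨l, t, h, -⟩
    refine j.2 fun g hg => ?_
    rw [h] at hg
    obtain ⟨t, -, rfl⟩ := List.mem_map.1 hg
    exact ⟨t, rfl⟩

end

theorem fp_checkGenerators : FP (decideCtx (fun (P : GeneratorProgram) q => Data.ofPerms (P q))
    generatorQuestions) fun j => (checkGenerators j.2 j.1.1.1 j.1.2).code := by
  let Δ := decideCtx (fun (P : GeneratorProgram) q => Data.ofPerms (P q)) generatorQuestions
  have hn : FP Δ fun j => .ofNat j.1.1.1.n := fp_decide_weaken fp_draw_n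
  have hg : FP Δ fun j => encL .ofPerm j.1.1.1.gens := fp_decide_weaken fp_draw_gens
  have hu : FP Δ fun j => encL (fun u : j.1.1.1.G => .ofPerm (u : Perm (Fin j.1.1.1.n)))
    (List.ofFn j.1.2) := fp_decide_weaken fp_draw
  have hz : FP Δ fun j => encL (fun s => .cons s.code (.ofPerms (j.2 s.input)))
    (generatorQuestions j.1) := fp_decide_questions
  have hS : FP Δ fun j => encL .ofPerm (j.2 j.1.1.1) :=
    FP.lookup (s := fun j : DrawIx × GeneratorProgram => (⟨none, none⟩ : Question j.1.1.1))
      (A := fun (j : DrawIx × GeneratorProgram) s => encL .ofPerm (j.2 s.input)) hz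
      (hn.cons ((FP.nil _).cons (FP.nil _))) fun j => List.mem_cons_self
  refine FPd.verdict (FPd.congr (p := fun j : DrawIx × GeneratorProgram =>
    (∀ s ∈ j.2 j.1.1.1, s ∈ span j.1.1.1.gens ∧ j.1.1.1.ev s = j.1.1.1.ev 1) ∧
      ∀ u ∈ List.ofFn j.1.2, RoundPasses j.2 j.1.1.1 u) (FPd.and ?_ ?_) fun j => ?_)
  · refine FPd.forall_mem (r := fun (j : DrawIx × GeneratorProgram) s =>
      s ∈ span j.1.1.1.gens ∧ j.1.1.1.ev s = j.1.1.1.ev 1) hS ?_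
    let κ := MemIx fun j : DrawIx × GeneratorProgram => j.2 j.1.1.1
    have hv := FP.var Δ (fun p : κ => p.i) fun p => .ofPerm p.b
    have hn' := hn.weaken (fun p : κ => p.i) fun p => .ofPerm p.b
    have hN := pBd_decide_size.weaken (Γ := Δ) (fun p : κ => p.i) fun p => .ofPerm p.b
    exact (FPd.mem_span hn' (hg.weaken _ _) hv).and (FPd.eq_data
      (FP.ev (x := fun p : κ => p.i.1.1.1) (k := fun p => p.i.1.1.2) (g := fun p => p.b)
        (fun _ => rfl) hN hv)
      (FP.ev (x := fun p : κ => p.i.1.1.1) (k := fun p => p.i.1.1.2) (g := fun p => 1)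
        (fun _ => rfl) hN hn'.perm_one))
  · refine FPd.forall_mem (r := fun (j : DrawIx × GeneratorProgram) u =>
      RoundPasses j.2 j.1.1.1 u) hu ?_
    let κ := MemIx fun j : DrawIx × GeneratorProgram => List.ofFn j.1.2
    have hv := FP.var Δ (fun p : κ => p.i) fun p => .ofPerm (p.b : Perm (Fin p.i.1.1.1.n))
    have hn' := hn.weaken (fun p : κ => p.i) fun p => .ofPerm (p.b : Perm (Fin p.i.1.1.1.n))
    refine FPd.roundPasses (x := fun p : κ => p.i.1.1.1) (P := fun p => p.i.2)
      (u := fun p => p.b) hn' hv (hS.weaken _ _) ?_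
    exact FP.lookup (s := fun p : κ => (⟨some p.b, none⟩ : Question p.i.1.1.1))
      (A := fun p s => encL .ofPerm (p.i.2 s.input)) (hz.weaken _ _)
      (hn'.cons ((FP.encO_some (e := fun p : κ => fun u : p.i.1.1.1.G =>
        .ofPerm (u : Perm (Fin p.i.1.1.1.n))) hv).cons (FP.nil _)))
      fun p => List.mem_cons_of_mem _ (List.mem_map.2 ⟨p.b, p.mem, rfl⟩)
  · rw [checkGenerators]
    split
    · rename_i h
      refine iff_of_true ⟨h.1, fun u hu => ?_⟩ rfl
      obtain ⟨r, rfl⟩ := List.mem_ofFn.1 hu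
      exact h.2 r
    · rename_i h
      refine iff_of_false (fun h' => h ⟨h'.1, fun r => h'.2 _ (List.mem_ofFn.2 ⟨r, rfl⟩)⟩) ?_
      simp

theorem exists_generatorMachine : ∃ M : Machine,
    M.Implements (fun (P : GeneratorProgram) q => Data.ofPerms (P q)) generatorChecker ∧
    M.PolyTime (fun (P : GeneratorProgram) q => Data.ofPerms (P q)) ∧
    ∀ (x : Input) (k : ℕ), (∃ H, x.Hides H) → ∀ w t out qs,
      M.Asks x k w t out qs → qs.length = k + 1 := by
  classical
  obtain ⟨M, hM, hT, hA⟩ := exists_machine (V := fun P i => checkGenerators P i.1.1 i.2)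
    fp_generatorQuestions fp_checkGenerators
  refine ⟨M, fun P x k _ v => (hM P x k v).trans ?_, hT, fun x k _ w t out qs h => ?_⟩
  · rw [generatorChecker, map_uniform_apply]
  · obtain ⟨u, -, rfl⟩ := hA x k w t out qs h
    simp [generatorQuestions]

end HSP

end
-- The main theorem
theorem mainTheorem9 :
    -- the checker for the decision version
    (∀ R : HSP.StabRoutine, R.IsCorrect →
      (∀ P : HSP.DecisionProgram, P.IsCorrect →
        ∀ (x : HSP.Input) (H : Subgroup x.G), x.Hides H → ∀ k : ℕ,
          HSP.decisionChecker R P x k = PMF.pure HSP.Verdict.correct) ∧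
      (∀ (P : HSP.DecisionProgram) (x : HSP.Input) (H : Subgroup x.G), x.Hides H →
        ¬ HSP.RightAnswer H (P x) → ∀ k : ℕ,
          HSP.decisionChecker R P x k HSP.Verdict.correct ≤ 2⁻¹ ^ k)) ∧
    (∃ R : HSP.StabRoutine, R.IsCorrect ∧ ∃ M : HSP.Machine,
      M.Implements (fun (P : HSP.DecisionProgram) q => (P q).code) (HSP.decisionChecker R) ∧
      M.PolyTime (fun (P : HSP.DecisionProgram) q => (P q).code)) ∧
    -- the checker for generators
    (∀ P : HSP.GeneratorProgram, P.IsCorrect →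
      ∀ (x : HSP.Input) (H : Subgroup x.G), x.Hides H → ∀ k : ℕ,
        HSP.generatorChecker P x k = PMF.pure HSP.Verdict.correct) ∧
    (∀ (P : HSP.GeneratorProgram) (x : HSP.Input) (H : Subgroup x.G), x.Hides H →
      ¬ HSP.RightGenerators H (P x) → ∀ k : ℕ,
        HSP.generatorChecker P x k HSP.Verdict.correct ≤ 2⁻¹ ^ k) ∧
    (∃ M : HSP.Machine,
      M.Implements (fun (P : HSP.GeneratorProgram) q => HSP.Data.ofPerms (P q))
        HSP.generatorChecker ∧
      M.PolyTime (fun (P : HSP.GeneratorProgram) q => HSP.Data.ofPerms (P q)) ∧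
      ∀ (x : HSP.Input) (k : ℕ), (∃ H, x.Hides H) → ∀ w t out qs,
        M.Asks x k w t out qs → qs.length = k + 1) := by
  refine ⟨fun R hR => ⟨fun P hP x H h k => HSP.decisionChecker_eq_pure hP hR h k,
    fun P x H h hP k => HSP.decisionChecker_correct_le h hP k⟩,
    ⟨HSP.chainRoutine, HSP.chainRoutine_isCorrect, HSP.exists_decisionMachine⟩,
    fun P hP x H h k => HSP.generatorChecker_eq_pure hP h k,
    fun P x H h hP k => HSP.generatorChecker_correct_le h hP k, HSP.exists_generatorMachine⟩
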